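/- **Corollary 6.1.** Let $d\ge 1$. *Frolov's rule.* Let $\xi_1<\dots<\xi_d$ be the (real, simple) roots of $P_d(t)=\prod_{j=1}^d(t-2j+1)-1$, let $\widetilde T=(\xi_i^{j-1})_{i,j=1}^d$, $T_n=(n\det\widetilde T)^{-1/d}\,\widetilde T$ and $\mathbb X_n=T_n(\mathbb Z^d)$. Frolov's cubature formula is $$Q_n(f)=\frac1n\sum_{x\in\mathbb X_n\cap[0,1)^d}f(x).$$ *Spaces.* Fix $s\in\mathbb R$, an integer $L\ge0$ with $L+1>s$, and $\Psi_0,\Psi_1\in C_0^\infty(\mathbb R)$ such that for some $\varepsilon>0$: $\mathcal F\Psi_0(\xi)\ne0$ for $|\xi|<\varepsilon$, $\mathcal F\Psi_1(\xi)\neq0$ for $\varepsilon/2<|\xi|<2\varepsilon$, and $D^\alpha\mathcal F\Psi_1(0)=0$ for $0\le\alpha\le L$. Put $\Psi_j=2^{j-1}\Psi_1(2^{j-1}\,\cdot)$ for $j\ge1$, and $\Psi_m(x)=\prod_{i=1}^d\Psi_{m_i}(x_i)$ for $m\in\mathbb N_0^d$. For tempered distributions $f$ on $\mathbb R^d$ and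 $0<\theta<\infty$ let $$\|f\|_{\mathbf B^s_{p,\theta}}=\Big(\sum_{m\in\mathbb N_0^d}2^{s|m|_1\theta}\|\Psi_m*f\|_p^\theta\Big)^{1/\theta},\qquad \|f\|_{\mathbf F^s_{p,\theta}}=\Big\|\Big(\sum_{m\in\mathbb N_0^d}2^{s|m|_1\theta}|\Psi_m*f|^\theta\Big)^{1/\theta}\Big\|_p ,$$ where $p<\infty$ in the $\mathbf F$-case. For $\mathbf A\in\{\mathbf B,\mathbf F\}$ let $\mathring{\mathbf A}^s_{p,\theta}$ be the space of all $f$ with $\|f\|_{\mathbf A^s_{p,\theta}}<\infty$ and $\operatorname{supp} f\subset[0,1]^d$. If $p\ge1$ and $s>1/p$, all its elements are (represented by) bounded continuous functions, and the worst-case error is $$e(Q_n,\mathring{\mathbf A}^s_{p,\theta})=\sup\Big\{\Big|\int_{[0,1]^d}f(x)\,dx-Q_n(f)\Big| : f\in\mathring{\mathbf A}^s_{p,\theta},\ \|f\|_{\mathbf A^s_{p,\theta}}\le1\Big\}.$$ Write $a_n\lesssim b_n$ if there is a constant $c>0$, independent of $n$, with $a_n\le c\,b_n$ for all $n\ge2$,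 and $a_n\asymp b_n$ if $a_n\lesssim b_n$ and $b_n\lesssim a_n$. *Claim.* Let $1\le p\le\infty$ (with $p<\infty$ in the $\mathbf F$-case), $0<\theta<1$ and $s>1/p$. (i) $e(Q_n,\mathring{\mathbf B}^s_{p,\theta})\asymp n^{-s}$. (ii) If $s\ge1$, then $e(Q_n,\mathring{\mathbf F}^s_{p,\theta})\asymp n^{-s}$. (iii) If $1/p<s<1$, then $e(Q_n,\mathring{\mathbf F}^s_{p,\theta})\lesssim n^{-s}(\log n)^{(d-1)(1-s)}$. -/

import Mathlib

open MeasureTheory SchwartzMap Polynomial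
open scoped ENNReal NNReal FourierTransform BoundedContinuousFunction

namespace FrolovCubature

noncomputable section

/-- The space `ℝ^d`. -/
abbrev Rd (d : ℕ) : Type := EuclideanSpace ℝ (Fin d)

/-- The closed unit cube `[0,1]^d`. -/
def unitCube (d : ℕ) : Set (Rd d) := {x | ∀ i, x i ∈ Set.Icc (0 : ℝ) 1}

/-- The half-open unit cube `[0,1)^d`. -/
def halfOpenCube (d : ℕ) : Set (Rd d) := {x | ∀ i, x i ∈ Set.Ico (0 : ℝ) 1}

/-! ### Frolov's cubature formula -/

/-- `P_d(t) = ∏_{j=1}^d (t - 2j + 1) - 1`. -/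
def frolovPoly (d : ℕ) : ℝ[X] :=
  (∏ j ∈ Finset.Icc 1 d, (X - C (2 * (j : ℝ) - 1))) - 1

/-- The roots `ξ_1 < ⋯ < ξ_d` of `P_d` (which are real and simple), in increasing order, so that
the Vandermonde determinant below is positive. -/
def frolovRoot (d : ℕ) (i : Fin d) : ℝ :=
  ((frolovPoly d).roots.sort (· ≤ ·)).getD i 0

/-- The Vandermonde matrix `(ξ_i^{j-1})_{i,j=1}^d`. -/
def frolovMatrix (d : ℕ) : Matrix (Fin d) (Fin d) ℝ :=
  Matrix.vandermonde (frolovRoot d)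

/-- The generator `T_n = (n det T)^{-1/d} T` of the lattice, where `T` is the Vandermonde matrix. -/
def frolovGenerator (d n : ℕ) : Matrix (Fin d) (Fin d) ℝ :=
  ((n : ℝ) * (frolovMatrix d).det) ^ (-(1 / (d : ℝ))) • frolovMatrix d

/-- The lattice `X_n = T_n(ℤ^d)`. -/
def frolovLattice (d n : ℕ) : Set (Rd d) :=
  Set.range fun z : Fin d → ℤ =>
    WithLp.toLp 2 (Matrix.mulVec (frolovGenerator d n) fun i => (z i : ℝ))

/-- Frolov's cubature formula `Q_n(f) = n⁻¹ ∑_{x ∈ X_n ∩ [0,1)^d} f(x)` (a finite sum). -/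
def frolovRule (d n : ℕ) (f : Rd d → ℂ) : ℂ :=
  (n : ℂ)⁻¹ * ∑ᶠ x ∈ frolovLattice d n ∩ halfOpenCube d, f x

/-! ### Local means -/

/-- A pair of generators `Ψ₀, Ψ₁ ∈ C₀^∞(ℝ)` of a system of local means: for some `ε > 0` the Fourier
transform of `Ψ₀` has no zero in `|ξ| < ε`, that of `Ψ₁` has no zero in `ε/2 < |ξ| < 2ε`, and the
derivatives of the latter vanish at the origin up to and including the order `L`. -/
structure LocalMeansKernel (L : ℕ) where
  psi0 : 𝓢(ℝ, ℂ)
  psi1 : 𝓢(ℝ, ℂ)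
  hasCompactSupport_psi0 : HasCompactSupport psi0
  hasCompactSupport_psi1 : HasCompactSupport psi1
  tauberian : ∃ ε : ℝ, 0 < ε ∧
    (∀ ξ : ℝ, |ξ| < ε → 𝓕 (psi0 : ℝ → ℂ) ξ ≠ 0) ∧
    (∀ ξ : ℝ, ε / 2 < |ξ| → |ξ| < 2 * ε → 𝓕 (psi1 : ℝ → ℂ) ξ ≠ 0)
  moments : ∀ k : ℕ, k ≤ L → iteratedDeriv k (𝓕 (psi1 : ℝ → ℂ)) 0 = 0

namespace LocalMeansKernel

variable {L : ℕ} (K : LocalMeansKernel L)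

/-- `Ψ_0`, and `Ψ_j(t) = 2^{j-1} Ψ_1(2^{j-1} t)` for `j ≥ 1`. -/
def dilate : ℕ → ℝ → ℂ
  | 0 => fun t => K.psi0 t
  | j + 1 => fun t => (2 : ℂ) ^ j * K.psi1 ((2 : ℝ) ^ j * t)

/-- `Ψ_m(x) = ∏_i Ψ_{m_i}(x_i)`. -/
def tensor {d : ℕ} (m : Fin d → ℕ) (x : Rd d) : ℂ := ∏ i, K.dilate (m i) (x i)

theorem contDiff_dilate (j : ℕ) : ContDiff ℝ ((⊤ : ℕ∞) : WithTop ℕ∞) (K.dilate j) := by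
  cases j with
  | zero => exact K.psi0.smooth ⊤
  | succ j =>
    exact contDiff_const.mul ((K.psi1.smooth ⊤).comp (contDiff_const.mul contDiff_id))

theorem hasCompactSupport_dilate (j : ℕ) : HasCompactSupport (K.dilate j) := by
  cases j with
  | zero => exact K.hasCompactSupport_psi0
  | succ j =>
    have h : HasCompactSupport fun t : ℝ => K.psi1 ((2 : ℝ) ^ j * t) :=
      K.hasCompactSupport_psi1.comp_homeomorph
        (Homeomorph.mulLeft₀ ((2 : ℝ) ^ j) (by positivity))
    exact h.mul_left

theorem contDiff_tensor {d : ℕ} (m : Fin d → ℕ) :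
    ContDiff ℝ ((⊤ : ℕ∞) : WithTop ℕ∞) (K.tensor m) := by
  unfold tensor
  exact contDiff_prod fun i _ => (K.contDiff_dilate (m i)).comp (by fun_prop)

theorem hasCompactSupport_tensor {d : ℕ} (m : Fin d → ℕ) : HasCompactSupport (K.tensor m) := by
  have hc : IsCompact (Set.univ.pi fun i => tsupport (K.dilate (m i))) :=
    isCompact_univ_pi fun i => K.hasCompactSupport_dilate (m i)
  have hc' := (EuclideanSpace.equiv (Fin d) ℝ).toHomeomorph.isCompact_preimage.mpr hc
  refine HasCompactSupport.of_support_subset_isCompact hc' fun x hx i _ => ?_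
  refine subset_tsupport _ fun h => hx ?_
  exact Finset.prod_eq_zero (Finset.mem_univ i) h

/-- The test function `y ↦ Ψ_m(x - y)`. -/
def testFunction {d : ℕ} (m : Fin d → ℕ) (x : Rd d) : 𝓢(Rd d, ℂ) :=
  HasCompactSupport.toSchwartzMap (f := fun y => K.tensor m (x - y))
    ((K.hasCompactSupport_tensor m).comp_homeomorph (Homeomorph.subLeft x))
    ((K.contDiff_tensor m).comp (contDiff_const.sub contDiff_id))

/-- The convolution `(Ψ_m * u)(x) = u(Ψ_m(x - ·))` with a tempered distribution `u`. -/
def conv {d : ℕ} (u : 𝓢'(Rd d, ℂ)) (m : Fin d → ℕ) (x : Rd d) : ℂ := u (K.testFunction m x)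

/-! ### Function spaces of dominating mixed smoothness -/

/-- The weight `2^{s |m|_1}`. -/
def _root_.FrolovCubature.weight {d : ℕ} (s : ℝ) (m : Fin d → ℕ) : ℝ≥0∞ :=
  ENNReal.ofReal ((2 : ℝ) ^ (s * ∑ i, (m i : ℝ)))

/-- The Besov (quasi-)norm `(∑_m 2^{s|m|_1 θ} ‖Ψ_m * u‖_p^θ)^{1/θ}`, for `0 < θ < ∞`. -/
def besovNorm {d : ℕ} (s : ℝ) (p : ℝ≥0∞) (θ : ℝ) (u : 𝓢'(Rd d, ℂ)) : ℝ≥0∞ :=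
  (∑' m : Fin d → ℕ, (weight s m * eLpNorm (K.conv u m) p volume) ^ θ) ^ (1 / θ)

/-- The Triebel-Lizorkin (quasi-)norm `‖(∑_m 2^{s|m|_1 θ} |Ψ_m * u|^θ)^{1/θ}‖_p`,
for `0 < p, θ < ∞`. -/
def triebelLizorkinNorm {d : ℕ} (s : ℝ) (p : ℝ≥0∞) (θ : ℝ) (u : 𝓢'(Rd d, ℂ)) : ℝ≥0∞ :=
  eLpNorm (fun x => (∑' m : Fin d → ℕ, (weight s m * ‖K.conv u m x‖ₑ) ^ θ) ^ (1 / θ)) p volume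

end LocalMeansKernel

/-- For a (quasi-)norm `N` with values in `[0,∞]`: the tempered distributions `u` with `N u < ∞`
whose support is contained in `[0,1]^d`. -/
def supportedSpace {d : ℕ} (N : 𝓢'(Rd d, ℂ) → ℝ≥0∞) : Set 𝓢'(Rd d, ℂ) :=
  {u | N u < ∞ ∧ Distribution.dsupport u ⊆ unitCube d}

/-! ### Worst-case errors -/

/-- The tempered distribution `u` is the bounded continuous function `f`. -/
def Represents {d : ℕ} (f : Rd d →ᵇ ℂ) (u : 𝓢'(Rd d, ℂ)) : Prop :=
  ∀ φ : 𝓢(Rd d, ℂ), u φ = ∫ x, φ x * f x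

/-- The error `|∫_{[0,1]^d} f(x) dx - Q_n(f)|`, where `f` is the (unique) bounded continuous
function that represents `u`. It is `∞` if there is no such function, so that a finite worst-case
error entails that the elements of the class are continuous functions. -/
def cubatureError {d : ℕ} (n : ℕ) (u : 𝓢'(Rd d, ℂ)) : ℝ≥0∞ :=
  ⨅ (f : Rd d →ᵇ ℂ) (_ : Represents f u), ‖(∫ x in unitCube d, f x) - frolovRule d n f‖ₑ

/-- The worst-case error of `Q_n` over the unit ball of the space of all `u` supported in `[0,1]^d`
with `N u < ∞`. -/
def worstCaseError {d : ℕ} (n : ℕ) (N : 𝓢'(Rd d, ℂ) → ℝ≥0∞) : ℝ≥0∞ :=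
  ⨆ u ∈ {u | u ∈ supportedSpace N ∧ N u ≤ 1}, cubatureError n u

/-- `a_n ≲ b_n`, for `n ≥ 2`. -/
def AsympLE (a b : ℕ → ℝ≥0∞) : Prop :=
  ∃ c : ℝ≥0, 0 < c ∧ ∀ n : ℕ, 2 ≤ n → a n ≤ c * b n

/-- `a_n ≍ b_n`, for `n ≥ 2`. -/
def AsympEq (a b : ℕ → ℝ≥0∞) : Prop := AsympLE a b ∧ AsympLE b a

end

end FrolovCubature

open FrolovCubature

namespace FrolovCubature

noncomputable section

/-! ### The Frolov polynomial -/

/-- The Frolov polynomial with integer coefficients. -/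
def frolovPolyInt (d : ℕ) : ℤ[X] :=
  (∏ j ∈ Finset.Icc 1 d, (X - C (2 * (j : ℤ) - 1))) - 1

theorem map_frolovPolyInt (d : ℕ) :
    (frolovPolyInt d).map (Int.castRingHom ℝ) = frolovPoly d := by
  rw [frolovPolyInt, frolovPoly, Polynomial.map_sub, Polynomial.map_one, Polynomial.map_prod]
  congr 1
  refine Finset.prod_congr rfl fun j _ => ?_
  rw [Polynomial.map_sub, map_X, map_C]
  norm_cast

theorem frolovProd_monic (d : ℕ) :
    (∏ j ∈ Finset.Icc 1 d, (X - C (2 * (j : ℤ) - 1))).Monic :=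
  monic_prod_of_monic _ _ fun _ _ => monic_X_sub_C _

theorem frolovProd_natDegree (d : ℕ) :
    (∏ j ∈ Finset.Icc 1 d, (X - C (2 * (j : ℤ) - 1))).natDegree = d := by
  rw [natDegree_prod_of_monic _ _ fun _ _ => monic_X_sub_C _]
  simp only [natDegree_X_sub_C, Finset.sum_const, Nat.card_Icc, smul_eq_mul, mul_one,
    Nat.add_sub_cancel]

theorem frolovPolyInt_natDegree (d : ℕ) : (frolovPolyInt d).natDegree = d := by
  rw [frolovPolyInt, ← C_1, natDegree_sub_C, frolovProd_natDegree]

theorem frolovPolyInt_monic {d : ℕ} (hd : 1 ≤ d) : (frolovPolyInt d).Monic := by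
  refine (frolovProd_monic d).sub_of_left ?_
  rw [degree_eq_natDegree (frolovProd_monic d).ne_zero, frolovProd_natDegree, degree_one]
  exact_mod_cast hd

theorem frolovPolyInt_eval {d j : ℕ} (hj : j ∈ Finset.Icc 1 d) :
    (frolovPolyInt d).eval (2 * (j : ℤ) - 1) = -1 := by
  rw [frolovPolyInt, eval_sub, eval_prod, Finset.prod_eq_zero hj (by simp)]
  simp

/-- If `P = f g` with `f`, `g` monic and nonconstant, then `f g = -1` at the `d` odd integers `1, 3,
…, 2d - 1`, so one factor is `1` and the other `-1` there. Thus `f + g` has `d` zeros but degree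
below `d`, and `f = -g` contradicts monicity. -/
theorem frolovPolyInt_irreducible {d : ℕ} (hd : 1 ≤ d) : Irreducible (frolovPolyInt d) := by
  rw [Monic.irreducible_iff_natDegree (frolovPolyInt_monic hd)]
  constructor
  · intro h
    have := frolovPolyInt_natDegree d
    rw [h] at this
    simp at this
    omega
  · intro f g hf hg hfg
    by_contra! hne
    have hf0 := Nat.pos_of_ne_zero hne.1
    have hg0 := Nat.pos_of_ne_zero hne.2
    have hdeg : f.natDegree + g.natDegree = d := by
      rw [← hf.natDegree_mul hg, hfg, frolovPolyInt_natDegree]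
    have hroot : ∀ j ∈ Finset.Icc 1 d, (f + g).eval (2 * (j : ℤ) - 1) = 0 := by
      intro j hj
      have h := frolovPolyInt_eval hj
      rw [← hfg, eval_mul] at h
      rw [eval_add]
      have hu : f.eval (2 * (j : ℤ) - 1) * -(g.eval (2 * (j : ℤ) - 1)) = 1 := by linarith
      rcases Int.isUnit_iff.mp (IsUnit.of_mul_eq_one _ hu) with h1 | h1 <;>
        rw [h1] at h ⊢ <;> linarith
    have hzero : f + g = 0 := by
      refine eq_zero_of_natDegree_lt_card_of_eval_eq_zero' (f + g)
        ((Finset.Icc 1 d).image fun j : ℕ => 2 * (j : ℤ) - 1) ?_ ?_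
      · intro x hx
        obtain ⟨j, hj, rfl⟩ := Finset.mem_image.mp hx
        exact hroot j hj
      · rw [Finset.card_image_of_injective _ (fun a b h => by simpa using h), Nat.card_Icc]
        have := natDegree_add_le f g
        omega
    have : f = -g := eq_neg_of_add_eq_zero_left hzero
    have h1 : f.leadingCoeff = (-g).leadingCoeff := by rw [← this]
    rw [leadingCoeff_neg, hf.leadingCoeff, hg.leadingCoeff] at h1
    norm_num at h1

/-- A root of the Frolov polynomial is not a root of an integer polynomial of smaller degree. -/
theorem aeval_ne_zero_of_frolovPoly_root {d : ℕ} (hd : 1 ≤ d) {ξ : ℝ}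
    (hξ : (frolovPoly d).eval ξ = 0) {q : ℤ[X]} (hq : q ≠ 0) (hdeg : q.degree < d) :
    aeval ξ q ≠ 0 := by
  intro h0
  have hirr : Irreducible ((frolovPolyInt d).map (algebraMap ℤ ℚ)) :=
    ((frolovPolyInt_monic hd).irreducible_iff_irreducible_map_fraction_map (K := ℚ)).mp
      (frolovPolyInt_irreducible hd)
  have hmon : ((frolovPolyInt d).map (algebraMap ℤ ℚ)).Monic := (frolovPolyInt_monic hd).map _
  have hroot : aeval ξ ((frolovPolyInt d).map (algebraMap ℤ ℚ)) = 0 := by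
    rw [aeval_map_algebraMap, aeval_def, ← eval_map, algebraMap_int_eq, map_frolovPolyInt, hξ]
  have hmin := minpoly.eq_of_irreducible_of_monic hirr hroot hmon
  have hq' : q.map (algebraMap ℤ ℚ) ≠ 0 := by
    rwa [Ne, Polynomial.map_eq_zero_iff (algebraMap ℤ ℚ).injective_int]
  have h1 : aeval ξ (q.map (algebraMap ℤ ℚ)) = 0 := by rw [aeval_map_algebraMap, h0]
  have h2 := minpoly.degree_le_of_ne_zero ℚ ξ hq' h1
  rw [← hmin, (frolovPolyInt_monic hd).degree_map,
    degree_eq_natDegree (frolovPolyInt_monic hd).ne_zero, frolovPolyInt_natDegree] at h2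
  exact absurd (h2.trans degree_map_le) (not_le.mpr hdeg)

/-! ### The roots of the Frolov polynomial -/

theorem frolovPoly_eval (d : ℕ) (t : ℝ) :
    (frolovPoly d).eval t = (∏ j ∈ Finset.Icc 1 d, (t - (2 * (j : ℝ) - 1))) - 1 := by
  simp [frolovPoly, eval_prod]

theorem frolovPoly_eval_odd {d i : ℕ} (hi : i ∈ Finset.Icc 1 d) :
    (frolovPoly d).eval (2 * (i : ℝ) - 1) = -1 := by
  rw [frolovPoly_eval, Finset.prod_eq_zero hi (by simp)]
  simp

/-- The value `∏_j (2k - 2j + 1)`, up to its sign, is at least one. -/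
theorem one_le_sign_mul_prod (d k : ℕ) (hk : k ≤ d) :
    1 ≤ (-1 : ℝ) ^ (d - k) * ∏ j ∈ Finset.Icc 1 d, (2 * (k : ℝ) - (2 * (j : ℝ) - 1)) := by
  induction d, hk using Nat.le_induction with
  | base =>
    simp only [Nat.sub_self, pow_zero, one_mul]
    refine Finset.one_le_prod fun j hj => ?_
    have : (j : ℝ) ≤ k := by exact_mod_cast (Finset.mem_Icc.mp hj).2
    linarith
  | succ d hk ih =>
    rw [Nat.sub_add_comm hk, Finset.prod_Icc_succ_top (by omega), pow_succ]
    have hkd : (k : ℝ) ≤ d := by exact_mod_cast hk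
    push_cast
    nlinarith

/-- For `k + 2 ≤ d` the factor with `j = d` is at most `-3`, which makes the inequality strict.
Strictness keeps the even integer `2k` from being a root. -/
theorem one_lt_sign_mul_prod (d k : ℕ) (hk : k + 2 ≤ d) :
    1 < (-1 : ℝ) ^ (d - k) * ∏ j ∈ Finset.Icc 1 d, (2 * (k : ℝ) - (2 * (j : ℝ) - 1)) := by
  obtain ⟨e, rfl⟩ : ∃ e, d = e + 1 := ⟨d - 1, by omega⟩
  have hke : k + 1 ≤ e := by omega
  have ih := one_le_sign_mul_prod e k (by omega)
  rw [Nat.sub_add_comm (by omega : k ≤ e), Finset.prod_Icc_succ_top (by omega), pow_succ]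
  have hkd : (k : ℝ) + 1 ≤ e := by exact_mod_cast hke
  push_cast
  nlinarith

/-- The polynomial equals `-1` at `2i - 1` and is nonnegative at one of the neighbours `2i`, `2i -
2`, according to the parity of `d - i`. The half-open intervals are disjoint, so this yields `d`
distinct roots, which is all of them. -/
theorem exists_frolovPoly_root {d i : ℕ} (hi : i ∈ Finset.Icc 1 d) :
    ∃ ξ ∈ Set.Ioc (2 * (i : ℝ) - 2) (2 * i), (frolovPoly d).eval ξ = 0 := by
  have hi' := Finset.mem_Icc.mp hi
  have hodd := frolovPoly_eval_odd hi
  have hcont : Continuous fun t => (frolovPoly d).eval t := (frolovPoly d).continuous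
  rcases Nat.even_or_odd (d - i) with he | ho
  · have h := one_le_sign_mul_prod d i hi'.2
    rw [he.neg_one_pow, one_mul] at h
    have hpos : 0 ≤ (frolovPoly d).eval (2 * (i : ℝ)) := by rw [frolovPoly_eval]; linarith
    obtain ⟨ξ, hξ, h0⟩ := intermediate_value_Icc (by linarith : 2 * (i : ℝ) - 1 ≤ 2 * i)
      hcont.continuousOn (show (0 : ℝ) ∈ Set.Icc _ _ from ⟨by rw [hodd]; norm_num, hpos⟩)
    exact ⟨ξ, ⟨by linarith [hξ.1], hξ.2⟩, h0⟩
  · have hlt : i < d := by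
      rcases Nat.lt_or_ge i d with h | h
      · exact h
      · rw [Nat.sub_eq_zero_of_le h] at ho; simp at ho
    have h := one_lt_sign_mul_prod d (i - 1) (by omega)
    have he : Even (d - (i - 1)) := by
      have : d - (i - 1) = (d - i) + 1 := by omega
      rw [this]; exact ho.add_one
    rw [he.neg_one_pow, one_mul, Nat.cast_sub hi'.1, Nat.cast_one] at h
    have hpos : 0 < (frolovPoly d).eval (2 * ((i : ℝ) - 1)) := by rw [frolovPoly_eval]; linarith
    obtain ⟨ξ, hξ, h0⟩ := intermediate_value_Icc' (by linarith : 2 * ((i : ℝ) - 1) ≤ 2 * i - 1)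
      hcont.continuousOn (show (0 : ℝ) ∈ Set.Icc _ _ from ⟨by rw [hodd]; norm_num, hpos.le⟩)
    refine ⟨ξ, ⟨lt_of_le_of_ne (by linarith [hξ.1]) ?_, by linarith [hξ.2]⟩, h0⟩
    intro h2
    have h3 : (frolovPoly d).eval ξ = 0 := h0
    rw [show 2 * ((i : ℝ) - 1) = ξ by linarith, h3] at hpos
    exact lt_irrefl _ hpos

theorem frolovPoly_monic {d : ℕ} (hd : 1 ≤ d) : (frolovPoly d).Monic := by
  rw [← map_frolovPolyInt]; exact (frolovPolyInt_monic hd).map _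

theorem frolovPoly_natDegree {d : ℕ} (hd : 1 ≤ d) : (frolovPoly d).natDegree = d := by
  rw [← map_frolovPolyInt, (frolovPolyInt_monic hd).natDegree_map, frolovPolyInt_natDegree]

theorem frolovPoly_roots {d : ℕ} (hd : 1 ≤ d) :
    (frolovPoly d).roots.Nodup ∧ (frolovPoly d).roots.card = d := by
  classical
  choose! r hr h0 using fun i (hi : i ∈ Finset.Icc 1 d) => exists_frolovPoly_root hi
  have hinj : Set.InjOn r (Finset.Icc 1 d : Finset ℕ) := by
    intro i hi j hj hij
    have h1 := hr i hi
    have h2 := hr j hj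
    rw [hij] at h1
    have a : (i : ℝ) < j + 1 := by linarith [h1.1, h2.2]
    have b : (j : ℝ) < i + 1 := by linarith [h2.1, h1.2]
    have a' : i < j + 1 := by exact_mod_cast a
    have b' : j < i + 1 := by exact_mod_cast b
    omega
  have hsub : (Finset.Icc 1 d).image r ⊆ (frolovPoly d).roots.toFinset := by
    intro x hx
    obtain ⟨i, hi, rfl⟩ := Finset.mem_image.mp hx
    rw [Multiset.mem_toFinset, mem_roots (frolovPoly_monic hd).ne_zero]
    exact h0 i hi
  have hcard := Finset.card_le_card hsub
  rw [Finset.card_image_of_injOn hinj, Nat.card_Icc, Nat.add_sub_cancel] at hcard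
  have h1 := Multiset.toFinset_card_le (frolovPoly d).roots
  have h2 := card_roots' (frolovPoly d)
  rw [frolovPoly_natDegree hd] at h2
  refine ⟨Multiset.toFinset_card_eq_card_iff_nodup.mp (by omega), by omega⟩

theorem frolovRoot_eval {d : ℕ} (hd : 1 ≤ d) (i : Fin d) :
    (frolovPoly d).eval (frolovRoot d i) = 0 := by
  have hlen : ((frolovPoly d).roots.sort (· ≤ ·)).length = d := by
    rw [Multiset.length_sort, (frolovPoly_roots hd).2]
  have hi : (i : ℕ) < ((frolovPoly d).roots.sort (· ≤ ·)).length := by rw [hlen]; exact i.2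
  have : frolovRoot d i ∈ (frolovPoly d).roots := by
    rw [frolovRoot, List.getD_eq_getElem _ _ hi, ← Multiset.mem_sort (r := (· ≤ ·))]
    exact List.getElem_mem hi
  exact (mem_roots (frolovPoly_monic hd).ne_zero).mp this

theorem frolovRoot_strictMono {d : ℕ} (hd : 1 ≤ d) : StrictMono (frolovRoot d) := by
  have hlen : ((frolovPoly d).roots.sort (· ≤ ·)).length = d := by
    rw [Multiset.length_sort, (frolovPoly_roots hd).2]
  intro i j hij
  have hi : (i : ℕ) < ((frolovPoly d).roots.sort (· ≤ ·)).length := by rw [hlen]; exact i.2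
  have hj : (j : ℕ) < ((frolovPoly d).roots.sort (· ≤ ·)).length := by rw [hlen]; exact j.2
  rw [frolovRoot, frolovRoot, List.getD_eq_getElem _ _ hi, List.getD_eq_getElem _ _ hj]
  have hs : ((frolovPoly d).roots.sort (· ≤ ·)).Pairwise (· ≤ ·) :=
    Multiset.pairwise_sort _ _
  have hn : ((frolovPoly d).roots.sort (· ≤ ·)).Nodup := by
    rw [← Multiset.coe_nodup, Multiset.sort_eq]; exact (frolovPoly_roots hd).1
  refine lt_of_le_of_ne (List.pairwise_iff_getElem.mp hs i j hi hj hij) fun h => ?_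
  exact absurd (hn.getElem_inj_iff.mp h) (ne_of_lt hij)

theorem frolovMatrix_det_pos {d : ℕ} (hd : 1 ≤ d) : 0 < (frolovMatrix d).det := by
  rw [frolovMatrix, Matrix.det_vandermonde]
  refine Finset.prod_pos fun i _ => Finset.prod_pos fun j hj => ?_
  exact sub_pos.mpr (frolovRoot_strictMono hd (Finset.mem_Ioi.mp hj))

/-! ### Admissibility of the Frolov lattice and of its dual -/

/-- The integer polynomial with a given vector of coefficients. -/
def vecPoly {d : ℕ} (z : Fin d → ℤ) : ℤ[X] := ∑ j : Fin d, C (z j) * X ^ (j : ℕ)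

theorem vecPoly_degree_lt {d : ℕ} (z : Fin d → ℤ) : (vecPoly z).degree < d := by
  refine degree_sum_fin_lt z

theorem vecPoly_ne_zero {d : ℕ} {z : Fin d → ℤ} (hz : z ≠ 0) : vecPoly z ≠ 0 := by
  obtain ⟨i, hi⟩ := Function.ne_iff.mp hz
  intro h
  apply hi
  have h1 := congrArg (fun q => coeff q (i : ℕ)) h
  simp only [vecPoly, finsetSum_coeff, coeff_C_mul, coeff_X_pow, coeff_zero] at h1
  rw [Finset.sum_eq_single i] at h1
  · simpa using h1
  · intro j _ hj
    rw [if_neg (fun h => hj (Fin.ext h.symm)), mul_zero]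
  · simp

theorem aeval_vecPoly {d : ℕ} (z : Fin d → ℤ) (i : Fin d) :
    aeval (frolovRoot d i) (vecPoly z) = (frolovMatrix d).mulVec (fun j => (z j : ℝ)) i := by
  simp only [vecPoly, map_sum, map_mul, map_pow, aeval_X, Matrix.mulVec, dotProduct,
    frolovMatrix, Matrix.vandermonde_apply, eq_intCast, map_intCast]
  exact Finset.sum_congr rfl fun j _ => mul_comm _ _

theorem frolovMatrix_mulVec_ne_zero {d : ℕ} (hd : 1 ≤ d) {z : Fin d → ℤ} (hz : z ≠ 0)
    (i : Fin d) : (frolovMatrix d).mulVec (fun j => (z j : ℝ)) i ≠ 0 := by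
  rw [← aeval_vecPoly]
  exact aeval_ne_zero_of_frolovPoly_root hd (frolovRoot_eval hd i) (vecPoly_ne_zero hz)
    (vecPoly_degree_lt z)

/-- At the roots, an integer polynomial agrees with its remainder modulo the Frolov polynomial. -/
theorem sum_coeff_modByMonic {d : ℕ} (hd : 1 ≤ d) (q : ℤ[X]) (i : Fin d) :
    ∑ b : Fin d, frolovRoot d i ^ (b : ℕ) * ((q %ₘ frolovPolyInt d).coeff b : ℝ) =
      aeval (frolovRoot d i) q := by
  have hroot : aeval (frolovRoot d i) (frolovPolyInt d) = 0 := by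
    rw [aeval_def, ← eval_map, algebraMap_int_eq, map_frolovPolyInt, frolovRoot_eval hd]
  have hdeg : (q %ₘ frolovPolyInt d).natDegree < d := by
    have := natDegree_modByMonic_lt q (frolovPolyInt_monic hd) (by
      intro h
      have h2 := frolovPolyInt_natDegree d
      rw [h, natDegree_one] at h2
      omega)
    rwa [frolovPolyInt_natDegree] at this
  have h := aeval_modByMonic_eq_self_of_root (p := q) hroot
  rw [← h, aeval_eq_sum_range' hdeg, ← Fin.sum_univ_eq_sum_range
    (fun b => (q %ₘ frolovPolyInt d).coeff b • frolovRoot d i ^ b)]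
  exact Finset.sum_congr rfl fun b _ => by rw [zsmul_eq_mul, mul_comm]

/-- The lattice `V ℤ^d` is admissible: the product of the coordinates of each nonzero point is at
least one in absolute value. -/
theorem one_le_prod_frolovMatrix_mulVec {d : ℕ} (hd : 1 ≤ d) {z : Fin d → ℤ} (hz : z ≠ 0) :
    1 ≤ ∏ i, |(frolovMatrix d).mulVec (fun j => (z j : ℝ)) i| := by
  set w := (frolovMatrix d).mulVec (fun j => (z j : ℝ))
  -- The matrix of multiplication by `vecPoly z` on `ℤ[X]/(P)` in the monomial basis. The
  -- Vandermonde matrix diagonalizes it, so its integer determinant is the product of the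
  -- coordinates of `V z`.
  let M : Matrix (Fin d) (Fin d) ℤ :=
    Matrix.of fun b a => ((X ^ (a : ℕ) * vecPoly z) %ₘ frolovPolyInt d).coeff b
  have hM : frolovMatrix d * M.map (Int.cast : ℤ → ℝ) = Matrix.diagonal w * frolovMatrix d := by
    ext i a
    rw [Matrix.mul_apply, Matrix.diagonal_mul]
    have h := sum_coeff_modByMonic hd (X ^ (a : ℕ) * vecPoly z) i
    rw [map_mul, map_pow, aeval_X, aeval_vecPoly] at h
    simpa [M, w, frolovMatrix, Matrix.vandermonde_apply, mul_comm] using h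
  have hdet := congrArg Matrix.det hM
  rw [Matrix.det_mul, Matrix.det_mul, Matrix.det_diagonal, mul_comm] at hdet
  have hMw : (M.map (Int.cast : ℤ → ℝ)).det = ∏ i, w i :=
    mul_right_cancel₀ (frolovMatrix_det_pos hd).ne' hdet
  have hcast : (M.map (Int.cast : ℤ → ℝ)).det = (M.det : ℝ) := by
    have := (Int.castRingHom ℝ).map_det M
    simpa using this.symm
  rw [← Finset.abs_prod, ← hMw, hcast, ← Int.cast_abs]
  have hne : M.det ≠ 0 := by
    intro h0
    rw [h0, Int.cast_zero] at hcast
    rw [hcast] at hMw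
    exact Finset.prod_ne_zero_iff.mpr (fun i _ => frolovMatrix_mulVec_ne_zero hd hz i) hMw.symm
  exact_mod_cast Int.one_le_abs hne

/-- If `V^T k` is a nonzero integer vector, then the product of the coordinates of `k` is at least
`(det V)^{-2}` in absolute value. -/
theorem one_le_prod_of_transpose_mulVec {d : ℕ} (hd : 1 ≤ d) {k : Fin d → ℝ} (hk : k ≠ 0)
    {z : Fin d → ℤ} (hz : (frolovMatrix d).transpose.mulVec k = fun j => (z j : ℝ)) :
    1 ≤ (frolovMatrix d).det ^ 2 * ∏ i, |k i| := by
  -- Integrality of the first `d` power moments of `k` propagates to all of them, since `X^e`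
  -- reduces modulo `P` to an integer combination of lower powers.
  have hmom : ∀ e : ℕ, ∃ t : ℤ, ∑ i, frolovRoot d i ^ e * k i = t := by
    intro e
    refine ⟨∑ b : Fin d, ((X ^ e : ℤ[X]) %ₘ frolovPolyInt d).coeff b * z b, ?_⟩
    push_cast
    have h1 : ∀ b : Fin d, (z b : ℝ) = ∑ i, frolovRoot d i ^ (b : ℕ) * k i := by
      intro b
      have := congrFun hz b
      rw [← this]
      simp [Matrix.mulVec, dotProduct, frolovMatrix, Matrix.vandermonde_apply]
    have h2 : ∀ i, frolovRoot d i ^ e = ∑ b : Fin d,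
        frolovRoot d i ^ (b : ℕ) * (((X ^ e : ℤ[X]) %ₘ frolovPolyInt d).coeff b : ℝ) := by
      intro i
      rw [sum_coeff_modByMonic hd, map_pow, aeval_X]
    simp_rw [h1, Finset.mul_sum]
    rw [Finset.sum_comm]
    refine Finset.sum_congr rfl fun i _ => ?_
    rw [h2 i, Finset.sum_mul]
    exact Finset.sum_congr rfl fun b _ => by ring
  choose t ht using hmom
  -- The Hankel matrix of the moments. It factors as `V^T diag(k) V`, so its integer determinant is
  -- `(det V)^2 ∏ k_i`.
  let H : Matrix (Fin d) (Fin d) ℤ := Matrix.of fun a b => t (a + b)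
  have hH : H.map (Int.cast : ℤ → ℝ) =
      (frolovMatrix d).transpose * (Matrix.diagonal k * frolovMatrix d) := by
    ext a b
    rw [Matrix.mul_apply]
    simp only [Matrix.map_apply, H, Matrix.of_apply, ← ht, Matrix.diagonal_mul,
      Matrix.transpose_apply, frolovMatrix, Matrix.vandermonde_apply]
    exact Finset.sum_congr rfl fun i _ => by ring
  have hcast : (H.map (Int.cast : ℤ → ℝ)).det = (H.det : ℝ) := by
    have := (Int.castRingHom ℝ).map_det H
    simpa using this.symm
  have hdet : (H.det : ℝ) = (frolovMatrix d).det ^ 2 * ∏ i, k i := by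
    rw [← hcast, hH, Matrix.det_mul, Matrix.det_mul, Matrix.det_transpose, Matrix.det_diagonal]
    ring
  -- A singular integer matrix has a nonzero integer kernel vector `v`. Then `k_i (V v)_i = 0` for
  -- all `i`, and no coordinate of `V v` vanishes, so `k = 0`.
  have hne : H.det ≠ 0 := by
    intro h0
    obtain ⟨v, hv, hHv⟩ := Matrix.exists_mulVec_eq_zero_iff.mpr h0
    have hv' : (H.map (Int.cast : ℤ → ℝ)).mulVec (fun j => (v j : ℝ)) = 0 := by
      ext a
      have := congrArg (Int.cast : ℤ → ℝ) (congrFun hHv a)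
      simpa [Matrix.mulVec, dotProduct] using this
    rw [hH, ← Matrix.mulVec_mulVec, ← Matrix.mulVec_mulVec] at hv'
    have hinj := Matrix.eq_zero_of_mulVec_eq_zero
      (by rw [Matrix.det_transpose]; exact (frolovMatrix_det_pos hd).ne') hv'
    apply hk
    ext i
    have h1 := congrFun hinj i
    rw [Matrix.mulVec_diagonal] at h1
    exact (mul_eq_zero.mp h1).resolve_right (frolovMatrix_mulVec_ne_zero hd hv i)
  have hd2 : (frolovMatrix d).det ^ 2 * ∏ i, |k i| = |(H.det : ℝ)| := by
    rw [hdet, abs_mul, Finset.abs_prod, abs_of_nonneg (sq_nonneg (frolovMatrix d).det)]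
  rw [hd2, ← Int.cast_abs]
  exact_mod_cast Int.one_le_abs hne

/-- The scaling factor of the generator. -/
def frolovScale (d n : ℕ) : ℝ := ((n : ℝ) * (frolovMatrix d).det) ^ (-(1 / (d : ℝ)))

theorem frolovScale_pos {d n : ℕ} (hd : 1 ≤ d) (hn : 0 < n) : 0 < frolovScale d n :=
  Real.rpow_pos_of_pos (mul_pos (by exact_mod_cast hn) (frolovMatrix_det_pos hd)) _

theorem frolovScale_pow {d n : ℕ} (hd : 1 ≤ d) (hn : 0 < n) :
    frolovScale d n ^ d = ((n : ℝ) * (frolovMatrix d).det)⁻¹ := by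
  have hpos : 0 < (n : ℝ) * (frolovMatrix d).det :=
    mul_pos (by exact_mod_cast hn) (frolovMatrix_det_pos hd)
  have hd0 : (d : ℝ) ≠ 0 := by positivity
  rw [frolovScale, ← Real.rpow_natCast, ← Real.rpow_mul hpos.le, ← Real.rpow_neg_one]
  congr 1
  field_simp

theorem frolovGenerator_eq (d n : ℕ) : frolovGenerator d n = frolovScale d n • frolovMatrix d :=
  rfl

theorem frolovGenerator_det {d n : ℕ} (hd : 1 ≤ d) (hn : 0 < n) :
    (frolovGenerator d n).det = (n : ℝ)⁻¹ := by
  have := (frolovMatrix_det_pos hd).ne'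
  rw [frolovGenerator_eq, Matrix.det_smul, Fintype.card_fin, frolovScale_pow hd hn]
  field_simp

theorem le_prod_frolovGenerator_mulVec {d n : ℕ} (hd : 1 ≤ d) (hn : 0 < n) {z : Fin d → ℤ}
    (hz : z ≠ 0) :
    ((n : ℝ) * (frolovMatrix d).det)⁻¹ ≤
      ∏ i, |(frolovGenerator d n).mulVec (fun j => (z j : ℝ)) i| := by
  have h := one_le_prod_frolovMatrix_mulVec hd hz
  have hs := frolovScale_pos hd hn
  simp_rw [frolovGenerator_eq, Matrix.smul_mulVec, Pi.smul_apply, smul_eq_mul, abs_mul]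
  rw [Finset.prod_mul_distrib, Finset.prod_const, Finset.card_univ, Fintype.card_fin,
    abs_of_pos hs, frolovScale_pow hd hn]
  exact le_mul_of_one_le_right (by rw [← frolovScale_pow hd hn]; positivity) h

theorem le_prod_of_frolovGenerator_transpose_mulVec {d n : ℕ} (hd : 1 ≤ d) (hn : 0 < n)
    {k : Fin d → ℝ} (hk : k ≠ 0) {z : Fin d → ℤ}
    (hz : (frolovGenerator d n).transpose.mulVec k = fun j => (z j : ℝ)) :
    (n : ℝ) / (frolovMatrix d).det ≤ ∏ i, |k i| := by
  have hs := frolovScale_pos hd hn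
  have hD := frolovMatrix_det_pos hd
  have hn' : (0 : ℝ) < n := by exact_mod_cast hn
  have h := one_le_prod_of_transpose_mulVec hd (k := frolovScale d n • k) (z := z)
    (smul_ne_zero hs.ne' hk) (by
      rw [← hz, frolovGenerator_eq, Matrix.transpose_smul, Matrix.smul_mulVec,
        Matrix.mulVec_smul])
  simp_rw [Pi.smul_apply, smul_eq_mul, abs_mul] at h
  rw [Finset.prod_mul_distrib, Finset.prod_const, Finset.card_univ, Fintype.card_fin,
    abs_of_pos hs, frolovScale_pow hd hn] at h
  rw [div_le_iff₀ hD]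
  have : (frolovMatrix d).det ^ 2 * (((n : ℝ) * (frolovMatrix d).det)⁻¹ * ∏ i, |k i|) =
      (∏ i, |k i|) * (frolovMatrix d).det / n := by
    field_simp
  rw [this, le_div_iff₀ hn', one_mul] at h
  exact h

end

end FrolovCubature

namespace FrolovCubature

noncomputable section

/-! ### Sums over admissible lattices -/

theorem tsum_pi_prod {α : Type*} : ∀ {d : ℕ} (f : Fin d → α → ℝ≥0∞),
    ∑' z : Fin d → α, ∏ i, f i (z i) = ∏ i, ∑' a, f i a
  | 0, f => by simp
  | d + 1, f => by
    rw [← (Fin.consEquiv fun _ : Fin (d + 1) => α).tsum_eq, ENNReal.tsum_prod']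
    simp only [Fin.prod_univ_succ, Fin.consEquiv_apply, Fin.cons_zero, Fin.cons_succ]
    simp_rw [ENNReal.tsum_mul_left, tsum_pi_prod (fun i => f i.succ), ENNReal.tsum_mul_right]

/-- Each term is at most a difference of consecutive values of `1 / (h (1 + h j))`; the subtracted
term carries the telescoping induction. -/
theorem sum_range_inv_sq_le {h : ℝ} (hh : 0 < h) (N : ℕ) :
    ∑ j ∈ Finset.range (N + 1), ((1 + h * j) ^ 2)⁻¹ ≤ 1 + 1 / h - 1 / (h * (1 + h * N)) := by
  induction N with
  | zero => simp
  | succ N ih =>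
    rw [Finset.sum_range_succ]
    have hN : (0 : ℝ) ≤ N := Nat.cast_nonneg N
    have h1 : 0 < 1 + h * N := by positivity
    have h2 : 0 < 1 + h * ((N + 1 : ℕ) : ℝ) := by positivity
    have key : ((1 + h * ((N + 1 : ℕ) : ℝ)) ^ 2)⁻¹ ≤
        1 / (h * (1 + h * N)) - 1 / (h * (1 + h * ((N + 1 : ℕ) : ℝ))) := by
      have : 1 / (h * (1 + h * N)) - 1 / (h * (1 + h * ((N + 1 : ℕ) : ℝ))) =
          ((1 + h * N) * (1 + h * ((N + 1 : ℕ) : ℝ)))⁻¹ := by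
        field_simp
        push_cast
        ring
      rw [this, sq]
      gcongr
      simp
    linarith

theorem tsum_nat_inv_sq_le {h : ℝ} (hh : 0 < h) :
    ∑' j : ℕ, ENNReal.ofReal ((1 + h * j) ^ 2)⁻¹ ≤ ENNReal.ofReal (1 + 1 / h) := by
  refine ENNReal.tsum_le_of_sum_range_le fun N => ?_
  rw [← ENNReal.ofReal_sum_of_nonneg fun _ _ => by positivity]
  refine ENNReal.ofReal_le_ofReal ?_
  calc ∑ j ∈ Finset.range N, ((1 + h * j) ^ 2)⁻¹
      ≤ ∑ j ∈ Finset.range (N + 1), ((1 + h * j) ^ 2)⁻¹ :=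
        Finset.sum_le_sum_of_subset_of_nonneg (Finset.range_mono N.le_succ)
          fun _ _ _ => by positivity
    _ ≤ _ := (sum_range_inv_sq_le hh N).trans (by
        have : 0 < 1 / (h * (1 + h * N)) := by positivity
        linarith)

/-- The quantity `max (|k| - 1) 0` is a lower bound for `|t|` when `⌊t⌋ = k`. Splitting off `k = 0`
leaves two copies of the sum over the naturals, and `1 + 2 (1 + 1/h) ≤ 5/h` for `h ≤ 1`. -/
theorem tsum_int_inv_sq_le {h : ℝ} (hh : 0 < h) (h1 : h ≤ 1) :
    ∑' k : ℤ, ENNReal.ofReal ((1 + h * max (|(k : ℝ)| - 1) 0) ^ 2)⁻¹ ≤ ENNReal.ofReal (5 / h) := by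
  have hsum : ∀ g : ℤ → ℝ≥0∞, ∑' k, g k = ∑' j : ℕ, g j + ∑' j : ℕ, g (-(j + 1)) := fun g =>
    (HasSum.of_nat_of_neg_add_one ENNReal.summable.hasSum ENNReal.summable.hasSum).tsum_eq
  rw [hsum, tsum_eq_zero_add' ENNReal.summable]
  have ha : ∀ j : ℕ, max (|(((j + 1 : ℕ) : ℤ) : ℝ)| - 1) 0 = j := by
    intro j
    have : (0 : ℝ) ≤ j := Nat.cast_nonneg j
    push_cast
    rw [abs_of_pos (by positivity), add_sub_cancel_right, max_eq_left this]
  have hb : ∀ j : ℕ, max (|((-((j : ℤ) + 1) : ℤ) : ℝ)| - 1) 0 = j := by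
    intro j
    have := ha j
    push_cast at this ⊢
    rw [← abs_neg, neg_neg]
    exact this
  simp_rw [ha, hb]
  have h0 := tsum_nat_inv_sq_le hh
  calc _ ≤ ENNReal.ofReal 1 + ENNReal.ofReal (1 + 1 / h) + ENNReal.ofReal (1 + 1 / h) := by
        gcongr
        simp
    _ = ENNReal.ofReal (1 + (1 + 1 / h) + (1 + 1 / h)) := by
        rw [← ENNReal.ofReal_add (by positivity) (by positivity),
          ← ENNReal.ofReal_add (by positivity) (by positivity)]
    _ ≤ _ := by
        refine ENNReal.ofReal_le_ofReal ?_
        rw [le_div_iff₀ hh]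
        have : 1 / h * h = 1 := by field_simp
        nlinarith

/-- The sum of a dilated and translated product weight over an admissible lattice, provided that
the dilated boxes of side length `h` contain at most one point of the lattice. -/
theorem tsum_lattice_le {d : ℕ} (A : Matrix (Fin d) (Fin d) ℝ) {δ : ℝ}
    (hA : ∀ z : Fin d → ℤ, z ≠ 0 → δ ≤ ∏ i, |A.mulVec (fun j => (z j : ℝ)) i|)
    {b : Fin d → ℝ} (hb : ∀ i, 0 < b i) {h : ℝ} (hh : 0 < h) (h1 : h ≤ 1)
    (hδ : h ^ d < δ * ∏ i, b i) (y : Fin d → ℝ) :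
    ∑' z : Fin d → ℤ, ENNReal.ofReal
      (∏ i, ((1 + b i * |A.mulVec (fun j => (z j : ℝ)) i - y i|) ^ 2)⁻¹) ≤
      ENNReal.ofReal ((5 / h) ^ d) := by
  let x : (Fin d → ℤ) → Fin d → ℝ := fun z => A.mulVec (fun j => (z j : ℝ))
  -- The index of the box with sides `h / b i` that contains the lattice point. Two points in one
  -- box would differ by a nonzero lattice vector with coordinate product at most `h^d / ∏ b i < δ`,
  -- so `κ` is injective and the lattice sum is dominated by a product of one-dimensional sums.
  let κ : (Fin d → ℤ) → Fin d → ℤ := fun z i => ⌊b i * (x z i - y i) / h⌋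
  have hκ : Function.Injective κ := by
    intro z z' hzz
    by_contra hne
    have hsub : ∀ i, x (z - z') i = x z i - x z' i := by
      intro i
      have : (fun j => ((z - z') j : ℝ)) = (fun j => (z j : ℝ)) - fun j => (z' j : ℝ) := by
        ext j; simp
      simp only [x]
      rw [this, Matrix.mulVec_sub, Pi.sub_apply]
    have hlt : ∀ i, |x (z - z') i| < h / b i := by
      intro i
      have h2 := Int.abs_sub_lt_one_of_floor_eq_floor (congrFun hzz i)
      rw [← sub_div, ← mul_sub, sub_sub_sub_cancel_right, ← hsub, abs_div, abs_mul,
        abs_of_pos (hb i), abs_of_pos hh, div_lt_one hh] at h2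
      rw [lt_div_iff₀ (hb i), mul_comm]
      exact h2
    have h3 := hA (z - z') (sub_ne_zero.mpr hne)
    have h4 : ∏ i, |x (z - z') i| ≤ ∏ i, (h / b i) :=
      Finset.prod_le_prod (fun i _ => abs_nonneg _) fun i _ => (hlt i).le
    have h5 : δ * ∏ i, b i ≤ h ^ d := by
      have hp : 0 < ∏ i, b i := Finset.prod_pos fun i _ => hb i
      have h6 := h3.trans h4
      rw [Finset.prod_div_distrib, Finset.prod_const, Finset.card_univ, Fintype.card_fin,
        le_div_iff₀ hp] at h6
      exact h6
    exact absurd hδ (not_lt.mpr h5)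
  let v : ℤ → ℝ := fun k => ((1 + h * max (|(k : ℝ)| - 1) 0) ^ 2)⁻¹
  have hv : ∀ z i, ((1 + b i * |x z i - y i|) ^ 2)⁻¹ ≤ v (κ z i) := by
    intro z i
    set t := b i * (x z i - y i) / h with ht
    have hbt : b i * |x z i - y i| = h * |t| := by
      rw [ht, abs_div, abs_mul, abs_of_pos (hb i), abs_of_pos hh]
      field_simp
    have hk : |(κ z i : ℝ)| - 1 ≤ |t| := by
      have e1 : (κ z i : ℝ) ≤ t := Int.floor_le t
      have e2 : t < κ z i + 1 := Int.lt_floor_add_one t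
      have e3 : |(κ z i : ℝ) - t| ≤ 1 := by rw [abs_le]; constructor <;> linarith
      have := abs_sub_abs_le_abs_sub (κ z i : ℝ) t
      linarith
    have hm : max (|(κ z i : ℝ)| - 1) 0 ≤ |t| := max_le hk (abs_nonneg t)
    have hm0 : 0 ≤ max (|(κ z i : ℝ)| - 1) 0 := le_max_right _ _
    simp only [v]
    rw [hbt]
    gcongr
  calc _ ≤ ∑' z, ∏ i, ENNReal.ofReal (v (κ z i)) := by
        refine ENNReal.tsum_le_tsum fun z => ?_
        rw [← ENNReal.ofReal_prod_of_nonneg fun i _ => by positivity]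
        exact ENNReal.ofReal_le_ofReal
          (Finset.prod_le_prod (fun i _ => by positivity) fun i _ => hv z i)
    _ ≤ ∑' k : Fin d → ℤ, ∏ i, ENNReal.ofReal (v (k i)) :=
        ENNReal.tsum_comp_le_tsum_of_injective hκ fun k => ∏ i, ENNReal.ofReal (v (k i))
    _ = ∏ _i : Fin d, ∑' k : ℤ, ENNReal.ofReal (v k) :=
        tsum_pi_prod fun _ k => ENNReal.ofReal (v k)
    _ ≤ ∏ _i : Fin d, ENNReal.ofReal (5 / h) :=
        Finset.prod_le_prod' fun i _ => tsum_int_inv_sq_le hh h1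
    _ = _ := by
        rw [Finset.prod_const, Finset.card_univ, Fintype.card_fin,
          ENNReal.ofReal_pow (by positivity)]

end

end FrolovCubature

namespace FrolovCubature

noncomputable section

section Convolution

set_option linter.unusedSectionVars false

open Filter Topology

variable {E : Type} [NormedAddCommGroup E] [InnerProductSpace ℝ E] [FiniteDimensional ℝ E]
  [MeasurableSpace E] [BorelSpace E]

/-! ### Convolution of Schwartz functions -/

theorem integrable_one_add_pow_mul (b : 𝓢(E, ℂ)) (k : ℕ) :
    Integrable fun x => (1 + ‖x‖) ^ k * ‖b x‖ := by
  refine Integrable.mono' (((b.integrable_pow_mul volume 0).add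
    (b.integrable_pow_mul volume k)).const_mul ((2 : ℝ) ^ k)) ?_ (.of_forall fun x => ?_)
  · exact (by fun_prop : Continuous fun x => (1 + ‖x‖) ^ k * ‖b x‖).aestronglyMeasurable
  · rw [Real.norm_of_nonneg (by positivity)]
    simp only [Pi.add_apply, pow_zero]
    rw [← add_mul, ← mul_assoc]
    gcongr
    calc (1 + ‖x‖) ^ k ≤ 2 ^ (k - 1) * (1 ^ k + ‖x‖ ^ k) :=
          add_pow_le zero_le_one (norm_nonneg x) k
      _ ≤ 2 ^ k * (1 + ‖x‖ ^ k) := by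
          rw [one_pow]
          gcongr
          · norm_num
          · omega

theorem norm_smul_schwartz_le {F : Type} [NormedAddCommGroup F] [NormedSpace ℝ F]
    [NormedSpace ℂ F] (b : 𝓢(E, ℂ)) (φ : 𝓢(E, F)) (x y : E) :
    ‖b x • φ (y - x)‖ ≤ ‖b x‖ * SchwartzMap.seminorm ℝ 0 0 φ := by
  rw [norm_smul]
  gcongr
  exact norm_le_seminorm ℝ φ _

theorem integrable_smul_schwartz {F : Type} [NormedAddCommGroup F] [NormedSpace ℝ F]
    [NormedSpace ℂ F] (b : 𝓢(E, ℂ)) (φ : 𝓢(E, F)) (y : E) :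
    Integrable fun x => b x • φ (y - x) :=
  Integrable.mono' (b.integrable.norm.mul_const _)
    (by have := φ.continuous; fun_prop : Continuous fun x => b x • φ (y - x)).aestronglyMeasurable
    (.of_forall fun x => norm_smul_schwartz_le b φ x y)

theorem hasFDerivAt_schwartz_conv {F : Type} [NormedAddCommGroup F] [NormedSpace ℝ F]
    [NormedSpace ℂ F] [SMulCommClass ℝ ℂ F] (b : 𝓢(E, ℂ)) (φ : 𝓢(E, F)) (y : E) :
    HasFDerivAt (fun y => ∫ x, b x • φ (y - x)) (∫ x, b x • fderivCLM ℝ E F φ (y - x)) y := by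
  refine hasFDerivAt_integral_of_dominated_of_fderiv_le (s := Set.univ)
    (F' := fun y x => b x • fderivCLM ℝ E F φ (y - x))
    (bound := fun x => ‖b x‖ * SchwartzMap.seminorm ℝ 0 0 (fderivCLM ℝ E F φ)) univ_mem
    (.of_forall fun y => (integrable_smul_schwartz b φ y).aestronglyMeasurable)
    (integrable_smul_schwartz b φ y) (integrable_smul_schwartz b _ y).aestronglyMeasurable
    (.of_forall fun x y _ => norm_smul_schwartz_le b _ x y) (b.integrable.norm.mul_const _)
    (.of_forall fun x y _ => ?_)
  have h := (φ.hasFDerivAt (y - x)).comp y ((hasFDerivAt_id y).sub_const x)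
  exact h.const_smul (b x)

theorem fderiv_schwartz_conv {F : Type} [NormedAddCommGroup F] [NormedSpace ℝ F]
    [NormedSpace ℂ F] [SMulCommClass ℝ ℂ F] (b : 𝓢(E, ℂ)) (φ : 𝓢(E, F)) :
    fderiv ℝ (fun y => ∫ x, b x • φ (y - x)) =
      fun y => ∫ x, b x • fderivCLM ℝ E F φ (y - x) :=
  funext fun y => (hasFDerivAt_schwartz_conv b φ y).fderiv

theorem integrable_smul_iteratedFDeriv {F : Type} [NormedAddCommGroup F] [NormedSpace ℝ F]
    [NormedSpace ℂ F] [SMulCommClass ℝ ℂ F] (b : 𝓢(E, ℂ)) (φ : 𝓢(E, F)) (l : ℕ) (y : E) :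
    Integrable fun x => b x • iteratedFDeriv ℝ l φ (y - x) := by
  refine Integrable.mono' (b.integrable.norm.mul_const (SchwartzMap.seminorm ℝ 0 l φ)) ?_
    (.of_forall fun x => ?_)
  · have := (φ.smooth l).continuous_iteratedFDeriv le_rfl
    exact (by fun_prop :
      Continuous fun x => b x • iteratedFDeriv ℝ l φ (y - x)).aestronglyMeasurable
  · rw [norm_smul]
    gcongr
    exact norm_iteratedFDeriv_le_seminorm ℝ φ l _

/-- The target space is quantified inside the induction because one derivative turns `F` into `E
→L[ℝ] F`. -/
theorem iteratedFDeriv_schwartz_conv (b : 𝓢(E, ℂ)) (l : ℕ) :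
    ∀ {F : Type} [NormedAddCommGroup F] [NormedSpace ℝ F] [NormedSpace ℂ F]
    [SMulCommClass ℝ ℂ F] [CompleteSpace F] (φ : 𝓢(E, F)) (y : E),
    iteratedFDeriv ℝ l (fun y => ∫ x, b x • φ (y - x)) y =
      ∫ x, b x • iteratedFDeriv ℝ l φ (y - x) := by
  induction l with
  | zero =>
    intro F _ _ _ _ _ φ y
    ext m
    rw [ContinuousMultilinearMap.integral_apply (integrable_smul_iteratedFDeriv b φ 0 y)]
    simp
  | succ l ih =>
    intro F _ _ _ _ _ φ y
    ext m
    rw [ContinuousMultilinearMap.integral_apply (integrable_smul_iteratedFDeriv b φ (l + 1) y)]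
    simp_rw [smul_apply, iteratedFDeriv_succ_apply_right]
    rw [fderiv_schwartz_conv]
    erw [ih (fderivCLM ℝ E F φ),
      ContinuousMultilinearMap.integral_apply (integrable_smul_iteratedFDeriv b _ l y),
      ContinuousLinearMap.integral_apply]
    · rfl
    · have := integrable_smul_iteratedFDeriv b (fderivCLM ℝ E F φ) l y
      exact ContinuousLinearMap.integrable_comp
        (ContinuousMultilinearMap.apply ℝ (fun _ : Fin l => E) (E →L[ℝ] F) (Fin.init m)) this

theorem contDiff_schwartz_conv (b : 𝓢(E, ℂ)) (l : ℕ) :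
    ∀ {F : Type} [NormedAddCommGroup F] [NormedSpace ℝ F] [NormedSpace ℂ F]
    [SMulCommClass ℝ ℂ F] (φ : 𝓢(E, F)), ContDiff ℝ l (fun y => ∫ x, b x • φ (y - x)) := by
  induction l with
  | zero =>
    intro F _ _ _ _ φ
    have : Differentiable ℝ (fun y => ∫ x, b x • φ (y - x)) :=
      fun y => (hasFDerivAt_schwartz_conv b φ y).differentiableAt
    exact contDiff_zero.mpr this.continuous
  | succ l ih =>
    intro F _ _ _ _ φ
    push_cast
    rw [contDiff_succ_iff_fderiv]
    refine ⟨fun y => (hasFDerivAt_schwartz_conv b φ y).differentiableAt, by simp, ?_⟩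
    rw [fderiv_schwartz_conv]
    exact ih (F := E →L[ℝ] F) _

theorem one_add_norm_le (x y : E) : 1 + ‖y‖ ≤ (1 + ‖x‖) * (1 + ‖y - x‖) := by
  have : ‖y‖ ≤ ‖x‖ + ‖y - x‖ := by
    calc ‖y‖ = ‖x + (y - x)‖ := by rw [add_sub_cancel]
      _ ≤ _ := norm_add_le _ _
  nlinarith [norm_nonneg x, norm_nonneg (y - x)]

/-- A bound for the weighted derivatives of a Schwartz function that is stable under
translations. -/
theorem exists_one_add_pow_bound (φ : 𝓢(E, ℂ)) (k l : ℕ) :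
    ∃ C, 0 ≤ C ∧ ∀ y, (1 + ‖y‖) ^ k * ‖iteratedFDeriv ℝ l φ y‖ ≤ C :=
  ⟨2 ^ k * (Finset.Iic (k, l)).sup (fun m => SchwartzMap.seminorm ℝ m.1 m.2) φ,
    by positivity, fun y => one_add_le_sup_seminorm_apply (m := (k, l)) le_rfl le_rfl φ y⟩

theorem one_add_pow_mul_translate_le {φ : 𝓢(E, ℂ)} {k l : ℕ} {C : ℝ}
    (hC : ∀ y, (1 + ‖y‖) ^ k * ‖iteratedFDeriv ℝ l φ y‖ ≤ C) (x y : E) :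
    (1 + ‖y‖) ^ k * ‖iteratedFDeriv ℝ l φ (y - x)‖ ≤ (1 + ‖x‖) ^ k * C := by
  calc (1 + ‖y‖) ^ k * ‖iteratedFDeriv ℝ l φ (y - x)‖
      ≤ ((1 + ‖x‖) * (1 + ‖y - x‖)) ^ k * ‖iteratedFDeriv ℝ l φ (y - x)‖ := by
        gcongr
        exact one_add_norm_le x y
    _ = (1 + ‖x‖) ^ k * ((1 + ‖y - x‖) ^ k * ‖iteratedFDeriv ℝ l φ (y - x)‖) := by
        rw [mul_pow, mul_assoc]
    _ ≤ _ := by gcongr; exact hC _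

/-- The convolution of two Schwartz functions. -/
def schwartzConv (b φ : 𝓢(E, ℂ)) : 𝓢(E, ℂ) where
  toFun y := ∫ x, b x • φ (y - x)
  smooth' := contDiff_infty.mpr fun l => contDiff_schwartz_conv b l φ
  decay' k l := by
    obtain ⟨C, hC0, hC⟩ := exists_one_add_pow_bound φ k l
    refine ⟨∫ x, (1 + ‖x‖) ^ k * ‖b x‖ * C, fun y => ?_⟩
    rw [iteratedFDeriv_schwartz_conv]
    calc ‖y‖ ^ k * ‖∫ x, b x • iteratedFDeriv ℝ l φ (y - x)‖
        ≤ ‖y‖ ^ k * ∫ x, ‖b x • iteratedFDeriv ℝ l φ (y - x)‖ := by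
          gcongr
          exact norm_integral_le_integral_norm _
      _ = ∫ x, ‖y‖ ^ k * ‖b x • iteratedFDeriv ℝ l φ (y - x)‖ := by rw [integral_const_mul]
      _ ≤ _ := by
          refine integral_mono ((integrable_smul_iteratedFDeriv b φ l y).norm.const_mul _)
            ((integrable_one_add_pow_mul b k).mul_const C) fun x => ?_
          have h := one_add_pow_mul_translate_le hC x y
          have h2 : ‖y‖ ^ k * ‖iteratedFDeriv ℝ l φ (y - x)‖ ≤
              (1 + ‖y‖) ^ k * ‖iteratedFDeriv ℝ l φ (y - x)‖ := by
            gcongr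
            linarith
          simp only [norm_smul]
          calc _ = ‖b x‖ * (‖y‖ ^ k * ‖iteratedFDeriv ℝ l φ (y - x)‖) := by ring
            _ ≤ ‖b x‖ * ((1 + ‖x‖) ^ k * C) := mul_le_mul_of_nonneg_left (h2.trans h) (norm_nonneg _)
            _ = _ := by ring

theorem schwartzConv_apply (b φ : 𝓢(E, ℂ)) (y : E) :
    schwartzConv b φ y = ∫ x, b x * φ (y - x) := rfl

/-! ### Translations -/

theorem iteratedFDeriv_compSubConstCLM (φ : 𝓢(E, ℂ)) (l : ℕ) (x y : E) :
    iteratedFDeriv ℝ l (compSubConstCLM ℂ x φ) y = iteratedFDeriv ℝ l φ (y - x) :=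
  iteratedFDeriv_comp_sub l x y

theorem seminorm_compSubConstCLM_le (φ : 𝓢(E, ℂ)) (k l : ℕ) :
    ∃ C, 0 ≤ C ∧ ∀ x, SchwartzMap.seminorm ℂ k l (compSubConstCLM ℂ x φ) ≤ C * (1 + ‖x‖) ^ k := by
  obtain ⟨C, hC0, hC⟩ := exists_one_add_pow_bound φ k l
  refine ⟨C, hC0, fun x => seminorm_le_bound ℂ k l _ (by positivity) fun y => ?_⟩
  rw [iteratedFDeriv_compSubConstCLM, mul_comm C]
  refine le_trans ?_ (one_add_pow_mul_translate_le hC x y)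
  gcongr
  linarith [norm_nonneg y]

/-- The mean value inequality on the segment from `y - x` to `y - x'`, where the decay of the next
derivative is transferred from the segment to `y` at the cost of a power of `1 + ‖x‖ + ‖x'‖`. It
makes translation continuous in the Schwartz topology. -/
theorem seminorm_compSubConstCLM_sub_le (φ : 𝓢(E, ℂ)) (k l : ℕ) :
    ∃ C, 0 ≤ C ∧ ∀ x x', SchwartzMap.seminorm ℂ k l
      (compSubConstCLM ℂ x' φ - compSubConstCLM ℂ x φ) ≤
        C * (1 + (‖x‖ + ‖x'‖)) ^ k * ‖x' - x‖ := by
  obtain ⟨C, hC0, hC⟩ := exists_one_add_pow_bound φ k (l + 1)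
  refine ⟨C, hC0, fun x x' => seminorm_le_bound ℂ k l _ (by positivity) fun y => ?_⟩
  have hsub : iteratedFDeriv ℝ l (compSubConstCLM ℂ x' φ - compSubConstCLM ℂ x φ : 𝓢(E, ℂ)) y =
      iteratedFDeriv ℝ l φ (y - x') - iteratedFDeriv ℝ l φ (y - x) := by
    rw [← iteratedFDeriv_compSubConstCLM, ← iteratedFDeriv_compSubConstCLM]
    exact iteratedFDeriv_sub_apply ((SchwartzMap.smooth _ l).contDiffAt)
      ((SchwartzMap.smooth _ l).contDiffAt)
  rw [hsub]
  set D := C * (1 + (‖x‖ + ‖x'‖)) ^ k / (1 + ‖y‖) ^ k with hD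
  have hpos : 0 < (1 + ‖y‖) ^ k := by positivity
  have hmv := (convex_segment (𝕜 := ℝ) (y - x) (y - x')).norm_image_sub_le_of_norm_fderiv_le
    (𝕜 := ℝ) (f := iteratedFDeriv ℝ l φ) (C := D)
    (fun w _ => ((φ.smooth (l + 1)).differentiable_iteratedFDeriv (by exact_mod_cast l.lt_succ_self)) w)
    (fun w hw => by
      rw [norm_fderiv_iteratedFDeriv, hD, le_div_iff₀ hpos, mul_comm]
      have hx : ‖y - w‖ ≤ ‖x‖ + ‖x'‖ := by
        obtain ⟨a, c, ha, hc, hac, rfl⟩ := hw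
        have : y - (a • (y - x) + c • (y - x')) = a • x + c • x' := by
          rw [show y - (a • (y - x) + c • (y - x')) = (1 - (a + c)) • y + (a • x + c • x') by
            module, hac, sub_self, zero_smul, zero_add]
        rw [this]
        refine (norm_add_le _ _).trans ?_
        rw [norm_smul, norm_smul, Real.norm_of_nonneg ha, Real.norm_of_nonneg hc]
        nlinarith [norm_nonneg x, norm_nonneg x']
      have h := one_add_pow_mul_translate_le hC (y - w) y
      rw [sub_sub_cancel] at h
      refine h.trans ?_
      rw [mul_comm C]
      gcongr)
    (left_mem_segment ℝ _ _) (right_mem_segment ℝ _ _)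
  have hnorm : ‖y - x' - (y - x)‖ = ‖x' - x‖ := by
    rw [sub_sub_sub_cancel_left, norm_sub_rev]
  rw [hnorm] at hmv
  calc ‖y‖ ^ k * ‖iteratedFDeriv ℝ l φ (y - x') - iteratedFDeriv ℝ l φ (y - x)‖
      ≤ (1 + ‖y‖) ^ k * (D * ‖x' - x‖) := by
        gcongr
        linarith
    _ = _ := by rw [hD]; field_simp

theorem continuous_compSubConstCLM (φ : 𝓢(E, ℂ)) :
    Continuous fun x => compSubConstCLM ℂ x φ := by
  rw [continuous_iff_continuousAt]
  intro x
  rw [ContinuousAt, (schwartz_withSeminorms ℂ E ℂ).tendsto_nhds]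
  intro m ε hε
  obtain ⟨C, hC0, hC⟩ := seminorm_compSubConstCLM_sub_le φ m.1 m.2
  have hc : Tendsto (fun x' => C * (1 + (‖x‖ + ‖x'‖)) ^ m.1 * ‖x' - x‖) (𝓝 x) (𝓝 0) := by
    have : Continuous fun x' : E => C * (1 + (‖x‖ + ‖x'‖)) ^ m.1 * ‖x' - x‖ := by fun_prop
    simpa using this.tendsto x
  filter_upwards [hc.eventually_lt_const hε] with x' hx'
  exact (hC x x').trans_lt hx'

/-! ### Tempered distributions and convolutions -/

theorem exists_seminorm_bound (u : 𝓢'(E, ℂ)) :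
    ∃ (s : Finset (ℕ × ℕ)) (C : ℝ), 0 ≤ C ∧ ∀ φ : 𝓢(E, ℂ),
      ‖u φ‖ ≤ C * ∑ m ∈ s, SchwartzMap.seminorm ℂ m.1 m.2 φ := by
  have hcont : Continuous ((normSeminorm ℂ ℂ).comp (u : 𝓢(E, ℂ) →ₗ[ℂ] ℂ)) :=
    (continuous_norm.comp u.continuous : Continuous fun φ => ‖u φ‖)
  obtain ⟨s, C, _, h⟩ := Seminorm.bound_of_continuous (schwartz_withSeminorms ℂ E ℂ) _ hcont
  refine ⟨s, C, C.2, fun φ => (h φ).trans ?_⟩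
  rw [smul_apply, NNReal.smul_def, smul_eq_mul]
  gcongr
  refine Seminorm.finset_sup_apply_le (Finset.sum_nonneg fun m _ => apply_nonneg _ _) fun m hm => ?_
  exact Finset.single_le_sum (f := fun m : ℕ × ℕ => SchwartzMap.seminorm ℂ m.1 m.2 φ)
    (fun m _ => apply_nonneg _ _) hm

theorem exists_translate_growth (u : 𝓢'(E, ℂ)) (φ : 𝓢(E, ℂ)) :
    ∃ (C : ℝ) (k : ℕ), 0 ≤ C ∧ ∀ x, ‖u (compSubConstCLM ℂ x φ)‖ ≤ C * (1 + ‖x‖) ^ k := by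
  obtain ⟨s, C, hC, hu⟩ := exists_seminorm_bound u
  choose D hD0 hD using fun m : ℕ × ℕ => seminorm_compSubConstCLM_le φ m.1 m.2
  refine ⟨C * ∑ m ∈ s, D m, s.sup Prod.fst, mul_nonneg hC (Finset.sum_nonneg fun m _ => hD0 m),
    fun x => (hu _).trans ?_⟩
  rw [mul_assoc, Finset.sum_mul]
  gcongr with m hm
  refine (hD m x).trans (mul_le_mul_of_nonneg_left ?_ (hD0 m))
  exact pow_le_pow_right₀ (by linarith [norm_nonneg x]) (Finset.le_sup (f := Prod.fst) hm)

/-- Bounded continuous functions with values in the multilinear maps of degree `l`. -/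
abbrev DerivBCF (E : Type) [NormedAddCommGroup E] [InnerProductSpace ℝ E] (l : ℕ) : Type :=
  @BoundedContinuousFunction E (ContinuousMultilinearMap ℝ (fun _ : Fin l => E) ℂ) _
    NormedAddCommGroup.toSeminormedAddCommGroup.toPseudoMetricSpace

/-- The weighted derivatives of a Schwartz function, as a linear map into a space of bounded
continuous functions. -/
def weightedDeriv (m : ℕ × ℕ) :
    𝓢(E, ℂ) →ₗ[ℂ] DerivBCF E m.2 where
  toFun φ := BoundedContinuousFunction.ofNormedAddCommGroup
    (fun y => ‖y‖ ^ m.1 • iteratedFDeriv ℝ m.2 φ y)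
    (by
      have := (φ.smooth m.2).continuous_iteratedFDeriv le_rfl
      fun_prop)
    (SchwartzMap.seminorm ℂ m.1 m.2 φ)
    (fun y => by
      rw [norm_smul, norm_pow, norm_norm]
      exact le_seminorm ℂ m.1 m.2 φ y)
  map_add' φ ψ := by
    ext1 y
    change ‖y‖ ^ m.1 • iteratedFDeriv ℝ m.2 (φ + ψ : 𝓢(E, ℂ)) y =
      ‖y‖ ^ m.1 • iteratedFDeriv ℝ m.2 φ y + ‖y‖ ^ m.1 • iteratedFDeriv ℝ m.2 ψ y
    rw [← smul_add]
    congr 1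
    exact iteratedFDeriv_add_apply (φ.smooth m.2).contDiffAt (ψ.smooth m.2).contDiffAt
  map_smul' c φ := by
    ext1 y
    change ‖y‖ ^ m.1 • iteratedFDeriv ℝ m.2 (c • φ : 𝓢(E, ℂ)) y =
      c • ‖y‖ ^ m.1 • iteratedFDeriv ℝ m.2 φ y
    rw [smul_comm c]
    congr 1
    exact iteratedFDeriv_const_smul_apply (φ.smooth m.2).contDiffAt

theorem weightedDeriv_apply (m : ℕ × ℕ) (φ : 𝓢(E, ℂ)) (y : E) :
    weightedDeriv m φ y = ‖y‖ ^ m.1 • iteratedFDeriv ℝ m.2 φ y := rfl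

theorem norm_weightedDeriv_le (m : ℕ × ℕ) (φ : 𝓢(E, ℂ)) :
    ‖weightedDeriv m φ‖ ≤ SchwartzMap.seminorm ℂ m.1 m.2 φ :=
  BoundedContinuousFunction.norm_ofNormedAddCommGroup_le _ (apply_nonneg _ _) fun y => by
    rw [norm_smul, norm_pow, norm_norm]
    exact le_seminorm ℂ m.1 m.2 φ y

theorem seminorm_le_norm_weightedDeriv (m : ℕ × ℕ) (φ : 𝓢(E, ℂ)) :
    SchwartzMap.seminorm ℂ m.1 m.2 φ ≤ ‖weightedDeriv m φ‖ := by
  refine seminorm_le_bound ℂ m.1 m.2 φ (norm_nonneg _) fun y => ?_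
  have h := (weightedDeriv m φ).norm_coe_le_norm y
  rwa [weightedDeriv_apply, norm_smul, norm_pow, norm_norm] at h

/-- A tempered distribution factors through finitely many weighted derivatives. -/
theorem exists_factor_weightedDeriv (u : 𝓢'(E, ℂ)) :
    ∃ (s : Finset (ℕ × ℕ)) (U : (∀ m : s, DerivBCF E m.1.2) →L[ℂ] ℂ),
      ∀ φ : 𝓢(E, ℂ), u φ = U fun m => weightedDeriv m.1 φ := by
  obtain ⟨s, C, hC, hu⟩ := exists_seminorm_bound u
  let J : 𝓢(E, ℂ) →ₗ[ℂ] (∀ m : s, DerivBCF E m.1.2) :=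
    LinearMap.pi fun m => weightedDeriv m.1
  have hJ : ∀ φ, ‖u φ‖ ≤ C * s.card * ‖J φ‖ := by
    intro φ
    refine (hu φ).trans ?_
    rw [mul_assoc]
    gcongr
    rw [← nsmul_eq_mul]
    refine Finset.sum_le_card_nsmul _ _ _ fun m hm => ?_
    exact (seminorm_le_norm_weightedDeriv m φ).trans (norm_le_pi_norm (J φ) ⟨m, hm⟩)
  have hker : LinearMap.ker J ≤ LinearMap.ker (u : 𝓢(E, ℂ) →ₗ[ℂ] ℂ) := by
    intro φ hφ
    have h := hJ φ
    rw [LinearMap.mem_ker.mp hφ, norm_zero, mul_zero] at h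
    exact LinearMap.mem_ker.mpr (norm_le_zero_iff.mp h)
  let f : LinearMap.range J →ₗ[ℂ] ℂ :=
    ((LinearMap.ker J).liftQ (u : 𝓢(E, ℂ) →ₗ[ℂ] ℂ) hker).comp
      J.quotKerEquivRange.symm.toLinearMap
  have hf : ∀ φ, f ⟨J φ, LinearMap.mem_range_self J φ⟩ = u φ := by
    intro φ
    have : J.quotKerEquivRange.symm ⟨J φ, LinearMap.mem_range_self J φ⟩ =
        (LinearMap.ker J).mkQ φ := by
      rw [LinearEquiv.symm_apply_eq]
      rfl
    simp only [f, LinearMap.comp_apply, LinearEquiv.coe_coe, this]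
    simp
  let fc : StrongDual ℂ (LinearMap.range J) := f.mkContinuous (C * s.card) (by
    rintro ⟨_, φ, rfl⟩
    rw [hf]
    exact hJ φ)
  -- The functional is bounded on the range of `J` in a product of Banach spaces; Hahn–Banach
  -- extends it to the whole product.
  obtain ⟨U, hU, _⟩ := exists_extension_norm_eq (LinearMap.range J) fc
  exact ⟨s, U, fun φ => by rw [← hf φ]; exact (hU ⟨J φ, LinearMap.mem_range_self J φ⟩).symm⟩

theorem continuous_weightedDeriv (m : ℕ × ℕ) :
    Continuous (weightedDeriv (E := E) m) := by
  rw [continuous_iff_continuousAt]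
  intro φ
  rw [ContinuousAt, tendsto_iff_norm_sub_tendsto_zero]
  have hc : Continuous fun ψ : 𝓢(E, ℂ) => SchwartzMap.seminorm ℂ m.1 m.2 (ψ - φ) :=
    ((schwartz_withSeminorms ℂ E ℂ).continuous_seminorm m).comp (continuous_id.sub continuous_const)
  have h0 := hc.tendsto φ
  rw [sub_self, map_zero] at h0
  refine squeeze_zero (fun _ => norm_nonneg _) (fun ψ => ?_) h0
  rw [← map_sub]
  exact norm_weightedDeriv_le m _

/-- Continuous linear functionals commute with the convolution integral. -/
theorem apply_schwartzConv (u : 𝓢'(E, ℂ)) (b φ : 𝓢(E, ℂ)) :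
    u (schwartzConv b φ) = ∫ x, b x * u (compSubConstCLM ℂ x φ) := by
  obtain ⟨s, U, hU⟩ := exists_factor_weightedDeriv u
  have hint : ∀ m : ℕ × ℕ,
      Integrable fun x => b x • weightedDeriv m (compSubConstCLM ℂ x φ) := by
    intro m
    obtain ⟨C, hC0, hC⟩ := seminorm_compSubConstCLM_le φ m.1 m.2
    refine Integrable.mono' ((integrable_one_add_pow_mul b m.1).mul_const C)
      (b.continuous.smul ((continuous_weightedDeriv m).comp
        (continuous_compSubConstCLM φ))).aestronglyMeasurable (.of_forall fun x => ?_)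
    rw [norm_smul]
    calc _ ≤ ‖b x‖ * (C * (1 + ‖x‖) ^ m.1) := by
          gcongr
          exact (norm_weightedDeriv_le m _).trans (hC x)
      _ = _ := by ring
  have hconv : ∀ m : ℕ × ℕ, weightedDeriv m (schwartzConv b φ) =
      ∫ x, b x • weightedDeriv m (compSubConstCLM ℂ x φ) := by
    intro m
    ext1 y
    have h1 := (BoundedContinuousFunction.evalCLM ℝ y).integral_comp_comm (hint m)
    rw [BoundedContinuousFunction.evalCLM_apply] at h1
    rw [← h1, weightedDeriv_apply]
    change ‖y‖ ^ m.1 • iteratedFDeriv ℝ m.2 (fun y => ∫ x, b x • φ (y - x)) y = _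
    rw [iteratedFDeriv_schwartz_conv, ← integral_smul]
    refine integral_congr_ae (.of_forall fun x => ?_)
    simp only [BoundedContinuousFunction.evalCLM_apply, BoundedContinuousFunction.coe_smul,
      weightedDeriv_apply, iteratedFDeriv_compSubConstCLM]
    rw [smul_comm]
  have hpi : (fun m : s => weightedDeriv m.1 (schwartzConv b φ)) =
      ∫ x, fun m : s => b x • weightedDeriv m.1 (compSubConstCLM ℂ x φ) := by
    ext1 m
    rw [hconv, eval_integral fun m : s => hint m.1]
  -- After the factorization the convolution is a Bochner integral in a Banach space, where the
  -- continuous linear map `U` passes under the integral sign.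
  rw [hU, hpi, ← U.integral_comp_comm (Integrable.of_eval fun m : s => hint m.1)]
  refine integral_congr_ae (.of_forall fun x => ?_)
  change U (b x • fun m : s => weightedDeriv m.1 (compSubConstCLM ℂ x φ)) = _
  rw [map_smul, smul_eq_mul, ← hU]

theorem continuous_apply_compSubConstCLM (u : 𝓢'(E, ℂ)) (φ : 𝓢(E, ℂ)) :
    Continuous fun x => u (compSubConstCLM ℂ x φ) :=
  u.continuous.comp (continuous_compSubConstCLM φ)

end Convolution

end

end FrolovCubature

namespace FrolovCubature

noncomputable section

/-! ### Dual kernels -/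

/-- A system of band-limited functions that is dual to a system of local means. -/
structure DualKernel {L : ℕ} (K : LocalMeansKernel L) where
  lam0 : 𝓢(ℝ, ℂ)
  lam1 : 𝓢(ℝ, ℂ)
  kap : 𝓢(ℝ, ℂ)
  eps : ℝ
  eps_pos : 0 < eps
  compact0 : HasCompactSupport (𝓕 lam0 : 𝓢(ℝ, ℂ))
  compact1 : HasCompactSupport (𝓕 lam1 : 𝓢(ℝ, ℂ))
  compactK : HasCompactSupport (𝓕 kap : 𝓢(ℝ, ℂ))
  band0 : ∀ ξ, eps ≤ |ξ| → (𝓕 lam0 : 𝓢(ℝ, ℂ)) ξ = 0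
  band1 : ∀ ξ, 2 * eps ≤ |ξ| → (𝓕 lam1 : 𝓢(ℝ, ℂ)) ξ = 0
  integral_kap : ∫ t, kap t = 1
  conv0 : ∀ t, ∫ y, K.psi0 y * lam0 (t - y) = kap t
  conv1 : ∀ t, ∫ y, K.psi1 y * lam1 (t - y) = 2 * kap (2 * t) - kap t

theorem contDiff_div_of_tsupport_subset {f g : ℝ → ℂ} (hf : ContDiff ℝ ((⊤ : ℕ∞) : WithTop ℕ∞) f)
    (hg : ContDiff ℝ ((⊤ : ℕ∞) : WithTop ℕ∞) g) (h : ∀ x ∈ tsupport f, g x ≠ 0) :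
    ContDiff ℝ ((⊤ : ℕ∞) : WithTop ℕ∞) fun x => f x / g x := by
  rw [contDiff_iff_contDiffAt]
  intro x
  by_cases hx : x ∈ tsupport f
  · simp_rw [div_eq_mul_inv]
    exact hf.contDiffAt.mul (hg.contDiffAt.inv (h x hx))
  · have : (fun x => f x / g x) =ᶠ[nhds x] fun _ => 0 := by
      filter_upwards [(isClosed_tsupport f).isOpen_compl.mem_nhds hx] with y hy
      rw [image_eq_zero_of_notMem_tsupport hy, zero_div]
    exact contDiffAt_const.congr_of_eventuallyEq this

/-- Take `lam` with `𝓕 lam = f / 𝓕 ψ`, which is smooth with compact support because `𝓕 ψ` has no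
zero on the support of `f`. Convolution with `ψ` multiplies by `𝓕 ψ` again. -/
theorem exists_schwartz_quotient (ψ : 𝓢(ℝ, ℂ)) {f : ℝ → ℂ}
    (hf : ContDiff ℝ ((⊤ : ℕ∞) : WithTop ℕ∞) f) (hc : HasCompactSupport f)
    (h : ∀ x ∈ tsupport f, (𝓕 ψ : 𝓢(ℝ, ℂ)) x ≠ 0) :
    ∃ lam : 𝓢(ℝ, ℂ), HasCompactSupport (𝓕 lam : 𝓢(ℝ, ℂ)) ∧
      (∀ ξ, f ξ = 0 → (𝓕 lam : 𝓢(ℝ, ℂ)) ξ = 0) ∧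
      ∀ t, ∫ y, ψ y * lam (t - y) = 𝓕⁻ f t := by
  have hsm := contDiff_div_of_tsupport_subset hf ((𝓕 ψ : 𝓢(ℝ, ℂ)).smooth ⊤) h
  have hcs : HasCompactSupport fun x => f x / (𝓕 ψ : 𝓢(ℝ, ℂ)) x := by
    simp_rw [div_eq_mul_inv]
    exact hc.mul_right
  set γ := hcs.toSchwartzMap hsm with hγ
  have hγa : ∀ x, γ x = f x / (𝓕 ψ : 𝓢(ℝ, ℂ)) x := fun x => rfl
  refine ⟨𝓕⁻ γ, ?_, ?_, ?_⟩
  · rw [FourierTransform.fourier_fourierInv_eq]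
    exact hcs
  · intro ξ hξ
    rw [FourierTransform.fourier_fourierInv_eq, hγa, hξ, zero_div]
  · intro t
    have h1 := convolution_apply (ContinuousLinearMap.mul ℂ ℂ) ψ (𝓕⁻ γ) t
    rw [MeasureTheory.convolution_def] at h1
    simp only [ContinuousLinearMap.mul_apply'] at h1
    rw [← h1]
    have h2 := fourier_convolution (ContinuousLinearMap.mul ℂ ℂ) ψ (𝓕⁻ γ)
    rw [← FourierTransform.fourierInv_fourier_eq (F := 𝓢(ℝ, ℂ))
      (SchwartzMap.convolution (ContinuousLinearMap.mul ℂ ℂ) ψ (𝓕⁻ γ)), h2,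
      FourierTransform.fourier_fourierInv_eq, fourierInv_coe]
    refine congrArg (fun h : ℝ → ℂ => 𝓕⁻ h t) (funext fun x => ?_)
    simp only [pairing_apply_apply, ContinuousLinearMap.mul_apply', hγa]
    by_cases hx : x ∈ tsupport f
    · have := h x hx
      field_simp
    · rw [image_eq_zero_of_notMem_tsupport hx]
      simp

theorem fourierInv_comp_half (f : ℝ → ℂ) (t : ℝ) :
    𝓕⁻ (fun ξ => f (ξ / 2)) t = 2 * 𝓕⁻ f (2 * t) := by
  rw [Real.fourierInv_eq', Real.fourierInv_eq']
  have h := Measure.integral_comp_div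
    (fun ξ : ℝ => Complex.exp ((2 * Real.pi * (inner ℝ ξ (2 * t)) : ℝ) * Complex.I) • f ξ) 2
  simp only [Nat.abs_ofNat] at h
  rw [← Complex.coe_smul, smul_eq_mul] at h
  push_cast at h ⊢
  rw [← h]
  refine integral_congr_ae (.of_forall fun ξ => ?_)
  simp only [RCLike.inner_apply, conj_trivial, smul_eq_mul]
  congr 2
  push_cast
  ring

theorem integrable_fourierInv_integrand {g : ℝ → ℂ} (hg : Continuous g)
    (hgc : HasCompactSupport g) (t : ℝ) : Integrable fun ξ : ℝ =>
      Complex.exp ((2 * Real.pi * (inner ℝ ξ t) : ℝ) * Complex.I) • g ξ := by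
  have he : Continuous fun ξ : ℝ =>
      Complex.exp ((2 * Real.pi * (inner ℝ ξ t) : ℝ) * Complex.I) := by
    simp only [RCLike.inner_apply, conj_trivial]
    fun_prop
  exact (he.smul hg).integrable_of_hasCompactSupport
    (hgc.smul_left (f := fun ξ : ℝ => Complex.exp ((2 * Real.pi * (inner ℝ ξ t) : ℝ) * Complex.I)))

theorem exists_dualKernel {L : ℕ} (K : LocalMeansKernel L) : Nonempty (DualKernel K) := by
  obtain ⟨ε, hε, h0, h1⟩ := K.tauberian
  -- The radii are chosen so that the cutoff lives in `|ξ| ≤ 5ε/6`, inside the region where `𝓕Ψ_0 ≠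
  -- 0`, while the difference `φ'` below lives in `2ε/3 ≤ |ξ| ≤ 5ε/3`, inside the annulus where
  -- `𝓕Ψ_1 ≠ 0`.
  let f : ContDiffBump (0 : ℝ) := ⟨2 / 3 * ε, 5 / 6 * ε, by positivity, by linarith⟩
  have hfin : f.rIn = 2 / 3 * ε := rfl
  have hfout : f.rOut = 5 / 6 * ε := rfl
  let φ : ℝ → ℂ := fun ξ => (f ξ : ℂ)
  have hφ : ContDiff ℝ ((⊤ : ℕ∞) : WithTop ℕ∞) φ := Complex.ofRealCLM.contDiff.comp f.contDiff
  have hφc : HasCompactSupport φ := f.hasCompactSupport.comp_left Complex.ofReal_zero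
  have hφ0 : ∀ ξ, 5 / 6 * ε ≤ |ξ| → φ ξ = 0 := by
    intro ξ hξ
    simp only [φ]
    rw [f.zero_of_le_dist (by rw [hfout, Real.dist_eq, sub_zero]; exact hξ), Complex.ofReal_zero]
  have hφ1 : ∀ ξ, |ξ| ≤ 2 / 3 * ε → φ ξ = 1 := by
    intro ξ hξ
    simp only [φ]
    rw [f.one_of_mem_closedBall (by
      rw [hfin, Metric.mem_closedBall, Real.dist_eq, sub_zero]; exact hξ), Complex.ofReal_one]
  let φ' : ℝ → ℂ := fun ξ => φ (ξ / 2) - φ ξ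
  have hφ' : ContDiff ℝ ((⊤ : ℕ∞) : WithTop ℕ∞) φ' :=
    (hφ.comp (contDiff_id.div_const 2)).sub hφ
  have htri : ∀ ξ : ℝ, |ξ / 2| = |ξ| / 2 := fun ξ => by rw [abs_div, abs_two]
  have hsupp' : tsupport φ' ⊆ {ξ | 2 / 3 * ε ≤ |ξ|} ∩ {ξ | |ξ| ≤ 5 / 3 * ε} := by
    refine closure_minimal (fun ξ hξ => ?_) ((isClosed_le continuous_const continuous_abs).inter
      (isClosed_le continuous_abs continuous_const))
    rw [Function.mem_support] at hξ
    constructor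
    · by_contra hlt
      simp only [Set.mem_ofPred_eq, not_le] at hlt
      exact hξ (by simp only [φ']; rw [hφ1 ξ hlt.le, hφ1 _ (by rw [htri]; linarith [abs_nonneg ξ]),
        sub_self])
    · by_contra hlt
      simp only [Set.mem_ofPred_eq, not_le] at hlt
      exact hξ (by simp only [φ']; rw [hφ0 ξ (by linarith), hφ0 _ (by rw [htri]; linarith),
        sub_self])
  have hφ'c : HasCompactSupport φ' := by
    refine HasCompactSupport.of_support_subset_isCompact (isCompact_Icc (a := -(5 / 3 * ε))
      (b := 5 / 3 * ε)) fun ξ hξ => ?_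
    exact abs_le.mp (hsupp' (subset_tsupport _ hξ)).2
  have hsupp : tsupport φ ⊆ {ξ | |ξ| ≤ 5 / 6 * ε} := by
    refine closure_minimal (fun ξ hξ => ?_) (isClosed_le continuous_abs continuous_const)
    by_contra hlt
    simp only [Set.mem_ofPred_eq, not_le] at hlt
    exact hξ (hφ0 ξ hlt.le)
  obtain ⟨lam0, hc0, hb0, hv0⟩ := exists_schwartz_quotient K.psi0 hφ hφc fun x hx =>
    h0 x (lt_of_le_of_lt (hsupp hx) (by linarith))
  obtain ⟨lam1, hc1, hb1, hv1⟩ := exists_schwartz_quotient K.psi1 hφ' hφ'c fun x hx =>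
    h1 x (lt_of_lt_of_le (by linarith) (hsupp' hx).1) (lt_of_le_of_lt (hsupp' hx).2 (by linarith))
  set Φ := hφc.toSchwartzMap hφ with hΦ
  have hkap : ∀ t, (𝓕⁻ Φ : 𝓢(ℝ, ℂ)) t = 𝓕⁻ φ t := fun t => by rw [fourierInv_coe]; rfl
  refine ⟨⟨lam0, lam1, 𝓕⁻ Φ, ε, hε, hc0, hc1, ?_, ?_, ?_, ?_, ?_, ?_⟩⟩
  · rw [FourierTransform.fourier_fourierInv_eq]
    exact hφc
  · exact fun ξ hξ => hb0 ξ (hφ0 ξ (by linarith))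
  · exact fun ξ hξ => hb1 ξ (by
      simp only [φ']
      rw [hφ0 ξ (by linarith), hφ0 _ (by rw [htri]; linarith), sub_self])
  · have h2 : (𝓕 (𝓕⁻ Φ : 𝓢(ℝ, ℂ)) : 𝓢(ℝ, ℂ)) 0 = ∫ t, (𝓕⁻ Φ : 𝓢(ℝ, ℂ)) t := by
      rw [fourier_coe, Real.fourier_eq]
      simp
    rw [← h2, FourierTransform.fourier_fourierInv_eq]
    exact hφ1 0 (by rw [abs_zero]; positivity)
  · exact fun t => by rw [hv0, hkap]
  · intro t
    rw [hv1, hkap, hkap, ← fourierInv_comp_half]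
    have hhalf : Continuous fun ξ : ℝ => φ (ξ / 2) := hφ.continuous.comp (by fun_prop)
    have hhalfc : HasCompactSupport fun ξ : ℝ => φ (ξ / 2) := by
      simp_rw [div_eq_mul_inv]
      exact hφc.comp_homeomorph (Homeomorph.mulRight₀ (2⁻¹ : ℝ) (by norm_num))
    rw [Real.fourierInv_eq', Real.fourierInv_eq', Real.fourierInv_eq',
      ← integral_sub (integrable_fourierInv_integrand hhalf hhalfc t)
        (integrable_fourierInv_integrand hφ.continuous hφc t)]
    exact integral_congr_ae (.of_forall fun ξ => smul_sub _ _ _)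

end

end FrolovCubature

namespace FrolovCubature

noncomputable section

/-! ### Tensor products -/

theorem integral_prod_coord {d : ℕ} (f : Fin d → ℝ → ℂ) :
    ∫ x : Rd d, ∏ i, f i (x i) = ∏ i, ∫ t, f i t := by
  rw [← integral_fintype_prod_volume_eq_prod]
  exact (PiLp.volume_preserving_ofLp (Fin d)).integral_comp
    (MeasurableEquiv.toLp 2 (Fin d → ℝ)).symm.measurableEmbedding fun x => ∏ i, f i (x i)

theorem integrable_prod_coord {d : ℕ} {𝕜 : Type*} [RCLike 𝕜] {f : Fin d → ℝ → 𝕜}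
    (hf : ∀ i, Integrable (f i)) : Integrable fun x : Rd d => ∏ i, f i (x i) :=
  ((PiLp.volume_preserving_ofLp (Fin d)).integrable_comp_emb
    (MeasurableEquiv.toLp 2 (Fin d → ℝ)).symm.measurableEmbedding
    (g := fun x => ∏ i, f i (x i))).mpr (Integrable.fintype_prod hf)

theorem lintegral_prod_coord {d : ℕ} {f : Fin d → ℝ → ℝ} (hf : ∀ i, Integrable (f i))
    (h0 : ∀ i t, 0 ≤ f i t) :
    ∫⁻ x : Rd d, ENNReal.ofReal (∏ i, f i (x i)) = ∏ i, ENNReal.ofReal (∫ t, f i t) := by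
  rw [← ofReal_integral_eq_lintegral_ofReal (integrable_prod_coord hf)
    (.of_forall fun x => Finset.prod_nonneg fun i _ => h0 i _),
    ← ENNReal.ofReal_prod_of_nonneg fun i _ => integral_nonneg (h0 i),
    ← integral_fintype_prod_volume_eq_prod]
  congr 1
  exact (PiLp.volume_preserving_ofLp (Fin d)).integral_comp
    (MeasurableEquiv.toLp 2 (Fin d → ℝ)).symm.measurableEmbedding fun x => ∏ i, f i (x i)

theorem hasCompactSupport_prod_coord {d : ℕ} {f : Fin d → ℝ → ℂ}
    (hf : ∀ i, HasCompactSupport (f i)) : HasCompactSupport fun x : Rd d => ∏ i, f i (x i) := by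
  have hc : IsCompact (Set.univ.pi fun i => tsupport (f i)) := isCompact_univ_pi fun i => hf i
  have hc' := (EuclideanSpace.equiv (Fin d) ℝ).toHomeomorph.isCompact_preimage.mpr hc
  refine HasCompactSupport.of_support_subset_isCompact hc' fun x hx i _ => ?_
  exact subset_tsupport _ fun h => hx (Finset.prod_eq_zero (Finset.mem_univ i) h)

theorem contDiff_prod_coord {d : ℕ} {f : Fin d → ℝ → ℂ}
    (hf : ∀ i, ContDiff ℝ ((⊤ : ℕ∞) : WithTop ℕ∞) (f i)) :
    ContDiff ℝ ((⊤ : ℕ∞) : WithTop ℕ∞) fun x : Rd d => ∏ i, f i (x i) :=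
  contDiff_prod fun i _ => (hf i).comp (by fun_prop)

/-- The tensor product of band-limited Schwartz functions. -/
def tensorProd {d : ℕ} (g : Fin d → 𝓢(ℝ, ℂ))
    (hg : ∀ i, HasCompactSupport (𝓕 (g i) : 𝓢(ℝ, ℂ))) : 𝓢(Rd d, ℂ) :=
  𝓕⁻ ((hasCompactSupport_prod_coord hg).toSchwartzMap
    (contDiff_prod_coord fun i => (𝓕 (g i) : 𝓢(ℝ, ℂ)).smooth ⊤))

theorem tensorProd_apply {d : ℕ} (g : Fin d → 𝓢(ℝ, ℂ))
    (hg : ∀ i, HasCompactSupport (𝓕 (g i) : 𝓢(ℝ, ℂ))) (x : Rd d) :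
    tensorProd g hg x = ∏ i, g i (x i) := by
  have h1 : ∀ i, g i (x i) = ∫ t : ℝ,
      Complex.exp ((2 * Real.pi * (t * x i) : ℝ) * Complex.I) * (𝓕 (g i) : 𝓢(ℝ, ℂ)) t := by
    intro i
    have h := congrArg (fun φ : 𝓢(ℝ, ℂ) => φ (x i))
      (FourierTransform.fourierInv_fourier_eq (F := 𝓢(ℝ, ℂ)) (g i))
    simp only at h
    rw [← h, fourierInv_coe, Real.fourierInv_eq']
    refine integral_congr_ae (.of_forall fun t => ?_)
    simp only [RCLike.inner_apply, conj_trivial, smul_eq_mul]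
    rw [mul_comm t]
  simp_rw [h1]
  rw [← integral_prod_coord fun i t =>
    Complex.exp ((2 * Real.pi * (t * x i) : ℝ) * Complex.I) * (𝓕 (g i) : 𝓢(ℝ, ℂ)) t,
    tensorProd, fourierInv_coe, Real.fourierInv_eq']
  refine integral_congr_ae (.of_forall fun ξ => ?_)
  simp only
  rw [Finset.prod_mul_distrib, ← Complex.exp_sum, smul_eq_mul]
  congr 2
  rw [PiLp.inner_apply, ← Finset.sum_mul, ← Complex.ofReal_sum, ← Finset.mul_sum]
  congr 3
  exact Finset.sum_congr rfl fun i _ => by simp [mul_comm]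

/-! ### Dilations -/

/-- The `L^1`-normalized dilation `t ↦ a g(a t)`. -/
def rescale (a : ℝ) (ha : a ≠ 0) (g : 𝓢(ℝ, ℂ)) : 𝓢(ℝ, ℂ) :=
  (a : ℂ) • compCLMOfContinuousLinearEquiv ℂ
    (ContinuousLinearEquiv.unitsEquivAut ℝ (Units.mk0 a ha)) g

theorem rescale_apply (a : ℝ) (ha : a ≠ 0) (g : 𝓢(ℝ, ℂ)) (t : ℝ) :
    rescale a ha g t = a * g (a * t) := by
  simp [rescale, mul_comm a t]

theorem fourier_rescale {a : ℝ} (ha : 0 < a) (g : 𝓢(ℝ, ℂ)) (ξ : ℝ) :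
    (𝓕 (rescale a ha.ne' g) : 𝓢(ℝ, ℂ)) ξ = (𝓕 g : 𝓢(ℝ, ℂ)) (ξ / a) := by
  rw [fourier_coe, fourier_coe, Real.fourier_eq', Real.fourier_eq']
  have h := Measure.integral_comp_mul_left (fun t : ℝ =>
    Complex.exp ((-2 * Real.pi * (inner ℝ t (ξ / a)) : ℝ) * Complex.I) • g t) a
  rw [abs_of_pos (inv_pos.mpr ha), eq_comm, inv_smul_eq_iff₀ ha.ne', ← integral_smul] at h
  rw [h]
  refine integral_congr_ae (.of_forall fun t => ?_)
  simp only [RCLike.inner_apply, conj_trivial, smul_eq_mul, rescale_apply, Complex.real_smul]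
  have : ξ / a * (a * t) = ξ * t := by field_simp
  rw [this]
  ring

theorem hasCompactSupport_fourier_rescale {a : ℝ} (ha : 0 < a) {g : 𝓢(ℝ, ℂ)}
    (hg : HasCompactSupport (𝓕 g : 𝓢(ℝ, ℂ))) :
    HasCompactSupport (𝓕 (rescale a ha.ne' g) : 𝓢(ℝ, ℂ)) := by
  have h : ((𝓕 (rescale a ha.ne' g) : 𝓢(ℝ, ℂ)) : ℝ → ℂ) = fun ξ => (𝓕 g : 𝓢(ℝ, ℂ)) (ξ * a⁻¹) :=
    funext fun ξ => by rw [fourier_rescale ha, div_eq_mul_inv]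
  rw [h]
  exact hg.comp_homeomorph (Homeomorph.mulRight₀ a⁻¹ (inv_ne_zero ha.ne'))

/-- The weight `b (1 + b |t|)^{-2}`. -/
def decay (b t : ℝ) : ℝ := b * ((1 + b * |t|) ^ 2)⁻¹

theorem decay_nonneg {b : ℝ} (hb : 0 ≤ b) (t : ℝ) : 0 ≤ decay b t := by
  unfold decay; positivity

theorem continuous_decay {b : ℝ} (hb : 0 ≤ b) : Continuous (decay b) := by
  unfold decay
  refine continuous_const.mul (Continuous.inv₀ (by fun_prop) fun t => ?_)
  positivity

theorem exists_decay_bound (g : 𝓢(ℝ, ℂ)) : ∃ C, 0 ≤ C ∧ ∀ t, ‖g t‖ ≤ C * decay 1 t := by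
  have h := fun t => one_add_le_sup_seminorm_apply (𝕜 := ℂ) (m := (2, 0)) (k := 2) (n := 0)
    le_rfl le_rfl g t
  refine ⟨2 ^ 2 * (Finset.Iic (2, 0)).sup (fun m => SchwartzMap.seminorm ℂ m.1 m.2) g,
    by positivity, fun t => ?_⟩
  have h1 := h t
  rw [norm_iteratedFDeriv_zero, Real.norm_eq_abs] at h1
  rw [decay, one_mul, one_mul, ← div_eq_mul_inv, le_div_iff₀ (by positivity), mul_comm]
  exact h1

namespace DualKernel

variable {L : ℕ} {K : LocalMeansKernel L} (D : DualKernel K)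

/-- The dual functions at all scales. -/
def dil : ℕ → 𝓢(ℝ, ℂ)
  | 0 => D.lam0
  | j + 1 => rescale ((2 : ℝ) ^ j) (by positivity) D.lam1

theorem hasCompactSupport_fourier_dil (j : ℕ) : HasCompactSupport (𝓕 (D.dil j) : 𝓢(ℝ, ℂ)) := by
  cases j with
  | zero => exact D.compact0
  | succ j => exact hasCompactSupport_fourier_rescale (by positivity) D.compact1

theorem fourier_dil_eq_zero (j : ℕ) {ξ : ℝ} (hξ : D.eps * 2 ^ j ≤ |ξ|) :
    (𝓕 (D.dil j) : 𝓢(ℝ, ℂ)) ξ = 0 := by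
  cases j with
  | zero => exact D.band0 ξ (by simpa using hξ)
  | succ j =>
    have h2 : (0 : ℝ) < 2 ^ j := by positivity
    change (𝓕 (rescale ((2 : ℝ) ^ j) h2.ne' D.lam1) : 𝓢(ℝ, ℂ)) ξ = 0
    rw [fourier_rescale h2]
    refine D.band1 _ ?_
    rw [abs_div, abs_of_pos h2, le_div_iff₀ h2]
    rw [pow_succ] at hξ
    linarith

theorem exists_dil_bound : ∃ C, 0 ≤ C ∧ ∀ j t, ‖D.dil j t‖ ≤ C * decay (2 ^ j) t := by
  obtain ⟨C0, hC0, h0⟩ := exists_decay_bound D.lam0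
  obtain ⟨C1, hC1, h1⟩ := exists_decay_bound D.lam1
  refine ⟨C0 + 2 * C1, by positivity, fun j t => ?_⟩
  cases j with
  | zero =>
    rw [pow_zero]
    refine (h0 t).trans ?_
    have := decay_nonneg zero_le_one t
    nlinarith
  | succ j =>
    have h2 : (0 : ℝ) < 2 ^ j := by positivity
    change ‖rescale ((2 : ℝ) ^ j) h2.ne' D.lam1 t‖ ≤ _
    rw [rescale_apply, norm_mul, Complex.norm_real, Real.norm_of_nonneg h2.le]
    have h3 := h1 (2 ^ j * t)
    -- The scale `j + 1` is a dilation by `2 ^ j`. Comparison with the decay at `2 ^ (j + 1)` costs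
    -- `4` in the inverse square and regains `2` in the prefactor.
    have h4 : (2 : ℝ) ^ j * decay 1 (2 ^ j * t) ≤ 2 * decay (2 ^ (j + 1)) t := by
      simp only [decay, one_mul, abs_mul, abs_of_pos h2]
      have h5 : 0 ≤ (2 : ℝ) ^ j * |t| := by positivity
      have h6 : ((1 + 2 ^ j * |t|) ^ 2)⁻¹ ≤ 4 * ((1 + 2 ^ (j + 1) * |t|) ^ 2)⁻¹ := by
        rw [← div_eq_mul_inv, inv_eq_one_div, div_le_div_iff₀ (by positivity) (by positivity)]
        rw [pow_succ (2 : ℝ) j]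
        nlinarith
      rw [pow_succ (2 : ℝ) j] at h6 ⊢
      nlinarith
    have h7 := decay_nonneg (b := 2 ^ (j + 1)) (by positivity) t
    calc _ ≤ 2 ^ j * (C1 * decay 1 (2 ^ j * t)) := by gcongr
      _ = C1 * (2 ^ j * decay 1 (2 ^ j * t)) := by ring
      _ ≤ C1 * (2 * decay (2 ^ (j + 1)) t) := by gcongr
      _ ≤ _ := by nlinarith

/-- The convolution of the kernels of a given scale. -/
theorem conv_dil (j : ℕ) (t : ℝ) : ∫ y, K.dilate j y * D.dil j (t - y) =
    match j with
    | 0 => D.kap t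
    | j + 1 => (2 : ℂ) ^ (j + 1) * D.kap (2 ^ (j + 1) * t) - (2 : ℂ) ^ j * D.kap (2 ^ j * t) := by
  cases j with
  | zero => exact D.conv0 t
  | succ j =>
    have h2 : (0 : ℝ) < 2 ^ j := by positivity
    change ∫ y, (2 : ℂ) ^ j * K.psi1 (2 ^ j * y) * rescale ((2 : ℝ) ^ j) h2.ne' D.lam1 (t - y) = _
    have h := Measure.integral_comp_mul_left
      (fun y : ℝ => K.psi1 y * D.lam1 (2 ^ j * t - y)) ((2 : ℝ) ^ j)
    rw [D.conv1, abs_of_pos (inv_pos.mpr h2), eq_comm, inv_smul_eq_iff₀ h2.ne',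
      Complex.real_smul] at h
    have e : ∀ y, (2 : ℂ) ^ j * K.psi1 (2 ^ j * y) *
        rescale ((2 : ℝ) ^ j) h2.ne' D.lam1 (t - y) =
        (2 : ℂ) ^ j * ((2 : ℂ) ^ j * (K.psi1 (2 ^ j * y) * D.lam1 (2 ^ j * t - 2 ^ j * y))) := by
      intro y
      rw [rescale_apply, mul_sub]
      push_cast
      ring
    simp_rw [e]
    rw [integral_const_mul, integral_const_mul]
    push_cast at h
    rw [← h, pow_succ, pow_succ (2 : ℝ), ← mul_assoc, mul_comm ((2 : ℝ) * 2 ^ j)]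
    ring_nf

/-- The convolution at scale `j + 1` is the difference of the dilates of `kap` by `2 ^ (j + 1)` and
`2 ^ j`, so the sum telescopes. -/
theorem sum_conv_dil (J : ℕ) (t : ℝ) :
    ∑ j ∈ Finset.range (J + 1), ∫ y, K.dilate j y * D.dil j (t - y) =
      rescale ((2 : ℝ) ^ J) (by positivity) D.kap t := by
  rw [rescale_apply]
  induction J with
  | zero =>
    rw [Finset.sum_range_one, D.conv_dil]
    simp
  | succ J ih =>
    rw [Finset.sum_range_succ, ih, D.conv_dil]
    push_cast
    ring

/-- The dual tensor product kernels. -/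
def tens {d : ℕ} (m : Fin d → ℕ) : 𝓢(Rd d, ℂ) :=
  tensorProd (fun i => D.dil (m i)) fun i => D.hasCompactSupport_fourier_dil (m i)

theorem tens_apply {d : ℕ} (m : Fin d → ℕ) (x : Rd d) :
    D.tens m x = ∏ i, D.dil (m i) (x i) := tensorProd_apply _ _ x

/-- The approximate identity. -/
def approx {d : ℕ} (J : ℕ) : 𝓢(Rd d, ℂ) :=
  tensorProd (fun _ => rescale ((2 : ℝ) ^ J) (by positivity) D.kap)
    fun _ => hasCompactSupport_fourier_rescale (by positivity) D.compactK

theorem approx_apply {d : ℕ} (J : ℕ) (x : Rd d) :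
    D.approx J x = ∏ i, rescale ((2 : ℝ) ^ J) (by positivity) D.kap (x i) :=
  tensorProd_apply _ _ x

end DualKernel

end

end FrolovCubature

namespace FrolovCubature

noncomputable section

/-! ### Localization of distributions -/

/-- Vanishing near each point of the compact support of `φ` is only local information. A finite
subcover and a subordinate smooth partition of unity split `φ` into test functions on which `u`
vanishes. -/
theorem apply_eq_zero_of_disjoint_dsupport {d : ℕ} (u : 𝓢'(Rd d, ℂ)) {φ : 𝓢(Rd d, ℂ)}
    (hc : HasCompactSupport φ) (h : Disjoint (tsupport φ) (Distribution.dsupport u)) :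
    u φ = 0 := by
  have h1 : ∀ x ∈ tsupport φ, ∃ s : Set (Rd d), Distribution.IsVanishingOn u s ∧ IsOpen s ∧ x ∈ s :=
    fun x hx => (Distribution.notMem_dsupport_iff x).mp (Set.disjoint_left.mp h hx)
  choose! U hU hUo hUm using h1
  obtain ⟨t, ht⟩ := IsCompact.elim_finite_subcover hc (fun x : tsupport φ => U x)
    (fun x => hUo x x.2) fun x hx => Set.mem_iUnion.mpr ⟨⟨x, hx⟩, hUm x hx⟩
  obtain ⟨ρ, hρ⟩ := SmoothPartitionOfUnity.exists_isSubordinate (modelWithCornersSelf ℝ (Rd d))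
    (isClosed_tsupport φ) (fun x : t => U x.1) (fun x => hUo _ x.1.2) fun x hx => by
      have := ht hx
      simp only [Set.mem_iUnion] at this ⊢
      obtain ⟨i, hi, hx⟩ := this
      exact ⟨⟨i, hi⟩, hx⟩
  have hsm : ∀ i, ContDiff ℝ ((⊤ : ℕ∞) : WithTop ℕ∞) fun y => (ρ i y : ℂ) * φ y := fun i =>
    (Complex.ofRealCLM.contDiff.comp ((ρ i).contMDiff.contDiff)).mul (φ.smooth ⊤)
  have hcs : ∀ i, HasCompactSupport fun y => (ρ i y : ℂ) * φ y := fun i => hc.mul_left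
  have hsum : φ = ∑ i, (hcs i).toSchwartzMap (hsm i) := by
    ext y
    rw [sum_apply]
    change φ y = ∑ i, (ρ i y : ℂ) * φ y
    by_cases hy : y ∈ tsupport φ
    · have := ρ.sum_eq_one hy
      rw [finsum_eq_sum_of_fintype] at this
      rw [← Finset.sum_mul, ← Complex.ofReal_sum, this, Complex.ofReal_one, one_mul]
    · simp [image_eq_zero_of_notMem_tsupport hy]
  rw [hsum, map_sum]
  refine Finset.sum_eq_zero fun i _ => hU i.1 i.1.2 _ ?_
  refine subset_trans (closure_mono fun y hy => ?_) (hρ i)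
  change (ρ i y : ℂ) * φ y ≠ 0 at hy
  exact fun h0 => hy (by rw [h0]; simp)

/-- The closed box `[-R,R]^d`. -/
def box (d : ℕ) (R : ℝ) : Set (Rd d) := {x | ∀ i, |x i| ≤ R}

theorem isCompact_box (d : ℕ) (R : ℝ) : IsCompact (box d R) := by
  have h := (EuclideanSpace.equiv (Fin d) ℝ).toHomeomorph.isCompact_preimage.mpr
    (isCompact_univ_pi fun _ : Fin d => isCompact_Icc (a := -R) (b := R))
  convert! h using 1
  ext x
  simp only [box, abs_le, Set.mem_preimage, Set.mem_univ_pi, Set.mem_Icc]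
  rfl

namespace LocalMeansKernel

variable {L : ℕ} (K : LocalMeansKernel L)

/-- For `j ≥ 1` the dilation factor is at least one and shrinks the support, so a single radius
serves all scales. All local means of `u` then live in one common box. -/
theorem exists_dilate_support : ∃ R, 0 ≤ R ∧ ∀ j t, R < |t| → K.dilate j t = 0 := by
  obtain ⟨R0, hR0⟩ := K.hasCompactSupport_psi0.isCompact.isBounded.exists_norm_le
  obtain ⟨R1, hR1⟩ := K.hasCompactSupport_psi1.isCompact.isBounded.exists_norm_le
  refine ⟨max 0 (max R0 R1), le_max_left _ _, fun j t ht => ?_⟩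
  simp only [max_lt_iff] at ht
  cases j with
  | zero =>
    refine image_eq_zero_of_notMem_tsupport fun h => ?_
    have := hR0 t h
    rw [Real.norm_eq_abs] at this
    linarith
  | succ j =>
    change (2 : ℂ) ^ j * K.psi1 ((2 : ℝ) ^ j * t) = 0
    suffices h0 : K.psi1 ((2 : ℝ) ^ j * t) = 0 by rw [h0, mul_zero]
    refine image_eq_zero_of_notMem_tsupport fun h => ?_
    have := hR1 _ h
    rw [Real.norm_eq_abs, abs_mul, abs_of_pos (by positivity)] at this
    have h1 : (1 : ℝ) ≤ 2 ^ j := one_le_pow₀ (by norm_num)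
    nlinarith [abs_nonneg t]

theorem testFunction_eq_translate {d : ℕ} (m : Fin d → ℕ) (x : Rd d) :
    K.testFunction m x = compSubConstCLM ℂ x (K.testFunction m 0) := by
  ext y
  change K.tensor m (x - y) = K.tensor m (0 - (y - x))
  rw [zero_sub, neg_sub]

theorem continuous_conv {d : ℕ} (u : 𝓢'(Rd d, ℂ)) (m : Fin d → ℕ) : Continuous (K.conv u m) := by
  have h := continuous_apply_compSubConstCLM u (K.testFunction m 0)
  simp_rw [← K.testFunction_eq_translate m] at h
  exact h

theorem exists_conv_support (d : ℕ) : ∃ R, 0 ≤ R ∧ ∀ (u : 𝓢'(Rd d, ℂ)),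
    Distribution.dsupport u ⊆ unitCube d → ∀ m x, x ∉ box d R → K.conv u m x = 0 := by
  obtain ⟨R, hR, h⟩ := K.exists_dilate_support
  refine ⟨R + 1, by linarith, fun u hu m x hx => ?_⟩
  refine apply_eq_zero_of_disjoint_dsupport u
    ((K.hasCompactSupport_tensor m).comp_homeomorph (Homeomorph.subLeft x))
    (Set.disjoint_left.mpr fun y hy hy' => hx fun i => ?_)
  have hs : tsupport (K.testFunction m x) ⊆ {y | |x i - y i| ≤ R} := by
    refine closure_minimal (fun z hz => ?_) (isClosed_le (by fun_prop) continuous_const)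
    by_contra hcon
    exact hz (Finset.prod_eq_zero (Finset.mem_univ i) (h _ _ (not_le.mp hcon)))
  have h1 : |x i - y i| ≤ R := hs hy
  rw [abs_le] at h1
  have h2 := hu hy' i
  rw [abs_le]
  constructor <;> linarith [h1.1, h1.2, h2.1, h2.2]

theorem hasCompactSupport_conv {d : ℕ} (u : 𝓢'(Rd d, ℂ))
    (hu : Distribution.dsupport u ⊆ unitCube d) (m : Fin d → ℕ) :
    HasCompactSupport (K.conv u m) := by
  obtain ⟨R, -, h⟩ := K.exists_conv_support d
  refine HasCompactSupport.of_support_subset_isCompact (isCompact_box d R) fun x hx => ?_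
  by_contra hcon
  exact hx (h u hu m x hcon)

theorem integrable_conv {d : ℕ} (u : 𝓢'(Rd d, ℂ))
    (hu : Distribution.dsupport u ⊆ unitCube d) (m : Fin d → ℕ) :
    Integrable (K.conv u m) :=
  (K.continuous_conv u m).integrable_of_hasCompactSupport (K.hasCompactSupport_conv u hu m)

end LocalMeansKernel

/-! ### The reproducing formula -/

/-- The reflected translate `y ↦ φ(x - y)`. -/
def reflectAt {d : ℕ} (φ : 𝓢(Rd d, ℂ)) (x : Rd d) : 𝓢(Rd d, ℂ) :=
  compSubConstCLM ℂ x (compCLMOfContinuousLinearEquiv ℂ (ContinuousLinearEquiv.neg ℝ) φ)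

theorem reflectAt_apply {d : ℕ} (φ : 𝓢(Rd d, ℂ)) (x y : Rd d) : reflectAt φ x y = φ (x - y) := by
  change φ (-(y - x)) = φ (x - y)
  rw [neg_sub]

/-- Both sides equal `u` applied to the convolution of `φ` with the reflection of `η`, written in
the two possible orders. -/
theorem integral_mul_apply_reflectAt {d : ℕ} (u : 𝓢'(Rd d, ℂ)) (φ η : 𝓢(Rd d, ℂ)) :
    ∫ x, φ x * u (reflectAt η x) = ∫ t, η (-t) * u (compSubConstCLM ℂ t φ) := by
  have h1 := apply_schwartzConv u φ (reflectAt η 0)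
  have h2 := apply_schwartzConv u (reflectAt η 0) φ
  have h3 : schwartzConv φ (reflectAt η 0) = schwartzConv (reflectAt η 0) φ := by
    ext w
    rw [schwartzConv_apply, schwartzConv_apply]
    rw [← integral_sub_left_eq_self _ volume w]
    refine integral_congr_ae (.of_forall fun x => ?_)
    simp only [sub_sub_cancel]
    rw [mul_comm]
  have h4 : ∀ x, compSubConstCLM ℂ x (reflectAt η 0) = reflectAt η x := by
    intro x
    ext y
    rw [compSubConstCLM_apply, reflectAt_apply, reflectAt_apply, zero_sub, neg_sub]
  simp_rw [h4] at h1
  rw [← h1, h3, h2]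
  refine integral_congr_ae (.of_forall fun t => ?_)
  simp only
  rw [reflectAt_apply, zero_sub]

namespace DualKernel

variable {L : ℕ} {K : LocalMeansKernel L} (D : DualKernel K)

/-- The part of scale `m` of the reproducing formula. -/
def part {d : ℕ} (u : 𝓢'(Rd d, ℂ)) (m : Fin d → ℕ) (x : Rd d) : ℂ :=
  ∫ y, D.tens m (x - y) * K.conv u m y

theorem part_eq {d : ℕ} (u : 𝓢'(Rd d, ℂ)) (m : Fin d → ℕ) (x : Rd d) :
    D.part u m x = u (schwartzConv (reflectAt (D.tens m) x) (K.testFunction m 0)) := by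
  rw [apply_schwartzConv]
  refine integral_congr_ae (.of_forall fun y => ?_)
  simp only
  rw [reflectAt_apply, ← K.testFunction_eq_translate]
  rfl

/-- Summing the tensor kernels over a cube of indices gives a product of one-dimensional sums, each
of which telescopes to a dilate of `kap`. -/
theorem sum_part {d : ℕ} (u : 𝓢'(Rd d, ℂ)) (J : ℕ) (x : Rd d) :
    ∑ m ∈ Fintype.piFinset fun _ : Fin d => Finset.range (J + 1), D.part u m x =
      u (reflectAt (D.approx J) x) := by
  simp_rw [D.part_eq]
  rw [← map_sum]
  congr 1
  ext w
  rw [sum_apply, reflectAt_apply, D.approx_apply]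
  simp_rw [← D.sum_conv_dil]
  rw [Finset.prod_univ_sum]
  refine Finset.sum_congr rfl fun m _ => ?_
  rw [schwartzConv_apply, ← integral_prod_coord]
  have h := integral_add_right_eq_self (μ := volume)
    (fun y : Rd d => reflectAt (D.tens m) x y * K.testFunction m 0 (w - y)) w
  rw [← h]
  refine integral_congr_ae (.of_forall fun y => ?_)
  simp only
  rw [reflectAt_apply, D.tens_apply]
  change _ * K.tensor m (0 - (w - (y + w))) = _
  rw [LocalMeansKernel.tensor, ← Finset.prod_mul_distrib]
  refine Finset.prod_congr rfl fun i _ => ?_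
  simp only [PiLp.sub_apply, PiLp.add_apply, PiLp.zero_apply]
  rw [mul_comm]
  congr 2 <;> ring

theorem approx_eq {d : ℕ} (J : ℕ) (x : Rd d) :
    D.approx J x = ((2 : ℝ) ^ J) ^ d • D.approx 0 ((2 : ℝ) ^ J • x) := by
  rw [D.approx_apply, D.approx_apply, Complex.real_smul]
  simp_rw [rescale_apply]
  rw [Finset.prod_mul_distrib]
  simp

theorem integral_approx_zero {d : ℕ} : ∫ x : Rd d, D.approx 0 x = 1 := by
  simp_rw [D.approx_apply]
  rw [integral_prod_coord fun _ t => rescale ((2 : ℝ) ^ 0) (by positivity) D.kap t]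
  simp [rescale_apply, D.integral_kap]

/-- The partial sums mollify `u` by the approximate identity. After rescaling to the fixed kernel
`approx 0`, dominated convergence applies, since `u` grows at most polynomially along translates of
`φ` and the kernel is Schwartz. -/
theorem tendsto_integral_sum_part {d : ℕ} (u : 𝓢'(Rd d, ℂ)) (φ : 𝓢(Rd d, ℂ)) :
    Filter.Tendsto (fun J : ℕ => ∫ x, φ x *
      ∑ m ∈ Fintype.piFinset fun _ : Fin d => Finset.range (J + 1), D.part u m x)
      Filter.atTop (nhds (u φ)) := by
  simp_rw [D.sum_part, integral_mul_apply_reflectAt]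
  obtain ⟨C, k, hC0, hC⟩ := exists_translate_growth u φ
  have h1 : ∀ J : ℕ, ∫ t, D.approx J (-t) * u (compSubConstCLM ℂ t φ) =
      ∫ t, D.approx 0 (-t) * u (compSubConstCLM ℂ (((2 : ℝ) ^ J)⁻¹ • t) φ) := by
    intro J
    have h2 : (0 : ℝ) < 2 ^ J := by positivity
    have h := Measure.integral_comp_smul (volume : Measure (Rd d)) (fun t =>
      D.approx 0 (-t) * u (compSubConstCLM ℂ (((2 : ℝ) ^ J)⁻¹ • t) φ)) ((2 : ℝ) ^ J)
    rw [finrank_euclideanSpace, Fintype.card_fin, abs_of_pos (by positivity), eq_comm,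
      inv_smul_eq_iff₀ (by positivity), ← integral_smul] at h
    rw [h]
    refine integral_congr_ae (.of_forall fun t => ?_)
    simp only
    rw [D.approx_eq, smul_smul, inv_mul_cancel₀ h2.ne', one_smul, smul_neg, smul_mul_assoc]
  simp_rw [h1]
  have h3 : u φ = ∫ t : Rd d, D.approx 0 (-t) * u φ := by
    rw [integral_mul_const, integral_neg_eq_self (fun t => D.approx 0 t), D.integral_approx_zero,
      one_mul]
  rw [h3]
  have hint := (integrable_one_add_pow_mul (D.approx (d := d) 0) k).comp_neg.mul_const C
  refine tendsto_integral_of_dominated_convergence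
    (fun t => (1 + ‖-t‖) ^ k * ‖D.approx 0 (-t)‖ * C) (fun J => ?_) hint (fun J => ?_) ?_
  · refine (Continuous.mul ?_ ?_).aestronglyMeasurable
    · exact (D.approx 0).continuous.comp continuous_neg
    · exact (continuous_apply_compSubConstCLM u φ).comp (continuous_const_smul _)
  · refine .of_forall fun t => ?_
    rw [norm_mul]
    have h4 : ‖((2 : ℝ) ^ J)⁻¹ • t‖ ≤ ‖-t‖ := by
      rw [norm_smul, norm_neg, Real.norm_of_nonneg (by positivity)]
      exact mul_le_of_le_one_left (norm_nonneg _) (inv_le_one_of_one_le₀ (one_le_pow₀ (by norm_num)))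
    calc _ ≤ ‖D.approx 0 (-t)‖ * (C * (1 + ‖((2 : ℝ) ^ J)⁻¹ • t‖) ^ k) := by
          gcongr
          exact hC _
      _ ≤ ‖D.approx 0 (-t)‖ * (C * (1 + ‖-t‖) ^ k) := by gcongr
      _ = _ := by ring
  · refine .of_forall fun t => ?_
    have h5 : Filter.Tendsto (fun J : ℕ => ((2 : ℝ) ^ J)⁻¹ • t) Filter.atTop (nhds ((0 : ℝ) • t)) := by
      refine Filter.Tendsto.smul_const ?_ t
      exact tendsto_inv_atTop_zero.comp (tendsto_pow_atTop_atTop_of_one_lt (by norm_num))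
    rw [zero_smul] at h5
    have h6 := ((continuous_apply_compSubConstCLM u φ).tendsto 0).comp h5
    rw [compSubConstCLM_zero] at h6
    exact h6.const_mul _

theorem continuous_part {d : ℕ} (u : 𝓢'(Rd d, ℂ))
    (hu : Distribution.dsupport u ⊆ unitCube d) (m : Fin d → ℕ) : Continuous (D.part u m) := by
  obtain ⟨C, -, hC⟩ := (D.tens (d := d) m).decay 0 0
  refine continuous_of_dominated (bound := fun y => C * ‖K.conv u m y‖) (fun x => ?_) (fun x => ?_)
    ((K.integrable_conv u hu m).norm.const_mul _) (.of_forall fun y => ?_)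
  · exact (((D.tens m).continuous.comp (by fun_prop)).mul
      (K.continuous_conv u m)).aestronglyMeasurable
  · refine .of_forall fun y => ?_
    rw [norm_mul]
    gcongr
    simpa using hC (x - y)
  · exact ((D.tens m).continuous.comp (by fun_prop)).mul continuous_const

theorem tendsto_piFinset_range (d : ℕ) :
    Filter.Tendsto (fun J : ℕ => Fintype.piFinset fun _ : Fin d => Finset.range (J + 1))
      Filter.atTop Filter.atTop := by
  refine Filter.tendsto_atTop_finset_of_monotone (fun a b hab => ?_) fun m => ?_
  · refine Fintype.piFinset_subset _ _ fun i => ?_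
    exact Finset.range_subset_range.mpr (by omega)
  · refine ⟨∑ i, m i, Fintype.mem_piFinset.mpr fun i => Finset.mem_range.mpr ?_⟩
    exact Nat.lt_succ_of_le (Finset.single_le_sum (f := m) (fun _ _ => Nat.zero_le _)
      (Finset.mem_univ i))

/-- A summable uniform bound makes the series of parts converge in the space of bounded continuous
functions; its sum represents `u` because the partial sums also converge to `u` as distributions. -/
theorem exists_represents {d : ℕ} (u : 𝓢'(Rd d, ℂ))
    (hu : Distribution.dsupport u ⊆ unitCube d) {M : (Fin d → ℕ) → ℝ} (hM : Summable M)
    (h : ∀ m x, ‖D.part u m x‖ ≤ M m) :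
    ∃ f : Rd d →ᵇ ℂ, Represents f u ∧ ∀ x, HasSum (fun m => D.part u m x) (f x) := by
  let F : (Fin d → ℕ) → (Rd d →ᵇ ℂ) := fun m =>
    BoundedContinuousFunction.ofNormedAddCommGroup (D.part u m) (D.continuous_part u hu m) (M m)
      (h m)
  have h0 : ∀ m, 0 ≤ M m := fun m => (norm_nonneg _).trans (h m 0)
  have hF : Summable F := Summable.of_norm_bounded hM fun m =>
    BoundedContinuousFunction.norm_ofNormedAddCommGroup_le _ (h0 m) _
  have hx : ∀ x, HasSum (fun m => D.part u m x) ((∑' m, F m) x) := fun x =>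
    (BoundedContinuousFunction.evalCLM ℂ x).hasSum hF.hasSum
  refine ⟨∑' m, F m, fun φ => ?_, hx⟩
  refine tendsto_nhds_unique (D.tendsto_integral_sum_part u φ) ?_
  refine tendsto_integral_of_dominated_convergence (fun x => ‖φ x‖ * ∑' m, M m) (fun J => ?_)
    (φ.integrable.norm.mul_const _) (fun J => .of_forall fun x => ?_) (.of_forall fun x => ?_)
  · exact (φ.continuous.mul (continuous_finsetSum _
      fun m _ => D.continuous_part u hu m)).aestronglyMeasurable
  · rw [norm_mul]
    gcongr
    exact (norm_sum_le_of_le _ fun m _ => h m x).trans (hM.sum_le_tsum _ fun m _ => h0 m)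
  · exact ((hx x).comp (tendsto_piFinset_range d)).const_mul _

end DualKernel

theorem isClosed_unitCube (d : ℕ) : IsClosed (unitCube d) := by
  have : unitCube d = ⋂ i, (fun x : Rd d => x i) ⁻¹' Set.Icc 0 1 := by
    ext x
    simp [unitCube]
  rw [this]
  exact isClosed_iInter fun i => isClosed_Icc.preimage (by fun_prop)

theorem Represents.eq_zero_of_notMem {d : ℕ} {f : Rd d →ᵇ ℂ} {u : 𝓢'(Rd d, ℂ)}
    (h : Represents f u) (hu : Distribution.dsupport u ⊆ unitCube d) {x : Rd d}
    (hx : ∃ i, x i ≤ 0 ∨ 1 ≤ x i) : f x = 0 := by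
  have hcl := isClosed_unitCube d
  have hae : ∀ᵐ x : Rd d, x ∈ (unitCube d)ᶜ → f x = 0 := by
    refine IsOpen.ae_eq_zero_of_integral_contDiff_smul_eq_zero hcl.isOpen_compl
      ((f.continuous.locallyIntegrable).locallyIntegrableOn _) fun g hg hgc hgs => ?_
    have hsm : ContDiff ℝ ((⊤ : ℕ∞) : WithTop ℕ∞) fun y => (g y : ℂ) :=
      Complex.ofRealCLM.contDiff.comp hg
    have hcs : HasCompactSupport fun y => (g y : ℂ) := hgc.comp_left Complex.ofReal_zero
    have hts : tsupport (hcs.toSchwartzMap hsm) ⊆ tsupport g :=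
      closure_mono fun z hz h0 => hz (by change (g z : ℂ) = 0; rw [h0, Complex.ofReal_zero])
    have h0 : u (hcs.toSchwartzMap hsm) = 0 :=
      apply_eq_zero_of_disjoint_dsupport u (φ := hcs.toSchwartzMap hsm) hcs
        (Set.disjoint_left.mpr fun y hy hy' => hgs (hts hy) (hu hy'))
    rw [← h0, h]
    exact integral_congr_ae (.of_forall fun y => Complex.real_smul)
  have hoff : ∀ x ∈ (unitCube d)ᶜ, f x = 0 := by
    have h2 := Measure.eqOn_open_of_ae_eq (μ := (volume : Measure (Rd d))) (f := f)
      (g := fun _ => (0 : ℂ)) ((ae_restrict_iff' hcl.isOpen_compl.measurableSet).mpr hae)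
      hcl.isOpen_compl f.continuous.continuousOn continuousOn_const
    exact fun x hx => h2 hx
  -- Continuity carries the vanishing over to the boundary faces, which lie in the closure of the
  -- complement. This makes the half-open cube in the rule harmless: the sum may be taken over the
  -- whole lattice.
  have hclo : Set.EqOn f (fun _ => (0 : ℂ)) (closure (unitCube d)ᶜ) :=
    (Set.EqOn.closure (f := f) (g := fun _ => (0 : ℂ)) hoff f.continuous continuous_const)
  refine hclo ?_
  obtain ⟨i, hi⟩ := hx
  have hseq : ∀ v : Rd d, Filter.Tendsto (fun t : ℝ => x + t • v) (nhdsWithin 0 (Set.Ioi 0))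
      (nhds x) := by
    intro v
    have : Filter.Tendsto (fun t : ℝ => x + t • v) (nhds 0) (nhds (x + (0 : ℝ) • v)) :=
      Continuous.tendsto (by fun_prop) 0
    rw [zero_smul, add_zero] at this
    exact this.mono_left nhdsWithin_le_nhds
  have hmem : ∀ v : Rd d, (∀ t : ℝ, 0 < t → x i + t * v i ∉ Set.Icc (0 : ℝ) 1) →
      x ∈ closure (unitCube d)ᶜ := by
    intro v hv
    refine mem_closure_of_tendsto (hseq v) ?_
    filter_upwards [self_mem_nhdsWithin] with t ht hmem
    exact hv t ht (by simpa using hmem i)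
  rcases hi with hi | hi
  · refine hmem (EuclideanSpace.single i (-1)) fun t ht hc => ?_
    have := hc.1
    simp at this
    linarith
  · refine hmem (EuclideanSpace.single i 1) fun t ht hc => ?_
    have := hc.2
    simp at this
    linarith

end

end FrolovCubature

namespace FrolovCubature

noncomputable section

/-! ### Poisson summation -/

theorem hasSum_setIntegral_add_int {d : ℕ} {G : (Fin d → ℝ) → ℂ} (hG : Integrable G) :
    HasSum (fun z : Fin d → ℤ => ∫ x in {x : Fin d → ℝ | ∀ i, x i ∈ Set.Ioc ((0 : Fin d → ℝ) i) ((0 : Fin d → ℝ) i + 1)},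
      G (fun i => x i + z i)) (∫ x, G x) := by
  set S : (Fin d → ℤ) → Set (Fin d → ℝ) := fun z => {x | ∀ i, x i ∈ Set.Ioc (z i : ℝ) (z i + 1)}
  have hS : ∀ z, MeasurableSet (S z) := fun z => MeasurableSet.univ_pi' fun i => measurableSet_Ioc
  have hdis : Pairwise (Function.onFun Disjoint S) := by
    intro z w hzw
    refine Set.disjoint_left.mpr fun x hx hx' => hzw (funext fun i => ?_)
    have h1 := hx i
    have h2 := hx' i
    have h3 : (z i : ℝ) < w i + 1 := h1.1.trans_le h2.2
    have h4 : (w i : ℝ) < z i + 1 := h2.1.trans_le h1.2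
    have h5 : z i < w i + 1 := by exact_mod_cast h3
    have h6 : w i < z i + 1 := by exact_mod_cast h4
    omega
  have hun : ⋃ z, S z = Set.univ := by
    refine Set.eq_univ_of_forall fun x => Set.mem_iUnion.mpr ⟨fun i => ⌈x i⌉ - 1, fun i => ?_⟩
    push_cast
    constructor
    · linarith [Int.ceil_lt_add_one (x i)]
    · linarith [Int.le_ceil (x i)]
  have h := hasSum_integral_iUnion hS hdis (f := G) (μ := volume) hG.integrableOn
  rw [hun, setIntegral_univ] at h
  convert! h using 2 with z
  have hmp := measurePreserving_add_right (volume : Measure (Fin d → ℝ)) (fun i => (z i : ℝ))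
  have := hmp.setIntegral_preimage_emb
    (MeasurableEquiv.addRight (fun i => (z i : ℝ))).measurableEmbedding G (S z)
  rw [← this]
  congr 2
  ext x
  simp [S, Set.mem_Ioc, add_comm _ (1 : ℝ)]

theorem mFourier_neg_apply {d : ℕ} (n : Fin d → ℤ) (x : Fin d → ℝ) :
    UnitAddTorus.mFourier (-n) (fun i => (x i : UnitAddCircle)) =
      ∏ i, Complex.exp (-(2 * Real.pi * Complex.I * n i * x i)) := by
  change ∏ i, fourier ((-n) i) (x i : UnitAddCircle) = _
  refine Finset.prod_congr rfl fun i _ => ?_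
  rw [fourier_coe_apply]
  congr 1
  push_cast [Pi.neg_apply]
  ring

/-- The periodization of `G` descends to a continuous function on the torus whose Fourier
coefficients are those of `G` at integer frequencies. All but the zeroth vanish, so the Fourier
series is the constant `∫ G`, and evaluation at the origin gives the claim. -/
theorem tsum_int_eq_integral {d : ℕ} {G : (Fin d → ℝ) → ℂ} (hc : Continuous G)
    (hint : Integrable G)
    (hb : ∀ R : ℝ, ∃ B : (Fin d → ℤ) → ℝ, Summable B ∧ ∀ (z : Fin d → ℤ) (x : Fin d → ℝ), (∀ i, |x i| ≤ R) →
      ‖G (fun i => x i + z i)‖ ≤ B z)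
    (hF : ∀ n : Fin d → ℤ, n ≠ 0 →
      ∫ x, (∏ i, Complex.exp (-(2 * Real.pi * Complex.I * n i * x i))) * G x = 0) :
    ∑' z : Fin d → ℤ, G (fun i => z i) = ∫ x, G x := by
  set P : (Fin d → ℝ) → ℂ := fun x => ∑' z : Fin d → ℤ, G (fun i => x i + z i) with hP
  have hPc : Continuous P := by
    rw [continuous_iff_continuousAt]
    intro x
    obtain ⟨B, hB, hBb⟩ := hb (‖x‖ + 1)
    have hon : ContinuousOn P (Metric.ball x 1) := by
      refine continuousOn_tsum (u := B) (fun z => Continuous.continuousOn (hc.comp (by fun_prop)))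
        hB fun z w hw => hBb z w fun i => ?_
      have h1 : ‖w‖ ≤ ‖x‖ + 1 := by
        have := norm_sub_norm_le w x
        rw [Metric.mem_ball, dist_eq_norm] at hw
        linarith
      exact (norm_le_pi_norm w i).trans h1
    exact hon.continuousAt (Metric.ball_mem_nhds x one_pos)
  have hper : ∀ (x : Fin d → ℝ) (w : Fin d → ℤ), P (fun i => x i + w i) = P x := by
    intro x w
    have := (Equiv.addLeft w).tsum_eq fun z : Fin d → ℤ => G (fun i => x i + z i)
    rw [hP]
    simp only
    rw [← this]
    refine tsum_congr fun z => ?_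
    congr 1
    ext i
    simp only [Equiv.coe_addLeft, Pi.add_apply]
    push_cast
    ring
  set π : (Fin d → ℝ) → UnitAddTorus (Fin d) := fun x i => (x i : UnitAddCircle) with hπ
  have hq : IsOpenQuotientMap π :=
    IsOpenQuotientMap.piMap (f := fun (_ : Fin d) (t : ℝ) => (t : UnitAddCircle)) fun _ =>
      QuotientAddGroup.isOpenQuotientMap_mk
  -- An arbitrary section of the quotient map is used; periodicity of `P` makes the value
  -- independent of it.
  set F : UnitAddTorus (Fin d) → ℂ := fun t => P (Function.surjInv hq.surjective t) with hFdef
  have hFπ : ∀ x, F (π x) = P x := by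
    intro x
    have h1 := Function.surjInv_eq hq.surjective (π x)
    set y := Function.surjInv hq.surjective (π x)
    have h2 : ∀ i, ∃ w : ℤ, y i = x i + w := by
      intro i
      have h3 := congrFun h1 i
      simp only [hπ] at h3
      rw [← sub_eq_zero, ← AddCircle.coe_sub, AddCircle.coe_eq_zero_iff] at h3
      obtain ⟨w, hw⟩ := h3
      refine ⟨w, ?_⟩
      rw [zsmul_eq_mul, mul_one] at hw
      linarith
    choose w hw using h2
    have : y = fun i => x i + w i := funext hw
    change P y = P x
    rw [this, hper]
  have hFc : Continuous F := by
    rw [hq.isQuotientMap.continuous_iff]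
    exact hPc.congr fun x => (hFπ x).symm
  have hcoef : ∀ n : Fin d → ℤ, UnitAddTorus.mFourierCoeff F n =
      ∫ x, (∏ i, Complex.exp (-(2 * Real.pi * Complex.I * n i * x i))) * G x := by
    intro n
    set e : (Fin d → ℝ) → ℂ := fun x =>
      ∏ i, Complex.exp (-(2 * Real.pi * Complex.I * n i * x i)) with he
    have hen : ∀ x, ‖e x‖ = 1 := by
      intro x
      rw [he, norm_prod]
      refine Finset.prod_eq_one fun i _ => ?_
      rw [Complex.norm_exp]
      simp
    have hec : Continuous e := by
      simp only [he]
      fun_prop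
    have heG : Integrable fun x => e x * G x :=
      hint.norm.mono' ((hec.mul hc).aestronglyMeasurable)
        (.of_forall fun x => by rw [norm_mul, hen, one_mul])
    have heper : ∀ (x : Fin d → ℝ) (z : Fin d → ℤ), e (fun i => x i + z i) = e x := by
      intro x z
      simp only [he]
      refine Finset.prod_congr rfl fun i _ => ?_
      rw [Complex.exp_eq_exp_iff_exists_int]
      refine ⟨-(n i * z i), ?_⟩
      push_cast
      ring
    have h1 := hasSum_setIntegral_add_int heG
    rw [UnitAddTorus.mFourierCoeff_eq_integral F n 0, ← h1.tsum_eq]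
    obtain ⟨B, hB, hBb⟩ := hb 1
    set Q := {x : Fin d → ℝ | ∀ i, x i ∈ Set.Ioc ((0 : Fin d → ℝ) i) ((0 : Fin d → ℝ) i + 1)} with hQ
    have hQv : volume Q ≠ ∞ := by
      have hsub : Q ⊆ Set.Icc 0 1 := fun x hx =>
        ⟨fun i => (hx i).1.le, fun i => by simpa using (hx i).2⟩
      exact ne_top_of_le_ne_top isCompact_Icc.measure_lt_top.ne (measure_mono hsub)
    have hQm : MeasurableSet Q := MeasurableSet.univ_pi' fun i => measurableSet_Ioc
    have hQb : ∀ z, ∀ x ∈ Q, ‖e (fun i => x i + z i) * G (fun i => x i + z i)‖ ≤ B z := by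
      intro z x hx
      rw [norm_mul, hen, one_mul]
      refine hBb z x fun i => ?_
      have := hx i
      simp only [Pi.zero_apply, zero_add, Set.mem_Ioc] at this
      rw [abs_of_pos this.1]
      exact this.2
    have hcz : ∀ z : Fin d → ℤ, Continuous fun x : Fin d → ℝ =>
        e (fun i => x i + z i) * G (fun i => x i + z i) := fun z =>
      (hec.comp (by fun_prop)).mul (hc.comp (by fun_prop))
    rw [eq_comm]
    have h2 := integral_tsum_of_summable_integral_norm (μ := volume.restrict Q)
      (F := fun (z : Fin d → ℤ) (x : Fin d → ℝ) => e (fun i => x i + z i) * G (fun i => x i + z i))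
      (fun z => ?_) ?_
    · rw [h2]
      refine integral_congr_ae (.of_forall fun x => ?_)
      simp only
      rw [mFourier_neg_apply, smul_eq_mul]
      change _ = e x * F (π x)
      rw [hFπ, hP]
      simp only [heper]
      rw [tsum_mul_left]
    · refine Measure.integrableOn_of_bounded (M := B z) hQv (hcz z).aestronglyMeasurable ?_
      filter_upwards [ae_restrict_mem hQm] with x hx using hQb z x hx
    · refine Summable.of_nonneg_of_le (fun z => integral_nonneg fun x => norm_nonneg _)
        (fun z => ?_) (hB.mul_right (volume.real Q))
      have h3 := norm_setIntegral_le_of_norm_le_const (μ := volume) (s := Q) (C := B z)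
        (f := fun x : Fin d → ℝ => ‖e (fun i => x i + z i) * G (fun i => x i + z i)‖)
        (lt_top_iff_ne_top.mpr hQv) (fun x hx => by rw [norm_norm]; exact hQb z x hx)
      exact (Real.le_norm_self _).trans h3
  have hsm : Summable (UnitAddTorus.mFourierCoeff F) := by
    refine summable_of_ne_finset_zero (s := {0}) fun n hn => ?_
    rw [hcoef, hF n (by simpa using hn)]
  have h := UnitAddTorus.hasSum_mFourier_series_apply_of_summable (f := ⟨F, hFc⟩) hsm (π 0)
  have h0 : ∀ n ≠ (0 : Fin d → ℤ),
      UnitAddTorus.mFourierCoeff F n • UnitAddTorus.mFourier n (π 0) = 0 := fun n hn => by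
    rw [hcoef, hF n hn, zero_smul]
  have h1 := h.unique (hasSum_single 0 h0)
  rw [hcoef] at h1
  change F (π 0) = _ at h1
  rw [hFπ] at h1
  simpa [hP, UnitAddTorus.mFourier_zero] using h1

theorem tsum_lattice_lt_top {d : ℕ} (hd : 1 ≤ d) (A : Matrix (Fin d) (Fin d) ℝ) {δ : ℝ}
    (hδ : 0 < δ) (hA : ∀ z : Fin d → ℤ, z ≠ 0 → δ ≤ ∏ i, |A.mulVec (fun j => (z j : ℝ)) i|)
    {b : Fin d → ℝ} (hb : ∀ i, 0 < b i) : ∃ C : ℝ, ∀ y : Fin d → ℝ,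
      ∑' z : Fin d → ℤ, ENNReal.ofReal
        (∏ i, ((1 + b i * |A.mulVec (fun j => (z j : ℝ)) i - y i|) ^ 2)⁻¹) ≤ ENNReal.ofReal C := by
  have hp : 0 < δ * ∏ i, b i := mul_pos hδ (Finset.prod_pos fun i _ => hb i)
  set h := min 1 (δ * (∏ i, b i) / 2)
  have h0 : 0 < h := lt_min one_pos (by positivity)
  have h1 : h ≤ 1 := min_le_left _ _
  refine ⟨(5 / h) ^ d, fun y => tsum_lattice_le A hA hb h0 h1 ?_ y⟩
  calc h ^ d ≤ h := pow_le_of_le_one h0.le h1 (by omega)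
    _ ≤ δ * (∏ i, b i) / 2 := min_le_right _ _
    _ < _ := by linarith

theorem summable_lattice {d : ℕ} (hd : 1 ≤ d) (A : Matrix (Fin d) (Fin d) ℝ) {δ : ℝ}
    (hδ : 0 < δ) (hA : ∀ z : Fin d → ℤ, z ≠ 0 → δ ≤ ∏ i, |A.mulVec (fun j => (z j : ℝ)) i|) :
    Summable fun z : Fin d → ℤ => ∏ i, ((1 + |A.mulVec (fun j => (z j : ℝ)) i|) ^ 2)⁻¹ := by
  obtain ⟨C, hC⟩ := tsum_lattice_lt_top hd A hδ hA (b := fun _ => 1) fun _ => one_pos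
  have h := hC 0
  simp only [one_mul, Pi.zero_apply, sub_zero] at h
  refine (ENNReal.summable_toReal (ne_top_of_le_ne_top ENNReal.ofReal_ne_top h)).congr fun z => ?_
  rw [ENNReal.toReal_ofReal]
  positivity

theorem integral_comp_mulVec {d : ℕ} {A : Matrix (Fin d) (Fin d) ℝ} (hdet : A.det ≠ 0)
    {H : (Fin d → ℝ) → ℂ} (hH : Continuous H) :
    ∫ x, H (A.mulVec x) = |A.det|⁻¹ * ∫ x, H x := by
  have hc : Continuous (Matrix.toLin' A) := LinearMap.continuous_of_finiteDimensional _
  have h := integral_map (μ := volume) hc.aemeasurable (f := H) hH.aestronglyMeasurable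
  rw [Real.map_matrix_volume_pi_eq_smul_volume_pi hdet, integral_smul_measure,
    ENNReal.toReal_ofReal (abs_nonneg _), abs_inv] at h
  simp only [Matrix.toLin'_apply] at h
  rw [← h, Complex.real_smul]

theorem integrable_comp_mulVec {d : ℕ} {A : Matrix (Fin d) (Fin d) ℝ} (hdet : A.det ≠ 0)
    {H : (Fin d → ℝ) → ℂ} (hH : Continuous H) (hi : Integrable H) :
    Integrable fun x => H (A.mulVec x) := by
  have hc : Continuous (Matrix.toLin' A) := LinearMap.continuous_of_finiteDimensional _
  have h := integrable_map_measure (μ := volume) (f := Matrix.toLin' A) (g := H)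
    hH.aestronglyMeasurable hc.aemeasurable
  rw [Real.map_matrix_volume_pi_eq_smul_volume_pi hdet] at h
  exact h.mp (hi.smul_measure ENNReal.ofReal_ne_top)

theorem norm_add_le_of_decay {g : ℝ → ℂ} {C M a w : ℝ} (hC0 : 0 ≤ C)
    (hC : ∀ t, ‖g t‖ ≤ C * decay 1 t) (hw : |w| ≤ M) :
    ‖g (a + w)‖ ≤ C * (1 + M) ^ 2 * ((1 + |a|) ^ 2)⁻¹ := by
  have hM : 0 ≤ M := (abs_nonneg w).trans hw
  refine (hC _).trans ?_
  rw [decay, one_mul, one_mul, mul_assoc]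
  refine mul_le_mul_of_nonneg_left ?_ hC0
  rw [← div_eq_mul_inv, inv_eq_one_div, div_le_div_iff₀ (by positivity) (by positivity), one_mul,
    ← mul_pow]
  refine pow_le_pow_left₀ (by positivity) ?_ 2
  have h5 : |a| ≤ |a + w| + |w| := by
    simpa using abs_sub (a + w) w
  nlinarith [abs_nonneg (a + w), abs_nonneg w]

theorem prod_exp_dual {d : ℕ} {A : Matrix (Fin d) (Fin d) ℝ} {k n : Fin d → ℝ}
    (hAk : A.transpose.mulVec k = n) (x : Fin d → ℝ) :
    ∏ i, Complex.exp (-(2 * Real.pi * Complex.I * n i * x i)) =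
      ∏ i, Complex.exp (-(2 * Real.pi * Complex.I * k i * A.mulVec x i)) := by
  rw [← Complex.exp_sum, ← Complex.exp_sum, Finset.sum_neg_distrib, Finset.sum_neg_distrib]
  congr 2
  have h1 : ∑ i, n i * x i = ∑ i, k i * A.mulVec x i := by
    have : n ⬝ᵥ x = k ⬝ᵥ A.mulVec x := by
      rw [← hAk, Matrix.mulVec_transpose, Matrix.dotProduct_mulVec]
    exact this
  have h2 := congrArg (fun t : ℝ => 2 * Real.pi * Complex.I * (t : ℂ)) h1
  push_cast [Finset.mul_sum] at h2
  simpa only [mul_assoc] using h2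

theorem integral_exp_mul_translate (g : 𝓢(ℝ, ℂ)) (k y : ℝ) :
    ∫ t : ℝ, Complex.exp (-(2 * Real.pi * Complex.I * k * t)) * g (t - y) =
      Complex.exp (-(2 * Real.pi * Complex.I * k * y)) * (𝓕 g : 𝓢(ℝ, ℂ)) k := by
  rw [← integral_add_right_eq_self _ y]
  have h4 : ∀ t : ℝ, Complex.exp (-(2 * Real.pi * Complex.I * k * (t + y : ℝ))) *
      g (t + y - y) = Complex.exp (-(2 * Real.pi * Complex.I * k * y)) *
        (Complex.exp ((-2 * Real.pi * inner ℝ t k : ℝ) * Complex.I) • g t) := by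
    intro t
    rw [add_sub_cancel_right, smul_eq_mul, ← mul_assoc, ← Complex.exp_add]
    congr 2
    simp only [RCLike.inner_apply, conj_trivial]
    push_cast
    ring
  simp_rw [h4]
  rw [integral_const_mul, ← Real.fourier_eq', ← fourier_coe]

/-- The Poisson summation formula on a lattice, for a product function whose Fourier transform
vanishes on the nonzero points of the dual lattice. -/
theorem tsum_lattice_eq_integral {d : ℕ} (hd : 1 ≤ d) (A : Matrix (Fin d) (Fin d) ℝ) {δ : ℝ}
    (hδ : 0 < δ) (hA : ∀ z : Fin d → ℤ, z ≠ 0 → δ ≤ ∏ i, |A.mulVec (fun j => (z j : ℝ)) i|)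
    (hdet : A.det ≠ 0) (g : Fin d → 𝓢(ℝ, ℂ)) (y : Fin d → ℝ)
    (hF : ∀ k : Fin d → ℝ, k ≠ 0 → ∀ z : Fin d → ℤ,
      A.transpose.mulVec k = (fun j => (z j : ℝ)) → ∃ i, (𝓕 (g i) : 𝓢(ℝ, ℂ)) (k i) = 0) :
    ∑' z : Fin d → ℤ, ∏ i, g i (A.mulVec (fun j => (z j : ℝ)) i - y i) =
      |A.det|⁻¹ * ∏ i, ∫ t, g i t := by
  set H : (Fin d → ℝ) → ℂ := fun v => ∏ i, g i (v i - y i) with hH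
  have hHc : Continuous H := by
    refine continuous_finsetProd _ fun i _ => (g i).continuous.comp (by fun_prop)
  have hHi : Integrable H :=
    Integrable.fintype_prod (f := fun i t => g i (t - y i)) fun i => (g i).integrable.comp_sub_right _
  have hHint : ∫ v, H v = ∏ i, ∫ t, g i t := by
    rw [hH, integral_fintype_prod_volume_eq_prod (fun i t => g i (t - y i))]
    exact Finset.prod_congr rfl fun i _ => integral_sub_right_eq_self (fun t => g i t) (y i)
  have hAc : Continuous fun x : Fin d → ℝ => A.mulVec x :=
    LinearMap.continuous_of_finiteDimensional (Matrix.toLin' A)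
  have key := tsum_int_eq_integral (G := fun x => H (A.mulVec x)) (hHc.comp hAc)
    (integrable_comp_mulVec hdet hHc hHi) ?_ ?_
  · rw [integral_comp_mulVec hdet hHc, hHint] at key
    exact key
  · intro R
    choose C hC0 hC using fun i => exists_decay_bound (g i)
    obtain ⟨M, hM⟩ := ((isCompact_univ_pi fun _ : Fin d =>
      isCompact_Icc (a := -R) (b := R)).image hAc).isBounded.exists_norm_le
    have hsl := Summable.mul_left (∏ i, C i * (1 + (|M| + ‖y‖)) ^ 2) (summable_lattice hd A hδ hA)
    refine ⟨fun z => (∏ i, C i * (1 + (|M| + ‖y‖)) ^ 2) *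
      ∏ i, ((1 + |A.mulVec (fun j => (z j : ℝ)) i|) ^ 2)⁻¹,
      hsl, fun z x hx => ?_⟩
    simp only [hH]
    rw [norm_prod, ← Finset.prod_mul_distrib]
    refine Finset.prod_le_prod (fun i _ => norm_nonneg _) fun i _ => ?_
    have h1 : (fun i => x i + (z i : ℝ)) = x + fun i => (z i : ℝ) := rfl
    have h4 : A.mulVec (fun i => x i + (z i : ℝ)) i - y i =
        A.mulVec (fun j => (z j : ℝ)) i + (A.mulVec x i - y i) := by
      rw [h1, Matrix.mulVec_add, Pi.add_apply]
      ring
    rw [h4]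
    refine norm_add_le_of_decay (hC0 i) (hC i) ?_
    have h3 : ‖A.mulVec x‖ ≤ M := hM _ ⟨x, fun j _ => abs_le.mp (hx j), rfl⟩
    calc |A.mulVec x i - y i| ≤ |A.mulVec x i| + |y i| := abs_sub _ _
      _ ≤ |M| + ‖y‖ :=
        add_le_add ((norm_le_pi_norm _ i).trans (h3.trans (le_abs_self _))) (norm_le_pi_norm y i)
  · intro n hn
    set k := (A.transpose)⁻¹.mulVec fun j => (n j : ℝ) with hk
    have hu : IsUnit A.transpose.det := by rw [Matrix.det_transpose]; exact hdet.isUnit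
    have hAk : A.transpose.mulVec k = fun j => (n j : ℝ) := by
      rw [hk, Matrix.mulVec_mulVec, Matrix.mul_nonsing_inv _ hu, Matrix.one_mulVec]
    have hk0 : k ≠ 0 := by
      rintro h0
      rw [h0, Matrix.mulVec_zero] at hAk
      exact hn (funext fun j => by simpa using (congrFun hAk j).symm)
    obtain ⟨i, hi⟩ := hF k hk0 n hAk
    have hexp := prod_exp_dual hAk
    simp only [Complex.ofReal_intCast] at hexp
    simp_rw [hexp]
    rw [integral_comp_mulVec hdet
      (H := fun v => (∏ i, Complex.exp (-(2 * Real.pi * Complex.I * k i * v i))) * H v)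
      (by fun_prop)]
    have h3 : ∫ v, (∏ i, Complex.exp (-(2 * Real.pi * Complex.I * k i * v i))) * H v = 0 := by
      simp_rw [hH, ← Finset.prod_mul_distrib]
      rw [integral_fintype_prod_volume_eq_prod
        (fun i (t : ℝ) => Complex.exp (-(2 * Real.pi * Complex.I * k i * t)) * g i (t - y i))]
      refine Finset.prod_eq_zero (Finset.mem_univ i) ?_
      rw [integral_exp_mul_translate, hi, mul_zero]
    rw [h3, mul_zero]

end

end FrolovCubature

namespace FrolovCubature

noncomputable section

/-! ### Sums of decaying functions over the Frolov lattice -/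

/-- The point of the Frolov lattice with the integer coordinates `z`. -/
def frolovPoint (d n : ℕ) (z : Fin d → ℤ) : Rd d :=
  WithLp.toLp 2 (Matrix.mulVec (frolovGenerator d n) fun i => (z i : ℝ))

theorem integrable_decay_one : Integrable (decay 1) := by
  have h := integrable_one_add_norm (E := ℝ) (μ := volume) (r := 2) (by simp)
  refine h.congr (.of_forall fun t => ?_)
  simp only [decay, one_mul, Real.norm_eq_abs]
  rw [Real.rpow_neg (by positivity)]
  norm_cast

theorem decay_eq {b : ℝ} (hb : 0 < b) (t : ℝ) : decay b t = b * decay 1 (b * t) := by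
  simp [decay, abs_mul, abs_of_pos hb]

theorem integrable_decay {b : ℝ} (hb : 0 < b) : Integrable (decay b) := by
  have h := (integrable_decay_one.comp_mul_left' hb.ne').const_mul b
  exact h.congr (.of_forall fun t => (decay_eq hb t).symm)

theorem integral_decay {b : ℝ} (hb : 0 < b) : ∫ t, decay b t = ∫ t, decay 1 t := by
  simp_rw [decay_eq hb]
  rw [integral_const_mul, Measure.integral_comp_mul_left (decay 1) b, abs_of_pos (inv_pos.mpr hb),
    smul_eq_mul, mul_inv_cancel_left₀ hb.ne']

/-- The product `∏_i 2^{m_i} (1 + 2^{m_i} |v_i|)^{-2}`. -/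
def decayProd {d : ℕ} (m : Fin d → ℕ) (v : Rd d) : ℝ := ∏ i, decay (2 ^ m i) (v i)

theorem decayProd_eq {d : ℕ} (m : Fin d → ℕ) (v : Rd d) :
    decayProd m v = 2 ^ (∑ i, m i) * ∏ i, ((1 + (2 : ℝ) ^ m i * |v i|) ^ 2)⁻¹ := by
  rw [decayProd, ← Finset.prod_pow_eq_pow_sum, ← Finset.prod_mul_distrib]
  rfl

theorem decayProd_le {d : ℕ} (m : Fin d → ℕ) (v : Rd d) : decayProd m v ≤ 2 ^ (∑ i, m i) := by
  rw [decayProd_eq]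
  refine mul_le_of_le_one_right (by positivity) (Finset.prod_le_one (fun i _ => by positivity)
    fun i _ => inv_le_one_of_one_le₀ (one_le_pow₀ ?_))
  have : (0 : ℝ) ≤ 2 ^ m i * |v i| := by positivity
  linarith

theorem continuous_decayProd {d : ℕ} (m : Fin d → ℕ) : Continuous (decayProd (d := d) m) :=
  continuous_finsetProd _ fun i _ => (continuous_decay (by positivity)).comp (by fun_prop)

/-- The integral of `decayProd m`. -/
def decayMass (d : ℕ) : ℝ≥0 := ((∫ t, decay 1 t) ^ d).toNNReal

theorem lintegral_decayProd {d : ℕ} (m : Fin d → ℕ) :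
    ∫⁻ v : Rd d, ENNReal.ofReal (decayProd m v) = decayMass d := by
  have h := lintegral_prod_coord (f := fun i => decay (2 ^ m i))
    (fun i => integrable_decay (by positivity)) fun i => decay_nonneg (by positivity)
  simp_rw [integral_decay (show (0 : ℝ) < 2 ^ m _ by positivity)] at h
  rw [Finset.prod_const, Finset.card_univ, Fintype.card_fin,
    ← ENNReal.ofReal_pow (integral_nonneg (decay_nonneg zero_le_one))] at h
  exact h

theorem exists_pow_lt {d : ℕ} (hd : 1 ≤ d) {c : ℝ} (hc : 0 < c) :
    ∃ h : ℝ, 0 < h ∧ h ≤ 1 ∧ h ^ d < c := by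
  refine ⟨min 1 (c / 2), lt_min one_pos (by positivity), min_le_left _ _, ?_⟩
  calc min 1 (c / 2) ^ d ≤ min 1 (c / 2) :=
        pow_le_of_le_one (le_min zero_le_one (by positivity)) (min_le_left _ _) (by omega)
    _ ≤ c / 2 := min_le_right _ _
    _ < c := by linarith

/-- Boxes with sides `h 2^{-m_i}` have volume `h^d 2^{-|m|_1}`, which is below the admissibility
constant `1 / (n det V)` once `h^d < 1 / (c det V)`. So `h` does not depend on `n` or `m`. -/
theorem exists_tsum_decayProd_le {d : ℕ} (hd : 1 ≤ d) {c : ℝ} (hc : 0 < c) :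
    ∃ C : ℝ≥0, ∀ (n : ℕ) (m : Fin d → ℕ), 0 < n → (n : ℝ) ≤ c * 2 ^ (∑ i, m i) → ∀ y : Rd d,
      ∑' z : Fin d → ℤ, ENNReal.ofReal (decayProd m (frolovPoint d n z - y)) ≤
        C * 2 ^ (∑ i, m i) := by
  have hD := frolovMatrix_det_pos hd
  obtain ⟨h, h0, h1, hh⟩ := exists_pow_lt hd (c := (c * (frolovMatrix d).det)⁻¹) (by positivity)
  refine ⟨((5 / h) ^ d).toNNReal, fun n m hn hm y => ?_⟩
  have hn' : (0 : ℝ) < n := by exact_mod_cast hn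
  have key := tsum_lattice_le (frolovGenerator d n)
    (fun z hz => le_prod_frolovGenerator_mulVec hd hn hz) (b := fun i => 2 ^ m i)
    (fun i => by positivity) h0 h1 (hh.trans_le ?_) y
  · simp_rw [decayProd_eq, ENNReal.ofReal_mul (show (0 : ℝ) ≤ 2 ^ (∑ i, m i) by positivity)]
    rw [ENNReal.tsum_mul_left, mul_comm]
    refine mul_le_mul' key (le_of_eq ?_)
    rw [ENNReal.ofReal_pow (by norm_num), ENNReal.ofReal_ofNat]
  · rw [Finset.prod_pow_eq_pow_sum, inv_mul_eq_div, inv_eq_one_div,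
      div_le_div_iff₀ (by positivity) (by positivity), one_mul]
    nlinarith

theorem tsum_decayProd_lt_top {d : ℕ} (hd : 1 ≤ d) {n : ℕ} (hn : 0 < n) (m : Fin d → ℕ) :
    ∃ C : ℝ≥0, ∀ y : Rd d,
      ∑' z : Fin d → ℤ, ENNReal.ofReal (decayProd m (frolovPoint d n z - y)) ≤ C := by
  have hn' : (0 : ℝ) < n := by exact_mod_cast hn
  obtain ⟨C, hC⟩ := exists_tsum_decayProd_le hd (c := n) hn'
  refine ⟨C * 2 ^ (∑ i, m i), fun y => ?_⟩
  have := hC n m hn (le_mul_of_one_le_right hn'.le (one_le_pow₀ one_le_two)) y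
  push_cast
  exact this

/-- The number of lattice points in a translate of a box is bounded by a multiple of `n`. -/
theorem exists_tsum_indicator_box_le {d : ℕ} (hd : 1 ≤ d) {R : ℝ} (hR : 0 ≤ R) :
    ∃ C : ℝ≥0, ∀ n : ℕ, 0 < n → ∀ w : Rd d,
      ∑' z : Fin d → ℤ, (box d R).indicator (fun _ => (1 : ℝ≥0∞)) (frolovPoint d n z - w) ≤
        C * n := by
  have hD := frolovMatrix_det_pos hd
  set c : ℝ := min 1 ((frolovMatrix d).det⁻¹ / 2) with hc
  have hc0 : 0 < c := lt_min one_pos (by positivity)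
  refine ⟨((1 + R) ^ (2 * d) * (5 ^ d / c)).toNNReal, fun n hn w => ?_⟩
  have hn' : (0 : ℝ) < n := by exact_mod_cast hn
  have hn1 : (1 : ℝ) ≤ n := by exact_mod_cast hn
  -- Cubes of volume `c / n` contain at most one lattice point, so the bound `(5 / h)^d` is a
  -- multiple of `n`.
  set h : ℝ := (c / n) ^ (1 / (d : ℝ)) with hh
  have hcn : 0 < c / n := by positivity
  have h0 : 0 < h := Real.rpow_pos_of_pos hcn _
  have h1 : h ≤ 1 := Real.rpow_le_one hcn.le
    ((div_le_one hn').mpr ((min_le_left _ _).trans hn1)) (by positivity)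
  have hd0 : (d : ℝ) ≠ 0 := by positivity
  have hpow : h ^ d = c / n := by
    rw [hh, ← Real.rpow_natCast, ← Real.rpow_mul hcn.le, one_div_mul_cancel hd0, Real.rpow_one]
  have key := tsum_lattice_le (frolovGenerator d n)
    (fun z hz => le_prod_frolovGenerator_mulVec hd hn hz) (b := fun _ => 1)
    (fun i => one_pos) h0 h1 ?_ w
  · have hle : ∀ z : Fin d → ℤ,
        (box d R).indicator (fun _ => (1 : ℝ≥0∞)) (frolovPoint d n z - w) ≤
        ENNReal.ofReal ((1 + R) ^ (2 * d)) * ENNReal.ofReal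
          (∏ i, ((1 + 1 * |(frolovGenerator d n).mulVec (fun j => (z j : ℝ)) i - w i|) ^ 2)⁻¹) := by
      intro z
      by_cases hz : frolovPoint d n z - w ∈ box d R
      · rw [Set.indicator_of_mem hz, ← ENNReal.ofReal_mul (by positivity), ENNReal.one_le_ofReal,
          pow_mul]
        have : ((1 + R) ^ 2) ^ d = ∏ _i : Fin d, (1 + R) ^ 2 := by simp
        rw [this, ← Finset.prod_mul_distrib]
        refine Finset.one_le_prod fun i _ => ?_
        rw [← div_eq_mul_inv, one_mul, one_le_div (by positivity)]
        have hzi : |(frolovGenerator d n).mulVec (fun j => (z j : ℝ)) i - w i| ≤ R := hz i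
        gcongr
      · rw [Set.indicator_of_notMem hz]
        exact zero_le
    refine (ENNReal.tsum_le_tsum hle).trans ?_
    rw [ENNReal.tsum_mul_left]
    refine (mul_le_mul_right key _).trans (le_of_eq ?_)
    rw [← ENNReal.ofReal_mul (by positivity), div_pow, hpow, ← ENNReal.ofReal_natCast n]
    change _ = ENNReal.ofReal _ * _
    rw [← ENNReal.ofReal_mul (by positivity)]
    congr 1
    field_simp
  · rw [hpow, Finset.prod_const_one, mul_one, mul_inv, div_lt_iff₀ hn']
    have : (n : ℝ)⁻¹ * (frolovMatrix d).det⁻¹ * n = (frolovMatrix d).det⁻¹ := by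
      field_simp
    rw [this]
    refine (min_le_right _ _).trans_lt ?_
    have : 0 < (frolovMatrix d).det⁻¹ := by positivity
    linarith

/-- The majorant of the averaging kernels of the cubature formula. -/
def sumWeight {d : ℕ} (n : ℕ) (m : Fin d → ℕ) (y : Rd d) : ℝ≥0∞ :=
  1 + (n : ℝ≥0∞)⁻¹ *
    ∑' z : Fin d → ℤ, ENNReal.ofReal (decayProd m (frolovPoint d n z - y))

theorem measurable_sumWeight {d : ℕ} (n : ℕ) (m : Fin d → ℕ) :
    Measurable (sumWeight (d := d) n m) := by
  unfold sumWeight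
  have h : ∀ z, Measurable fun y : Rd d => ENNReal.ofReal (decayProd m (frolovPoint d n z - y)) :=
    fun z => ((continuous_decayProd m).comp (by fun_prop)).measurable.ennreal_ofReal
  exact measurable_const.add (measurable_const.mul
    (Measurable.tsum (L := SummationFilter.unconditional (Fin d → ℤ)) h))

theorem exists_sumWeight_le {d : ℕ} (hd : 1 ≤ d) {c : ℝ} (hc : 0 < c) :
    ∃ C : ℝ≥0, ∀ (n : ℕ) (m : Fin d → ℕ), 0 < n → (n : ℝ) ≤ c * 2 ^ (∑ i, m i) → ∀ y : Rd d,
      sumWeight n m y ≤ C * 2 ^ (∑ i, m i) / n := by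
  obtain ⟨C, hC⟩ := exists_tsum_decayProd_le hd hc
  refine ⟨c.toNNReal + C, fun n m hn hm y => ?_⟩
  have hn0 : (n : ℝ≥0∞) ≠ 0 := by exact_mod_cast hn.ne'
  have hnt : (n : ℝ≥0∞) ≠ ∞ := ENNReal.natCast_ne_top n
  have h1 : (n : ℝ≥0∞) ≤ ENNReal.ofReal c * 2 ^ (∑ i, m i) := by
    have := ENNReal.ofReal_le_ofReal hm
    rwa [ENNReal.ofReal_natCast, ENNReal.ofReal_mul hc.le, ENNReal.ofReal_pow (by norm_num),
      ENNReal.ofReal_ofNat] at this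
  rw [sumWeight, ENNReal.coe_add, add_mul, ENNReal.add_div]
  gcongr
  · rw [ENNReal.le_div_iff_mul_le (.inl hn0) (.inl hnt), one_mul]
    exact h1
  · rw [mul_comm, ← div_eq_mul_inv]
    gcongr
    exact hC n m hn hm y

/-- After exchanging sum and integral, the number of lattice points in a translate of the box, at
most `C n`, is averaged against `decayProd m`, whose mass does not depend on `m`. No relation
between `n` and `m` is needed. -/
theorem exists_lintegral_sumWeight_le {d : ℕ} (hd : 1 ≤ d) {R : ℝ} (hR : 0 ≤ R) :
    ∃ C : ℝ≥0, ∀ (n : ℕ) (m : Fin d → ℕ), 0 < n → ∫⁻ y in box d R, sumWeight n m y ≤ C := by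
  obtain ⟨C, hC⟩ := exists_tsum_indicator_box_le hd hR
  refine ⟨(volume (box d R)).toNNReal + C * decayMass d, fun n m hn => ?_⟩
  have hn0 : (n : ℝ≥0∞) ≠ 0 := by exact_mod_cast hn.ne'
  have hnt : (n : ℝ≥0∞) ≠ ∞ := ENNReal.natCast_ne_top n
  have hms : MeasurableSet (box d R) := (isCompact_box d R).isClosed.measurableSet
  have hmd : ∀ z, Measurable fun y : Rd d => ENNReal.ofReal (decayProd m (frolovPoint d n z - y)) :=
    fun z => ((continuous_decayProd m).comp (by fun_prop)).measurable.ennreal_ofReal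
  have hmi : Measurable ((box d R).indicator fun _ => (1 : ℝ≥0∞)) := measurable_const.indicator hms
  simp only [sumWeight]
  rw [lintegral_add_left measurable_const, lintegral_one, Measure.restrict_apply_univ,
    lintegral_const_mul _ (Measurable.tsum (L := SummationFilter.unconditional (Fin d → ℤ)) hmd), ENNReal.coe_add,
    ENNReal.coe_toNNReal (isCompact_box d R).measure_lt_top.ne, ENNReal.coe_mul]
  refine add_le_add le_rfl ?_
  rw [lintegral_tsum fun z => (hmd z).aemeasurable]
  have h1 : ∀ z, ∫⁻ y in box d R, ENNReal.ofReal (decayProd m (frolovPoint d n z - y)) =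
      ∫⁻ w, (box d R).indicator (fun _ => (1 : ℝ≥0∞)) (frolovPoint d n z - w) *
        ENNReal.ofReal (decayProd m w) := by
    intro z
    rw [← lintegral_indicator hms, ← lintegral_sub_left_eq_self _ (frolovPoint d n z)]
    refine lintegral_congr fun w => ?_
    simp only [Set.indicator, sub_sub_cancel]
    split_ifs <;> simp
  simp_rw [h1]
  rw [← lintegral_tsum (f := fun z w => (box d R).indicator (fun _ => (1 : ℝ≥0∞))
    (frolovPoint d n z - w) * ENNReal.ofReal (decayProd m w)) fun z => ((hmi.comp (by fun_prop)).mul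
    (continuous_decayProd m).measurable.ennreal_ofReal).aemeasurable]
  simp_rw [ENNReal.tsum_mul_right]
  calc _ ≤ (n : ℝ≥0∞)⁻¹ * ∫⁻ w : Rd d, C * n * ENNReal.ofReal (decayProd m w) := by
        gcongr with w
        exact hC n hn w
    _ = _ := by
        rw [lintegral_const_mul _ (continuous_decayProd m).measurable.ennreal_ofReal,
          lintegral_decayProd, mul_comm (C : ℝ≥0∞), mul_assoc, ← mul_assoc,
          ENNReal.inv_mul_cancel hn0 hnt, one_mul]

end

end FrolovCubature

namespace FrolovCubature

noncomputable section

/-! ### The error of the cubature formula -/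

theorem frolovPoint_injective {d n : ℕ} (hd : 1 ≤ d) (hn : 0 < n) :
    Function.Injective (frolovPoint d n) := by
  intro z w h
  have hu : IsUnit (frolovGenerator d n) := by
    rw [Matrix.isUnit_iff_isUnit_det, frolovGenerator_det hd hn]
    exact (inv_ne_zero (by exact_mod_cast hn.ne')).isUnit
  have h1 := (Matrix.mulVec_injective_iff_isUnit.mpr hu)
    (show (frolovGenerator d n).mulVec (fun i => (z i : ℝ)) =
      (frolovGenerator d n).mulVec (fun i => (w i : ℝ)) from (WithLp.toLp_injective 2 h))
  exact funext fun i => by exact_mod_cast congrFun h1 i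

theorem finite_frolovPoint_mem_box {d n : ℕ} (hd : 1 ≤ d) (hn : 0 < n) {R : ℝ} (hR : 0 ≤ R) :
    {z : Fin d → ℤ | frolovPoint d n z ∈ box d R}.Finite := by
  obtain ⟨C, hC⟩ := exists_tsum_indicator_box_le hd hR
  have h := hC n hn 0
  have h1 : ∑' z : Fin d → ℤ, {z | frolovPoint d n z ∈ box d R}.indicator (fun _ => (1 : ℝ≥0∞)) z
      ≠ ∞ := by
    refine ne_top_of_le_ne_top (by finiteness) ((le_of_eq (tsum_congr fun z => ?_)).trans h)
    rw [sub_zero]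
    rfl
  have h2 := ENNReal.finite_const_le_of_tsum_ne_top h1 one_ne_zero
  refine h2.subset fun z hz => ?_
  rw [Set.mem_ofPred_eq, Set.indicator_of_mem hz]

theorem frolovRule_eq_tsum {d n : ℕ} (hd : 1 ≤ d) (hn : 0 < n) {f : Rd d → ℂ}
    (hf : ∀ x, x ∉ halfOpenCube d → f x = 0) :
    frolovRule d n f = (n : ℂ)⁻¹ * ∑' z, f (frolovPoint d n z) := by
  rw [frolovRule]
  congr 1
  have h1 : ∑ᶠ x ∈ frolovLattice d n ∩ halfOpenCube d, f x = ∑ᶠ x ∈ frolovLattice d n, f x := by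
    refine finsum_mem_inter_support_eq _ _ _ ?_
    ext x
    simp only [Set.mem_inter_iff, Function.mem_support]
    refine ⟨fun h => ⟨h.1.1, h.2⟩, fun h => ⟨⟨h.1, ?_⟩, h.2⟩⟩
    by_contra hcon
    exact h.2 (hf x hcon)
  rw [h1]
  have h2 := finsum_mem_range (f := f) (frolovPoint_injective (n := n) hd hn)
  change ∑ᶠ x ∈ Set.range (frolovPoint d n), f x = _
  rw [h2, tsum_eq_finsum]
  refine (finite_frolovPoint_mem_box hd hn zero_le_one).subset fun z hz => ?_
  by_contra hcon
  refine hz (hf _ fun h => hcon fun i => ?_)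
  have := h i
  rw [abs_of_nonneg this.1]
  exact this.2.le

namespace DualKernel

variable {L : ℕ} {K : LocalMeansKernel L} (D : DualKernel K)

theorem exists_tens_bound (d : ℕ) : ∃ C : ℝ≥0, ∀ (m : Fin d → ℕ) (x : Rd d),
    ‖D.tens m x‖ₑ ≤ C * ENNReal.ofReal (decayProd m x) := by
  obtain ⟨C, hC0, hC⟩ := D.exists_dil_bound
  refine ⟨(C ^ d).toNNReal, fun m x => ?_⟩
  have h1 : ‖D.tens m x‖ ≤ C ^ d * decayProd m x := by
    have : C ^ d = ∏ _i : Fin d, C := by simp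
    rw [D.tens_apply, norm_prod, decayProd, this, ← Finset.prod_mul_distrib]
    exact Finset.prod_le_prod (fun i _ => norm_nonneg _) fun i _ => hC _ _
  rw [← ofReal_norm]
  refine (ENNReal.ofReal_le_ofReal h1).trans (le_of_eq ?_)
  rw [ENNReal.ofReal_mul (by positivity)]
  rfl

theorem exists_enorm_part_le (d : ℕ) : ∃ C : ℝ≥0, ∀ (u : 𝓢'(Rd d, ℂ)) (m : Fin d → ℕ) (x : Rd d),
    ‖D.part u m x‖ₑ ≤ C * ∫⁻ y, ‖K.conv u m y‖ₑ * ENNReal.ofReal (decayProd m (x - y)) := by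
  obtain ⟨C, hC⟩ := D.exists_tens_bound d
  refine ⟨C, fun u m x => ?_⟩
  have hm : Measurable fun y => ‖K.conv u m y‖ₑ * ENNReal.ofReal (decayProd m (x - y)) :=
    (K.continuous_conv u m).enorm.measurable.mul
      ((continuous_decayProd m).comp (by fun_prop)).measurable.ennreal_ofReal
  rw [← lintegral_const_mul _ hm]
  refine (enorm_integral_le_lintegral_enorm _).trans (lintegral_mono fun y => ?_)
  rw [enorm_mul, mul_comm, mul_left_comm]
  gcongr
  exact hC m _

/-- The part of scale `m`, measured in the integral norm and in the mean over the lattice, is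
controlled by the corresponding local mean. -/
theorem exists_part_bound (d : ℕ) : ∃ C : ℝ≥0, ∀ (n : ℕ) (u : 𝓢'(Rd d, ℂ)) (m : Fin d → ℕ),
    (∫⁻ x, ‖D.part u m x‖ₑ) + (n : ℝ≥0∞)⁻¹ * ∑' z, ‖D.part u m (frolovPoint d n z)‖ₑ ≤
      C * ∫⁻ y, ‖K.conv u m y‖ₑ * sumWeight n m y := by
  obtain ⟨C, hC⟩ := D.exists_enorm_part_le d
  refine ⟨C * (decayMass d + 1), fun n u m => ?_⟩
  have hg : Measurable fun y => ‖K.conv u m y‖ₑ := (K.continuous_conv u m).enorm.measurable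
  have hw : ∀ x, Measurable fun y => ENNReal.ofReal (decayProd m (x - y)) := fun x =>
    ((continuous_decayProd m).comp (by fun_prop)).measurable.ennreal_ofReal
  have h1 : ∫⁻ x, ‖D.part u m x‖ₑ ≤ C * (decayMass d * ∫⁻ y, ‖K.conv u m y‖ₑ * sumWeight n m y) := by
    have hswap := lintegral_lintegral_swap (μ := (volume : Measure (Rd d)))
      (ν := (volume : Measure (Rd d)))
      (f := fun x y => ‖K.conv u m y‖ₑ * ENNReal.ofReal (decayProd m (x - y)))
      ((((K.continuous_conv u m).comp continuous_snd).enorm.measurable.mul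
        ((continuous_decayProd m).comp
          (continuous_fst.sub continuous_snd)).measurable.ennreal_ofReal).aemeasurable)
    calc ∫⁻ x, ‖D.part u m x‖ₑ
        ≤ ∫⁻ x, C * ∫⁻ y, ‖K.conv u m y‖ₑ * ENNReal.ofReal (decayProd m (x - y)) :=
          lintegral_mono fun x => hC u m x
      _ = C * ∫⁻ y, ∫⁻ x, ‖K.conv u m y‖ₑ * ENNReal.ofReal (decayProd m (x - y)) := by
          rw [lintegral_const_mul' _ _ ENNReal.coe_ne_top, hswap]
      _ = C * (decayMass d * ∫⁻ y, ‖K.conv u m y‖ₑ) := by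
          congr 1
          rw [← lintegral_const_mul _ hg]
          refine lintegral_congr fun y => ?_
          rw [lintegral_const_mul' _ _ enorm_ne_top, mul_comm]
          congr 1
          rw [lintegral_sub_right_eq_self (fun x => ENNReal.ofReal (decayProd m x)),
            lintegral_decayProd]
      _ ≤ _ := by
          gcongr with y
          exact le_mul_of_one_le_right zero_le (by rw [sumWeight]; exact le_self_add)
  have h2 : (n : ℝ≥0∞)⁻¹ * ∑' z, ‖D.part u m (frolovPoint d n z)‖ₑ ≤
      C * ∫⁻ y, ‖K.conv u m y‖ₑ * sumWeight n m y := by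
    calc _ ≤ (n : ℝ≥0∞)⁻¹ * ∑' z, C * ∫⁻ y, ‖K.conv u m y‖ₑ *
          ENNReal.ofReal (decayProd m (frolovPoint d n z - y)) := by
          gcongr
          exact hC u m _
      _ = C * ((n : ℝ≥0∞)⁻¹ * ∫⁻ y, ‖K.conv u m y‖ₑ *
          ∑' z, ENNReal.ofReal (decayProd m (frolovPoint d n z - y))) := by
          rw [ENNReal.tsum_mul_left, mul_left_comm]
          congr 2
          rw [← lintegral_tsum (f := fun z y => ‖K.conv u m y‖ₑ *
            ENNReal.ofReal (decayProd m (frolovPoint d n z - y)))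
            fun z => (hg.mul (hw _)).aemeasurable]
          simp_rw [ENNReal.tsum_mul_left]
      _ ≤ C * ∫⁻ y, (n : ℝ≥0∞)⁻¹ * (‖K.conv u m y‖ₑ *
          ∑' z, ENNReal.ofReal (decayProd m (frolovPoint d n z - y))) := by
          gcongr
          exact lintegral_const_mul_le _ _
      _ ≤ _ := by
          refine mul_le_mul_right (lintegral_mono fun y => ?_) _
          rw [mul_left_comm]
          refine mul_le_mul_right ?_ _
          rw [sumWeight]
          exact le_add_self
  refine (add_le_add h1 h2).trans (le_of_eq ?_)
  push_cast
  ring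

theorem lintegral_conv_mul_sumWeight_lt_top {d : ℕ} (hd : 1 ≤ d) {n : ℕ} (hn : 0 < n)
    (u : 𝓢'(Rd d, ℂ)) (hu : Distribution.dsupport u ⊆ unitCube d) (m : Fin d → ℕ) :
    ∫⁻ y, ‖K.conv u m y‖ₑ * sumWeight n m y < ∞ := by
  obtain ⟨C, hC⟩ := tsum_decayProd_lt_top hd hn m
  have hn0 : (n : ℝ≥0∞) ≠ 0 := by exact_mod_cast hn.ne'
  calc _ ≤ ∫⁻ y, ‖K.conv u m y‖ₑ * (1 + (n : ℝ≥0∞)⁻¹ * C) := by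
        gcongr with y
        rw [sumWeight]
        gcongr
        exact hC y
    _ = (∫⁻ y, ‖K.conv u m y‖ₑ) * (1 + (n : ℝ≥0∞)⁻¹ * C) :=
        lintegral_mul_const _ (K.continuous_conv u m).enorm.measurable
    _ < ∞ := by
        have := (K.integrable_conv u hu m).2
        rw [HasFiniteIntegral] at this
        finiteness

theorem integral_part {d : ℕ} (u : 𝓢'(Rd d, ℂ)) (hu : Distribution.dsupport u ⊆ unitCube d)
    (m : Fin d → ℕ) :
    ∫ x, D.part u m x = (∏ i, ∫ t, D.dil (m i) t) * ∫ y, K.conv u m y := by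
  have h := integral_convolution (μ := (volume : Measure (Rd d))) (ν := volume)
    (ContinuousLinearMap.mul ℂ ℂ) (K.integrable_conv u hu m) (D.tens (d := d) m).integrable
  have h1 : ∫ x : Rd d, D.tens m x = ∏ i, ∫ t, D.dil (m i) t := by
    simp_rw [D.tens_apply]
    exact integral_prod_coord _
  rw [h1, ContinuousLinearMap.mul_apply', mul_comm] at h
  rw [← h]
  refine integral_congr_ae (.of_forall fun x => integral_congr_ae (.of_forall fun y => ?_))
  exact mul_comm _ _

/-- The cubature formula integrates the parts of low scale exactly. -/
theorem integral_part_eq_tsum {d : ℕ} (hd : 1 ≤ d) {n : ℕ} (hn : 0 < n)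
    (u : 𝓢'(Rd d, ℂ)) (hu : Distribution.dsupport u ⊆ unitCube d) {m : Fin d → ℕ}
    (hm : (frolovMatrix d).det * D.eps ^ d * 2 ^ (∑ i, m i) < n) :
    ∫ x, D.part u m x = (n : ℂ)⁻¹ * ∑' z, D.part u m (frolovPoint d n z) := by
  have hn' : (0 : ℝ) < n := by exact_mod_cast hn
  have hD := frolovMatrix_det_pos hd
  have hnC : (n : ℂ) ≠ 0 := by exact_mod_cast hn.ne'
  have hpois : ∀ y : Rd d, ∑' z, D.tens m (frolovPoint d n z - y) =
      n * ∏ i, ∫ t, D.dil (m i) t := by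
    intro y
    have h := tsum_lattice_eq_integral hd (frolovGenerator d n)
      (δ := ((n : ℝ) * (frolovMatrix d).det)⁻¹) (by positivity)
      (fun z hz => le_prod_frolovGenerator_mulVec hd hn hz)
      (by rw [frolovGenerator_det hd hn]; positivity) (fun i => D.dil (m i)) y ?_
    · rw [frolovGenerator_det hd hn, abs_of_pos (by positivity), inv_inv] at h
      simp_rw [D.tens_apply]
      exact_mod_cast h
    · intro k hk z hz
      have h1 := le_prod_of_frolovGenerator_transpose_mulVec hd hn hk hz
      -- If no factor vanished at `k`, then `|k i| ≤ eps * 2 ^ m i` for all `i`, so the coordinate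
      -- product would fall below the bound `n / det V` for nonzero dual points.
      by_contra! hcon
      have h2 : ∀ i, |k i| ≤ D.eps * 2 ^ m i := fun i => by
        by_contra! h3
        exact hcon i (D.fourier_dil_eq_zero _ h3.le)
      have h4 : ∏ i, |k i| ≤ ∏ i, D.eps * 2 ^ m i :=
        Finset.prod_le_prod (fun i _ => abs_nonneg _) fun i _ => h2 i
      rw [Finset.prod_mul_distrib, Finset.prod_pow_eq_pow_sum, Finset.prod_const, Finset.card_univ,
        Fintype.card_fin] at h4
      have h5 := h1.trans h4
      rw [div_le_iff₀ hD] at h5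
      linarith
  have hfin := lintegral_conv_mul_sumWeight_lt_top (K := K) hd hn u hu m
  obtain ⟨C, hC⟩ := D.exists_tens_bound d
  have hmeas : ∀ z, AEStronglyMeasurable
      (fun y => D.tens m (frolovPoint d n z - y) * K.conv u m y) volume := fun z =>
    (((D.tens m).continuous.comp (by fun_prop)).mul (K.continuous_conv u m)).aestronglyMeasurable
  have hsw := integral_tsum (μ := (volume : Measure (Rd d))) hmeas ?_
  · have e1 : ∑' z, D.part u m (frolovPoint d n z) =
        ∫ y, ∑' z, D.tens m (frolovPoint d n z - y) * K.conv u m y := hsw.symm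
    rw [e1]
    simp_rw [tsum_mul_right, hpois]
    rw [integral_const_mul, D.integral_part u hu]
    field_simp
  · have hmz : ∀ z, Measurable fun y => ‖D.tens m (frolovPoint d n z - y) * K.conv u m y‖ₑ :=
      fun z => (((D.tens m).continuous.comp (by fun_prop)).mul
        (K.continuous_conv u m)).enorm.measurable
    rw [← lintegral_tsum fun z => (hmz z).aemeasurable]
    have hn0 : (n : ℝ≥0∞) ≠ 0 := by exact_mod_cast hn.ne'
    refine ne_top_of_le_ne_top (b := n * C * ∫⁻ y, ‖K.conv u m y‖ₑ * sumWeight n m y)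
      (ENNReal.mul_ne_top (by finiteness) hfin.ne) ?_
    rw [← lintegral_const_mul' _ _ (by finiteness)]
    refine lintegral_mono fun y => ?_
    calc ∑' z, ‖D.tens m (frolovPoint d n z - y) * K.conv u m y‖ₑ
        ≤ ∑' z, C * ‖K.conv u m y‖ₑ * ENNReal.ofReal (decayProd m (frolovPoint d n z - y)) := by
          refine ENNReal.tsum_le_tsum fun z => ?_
          rw [enorm_mul, mul_right_comm]
          gcongr
          exact hC m _
      _ = C * ‖K.conv u m y‖ₑ * (n * ((n : ℝ≥0∞)⁻¹ *
          ∑' z, ENNReal.ofReal (decayProd m (frolovPoint d n z - y)))) := by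
          rw [ENNReal.tsum_mul_left, ← mul_assoc (n : ℝ≥0∞),
            ENNReal.mul_inv_cancel hn0 (ENNReal.natCast_ne_top n), one_mul]
      _ ≤ C * ‖K.conv u m y‖ₑ * (n * sumWeight n m y) := by
          gcongr
          exact le_add_self
      _ = _ := by ring

theorem finite_low_scales (d : ℕ) (a : ℝ) {c : ℝ} (hc : 0 < c) :
    {m : Fin d → ℕ | c * 2 ^ (∑ i, m i) < a}.Finite := by
  obtain ⟨N, hN⟩ := pow_unbounded_of_one_lt (a / c) (one_lt_two (α := ℝ))
  refine (Set.Finite.pi' fun _ : Fin d => Set.finite_Iio N).subset fun m hm i => ?_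
  by_contra! hcon
  simp only [Set.mem_Iio, not_lt] at hcon
  have h1 : N ≤ ∑ i, m i :=
    hcon.trans (Finset.single_le_sum (f := m) (fun _ _ => Nat.zero_le _) (Finset.mem_univ i))
  have h2 : (2 : ℝ) ^ N ≤ 2 ^ (∑ i, m i) := pow_le_pow_right₀ one_le_two h1
  rw [div_lt_iff₀ hc] at hN
  rw [Set.mem_ofPred_eq] at hm
  nlinarith

/-- The error is the sum of the errors of the parts. Exactness removes the low scales; at the high
scales the integral and the lattice mean are each bounded in absolute value. Only finitely many low
scales occur, each with finite bound, so finiteness of the right side justifies all interchanges. -/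
theorem exists_cubatureError_le {d : ℕ} (hd : 1 ≤ d) : ∃ (C : ℝ≥0) (c : ℝ), 0 < c ∧
    ∀ n : ℕ, 0 < n → ∀ u : 𝓢'(Rd d, ℂ), Distribution.dsupport u ⊆ unitCube d →
      ∀ M : (Fin d → ℕ) → ℝ, Summable M → (∀ m x, ‖D.part u m x‖ ≤ M m) →
      cubatureError n u ≤ C * ∑' m : Fin d → ℕ,
        {m | (n : ℝ) ≤ c * 2 ^ (∑ i, m i)}.indicator
          (fun m => ∫⁻ y, ‖K.conv u m y‖ₑ * sumWeight n m y) m := by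
  obtain ⟨C, hC⟩ := D.exists_part_bound d
  have hD := frolovMatrix_det_pos hd
  have he := D.eps_pos
  -- A positive constant is needed so that the right side is infinite when the sum is.
  refine ⟨C + 1, (frolovMatrix d).det * D.eps ^ d, by positivity, fun n hn u hu M hM hb => ?_⟩
  set c := (frolovMatrix d).det * D.eps ^ d with hc
  have hc0 : 0 < c := by positivity
  set a : (Fin d → ℕ) → ℝ≥0∞ := fun m => ∫⁻ y, ‖K.conv u m y‖ₑ * sumWeight n m y with ha
  set S : Set (Fin d → ℕ) := {m | (n : ℝ) ≤ c * 2 ^ (∑ i, m i)} with hS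
  have hn0 : (n : ℝ≥0∞) ≠ 0 := by exact_mod_cast hn.ne'
  by_cases htop : ∑' m, S.indicator a m = ∞
  · rw [htop, ENNReal.mul_top (by positivity)]
    exact le_top
  have hafin : ∀ m, a m ≠ ∞ := fun m => (lintegral_conv_mul_sumWeight_lt_top hd hn u hu m).ne
  have hasum : ∑' m, a m ≠ ∞ := by
    have h1 : ∀ m, a m = S.indicator a m + Sᶜ.indicator a m := fun m =>
      (congrFun (Set.indicator_self_add_compl S a) m).symm
    simp_rw [h1]
    rw [ENNReal.tsum_add]
    refine ENNReal.add_ne_top.mpr ⟨htop, ?_⟩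
    have hfin : Sᶜ.Finite := (finite_low_scales d n hc0).subset fun m hm => by
      simpa [hS] using hm
    rw [tsum_eq_sum (s := hfin.toFinset) fun m hm => Set.indicator_of_notMem (by simpa using hm) _]
    refine (ENNReal.sum_lt_top.mpr fun m _ => ?_).ne
    exact (Set.indicator_le_self _ _ m).trans_lt (lt_top_iff_ne_top.mpr (hafin m))
  have hE := hC n u
  have hsum1 : ∑' m, ∫⁻ x, ‖D.part u m x‖ₑ ≠ ∞ := by
    refine ne_top_of_le_ne_top (ENNReal.mul_ne_top ENNReal.coe_ne_top hasum)
      ((ENNReal.tsum_le_tsum fun m => le_self_add.trans (hE m)).trans_eq ENNReal.tsum_mul_left)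
  have hsum2 : ∑' m, (n : ℝ≥0∞)⁻¹ * ∑' z, ‖D.part u m (frolovPoint d n z)‖ₑ ≠ ∞ := by
    refine ne_top_of_le_ne_top (ENNReal.mul_ne_top ENNReal.coe_ne_top hasum)
      ((ENNReal.tsum_le_tsum fun m => le_add_self.trans (hE m)).trans_eq ENNReal.tsum_mul_left)
  obtain ⟨f, hf, hfx⟩ := D.exists_represents u hu hM hb
  have hf0 : ∀ x, x ∉ halfOpenCube d → f x = 0 := by
    intro x hx
    simp only [halfOpenCube, Set.mem_ofPred_eq, not_forall, Set.mem_Ico, not_and_or, not_le,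
      not_lt] at hx
    obtain ⟨i, hi⟩ := hx
    exact hf.eq_zero_of_notMem hu ⟨i, hi.imp_left le_of_lt⟩
  have hcube : ∫ x in unitCube d, f x = ∫ x, f x := by
    refine setIntegral_eq_integral_of_forall_compl_eq_zero fun x hx => hf0 x fun h => hx fun i => ?_
    exact ⟨(h i).1, (h i).2.le⟩
  have hint : ∫ x, f x = ∑' m, ∫ x, D.part u m x := by
    rw [← integral_tsum (fun m => (D.continuous_part u hu m).aestronglyMeasurable) hsum1]
    exact integral_congr_ae (.of_forall fun x => (hfx x).tsum_eq.symm)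
  have hq : frolovRule d n f =
      ∑' m, (n : ℂ)⁻¹ * ∑' z, D.part u m (frolovPoint d n z) := by
    rw [frolovRule_eq_tsum hd hn hf0, tsum_mul_left]
    congr 1
    simp_rw [← (hfx _).tsum_eq]
    refine Summable.tsum_comm (f := fun m z => D.part u m (frolovPoint d n z)) ?_
    refine Summable.of_enorm ?_
    rw [ENNReal.tsum_prod']
    rw [ENNReal.tsum_mul_left] at hsum2
    intro h
    simp only [Function.uncurry_apply_pair] at h
    rw [h, ENNReal.mul_top (by simp)] at hsum2
    exact hsum2 rfl
  have hs1 : Summable fun m => ∫ x, D.part u m x :=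
    Summable.of_enorm (ne_top_of_le_ne_top hsum1
      (ENNReal.tsum_le_tsum fun m => enorm_integral_le_lintegral_enorm _))
  have hz : ∀ m, ‖(n : ℂ)⁻¹ * ∑' z, D.part u m (frolovPoint d n z)‖ₑ ≤
      (n : ℝ≥0∞)⁻¹ * ∑' z, ‖D.part u m (frolovPoint d n z)‖ₑ := by
    intro m
    rw [enorm_mul]
    refine mul_le_mul' (le_of_eq ?_) enorm_tsum_le_tsum_enorm
    rw [enorm_inv (by exact_mod_cast hn.ne')]
    rw [← ofReal_norm, Complex.norm_natCast, ENNReal.ofReal_natCast]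
  have hs2 : Summable fun m => (n : ℂ)⁻¹ * ∑' z, D.part u m (frolovPoint d n z) :=
    Summable.of_enorm (ne_top_of_le_ne_top hsum2 (ENNReal.tsum_le_tsum hz))
  have hdiff : (∫ x in unitCube d, f x) - frolovRule d n f =
      ∑' m, ((∫ x, D.part u m x) - (n : ℂ)⁻¹ * ∑' z, D.part u m (frolovPoint d n z)) := by
    rw [hcube, hint, hq, hs1.tsum_sub hs2]
  calc cubatureError n u ≤ ‖(∫ x in unitCube d, f x) - frolovRule d n f‖ₑ := iInf₂_le f hf
    _ ≤ ∑' m, ‖(∫ x, D.part u m x) - (n : ℂ)⁻¹ * ∑' z, D.part u m (frolovPoint d n z)‖ₑ := by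
        rw [hdiff]
        exact enorm_tsum_le_tsum_enorm
    _ ≤ ∑' m, C * S.indicator a m := by
        refine ENNReal.tsum_le_tsum fun m => ?_
        by_cases hm : m ∈ S
        · rw [Set.indicator_of_mem hm]
          refine (enorm_sub_le).trans (le_trans ?_ (hE m))
          exact add_le_add (enorm_integral_le_lintegral_enorm _) (hz m)
        · rw [D.integral_part_eq_tsum hd hn u hu (not_le.mp hm), sub_self, enorm_zero]
          exact zero_le
    _ = C * ∑' m, S.indicator a m := ENNReal.tsum_mul_left
    _ ≤ _ := by
        gcongr
        exact le_self_add

end DualKernel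

end

end FrolovCubature

namespace FrolovCubature

noncomputable section

/-! ### Weighted estimates -/

theorem inv_toReal_le_one {p : ℝ≥0∞} (hp : 1 ≤ p) : (p⁻¹).toReal ≤ 1 := by
  have h : p⁻¹ ≤ 1 := ENNReal.inv_le_one.mpr hp
  simpa using ENNReal.toReal_mono ENNReal.one_ne_top h

/-- With respect to the measure `T dμ` on `Ω`, Hölder gives the `L^1` norm as at most the `L^p` norm
times the total mass to the power `1 - 1/p`; the bound `T ≤ A` then compares this `L^p` norm with
the one for `μ`. The case `p = ∞` is included, with `1/p = 0`. -/
theorem lintegral_enorm_mul_le {α : Type*} [MeasurableSpace α] {μ : Measure α} {g : α → ℂ}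
    (hg : StronglyMeasurable g) {T : α → ℝ≥0∞} (hT : Measurable T) {Ω : Set α}
    (hΩ : MeasurableSet Ω) (hgΩ : ∀ x, x ∉ Ω → g x = 0) {A B : ℝ≥0∞} (hA0 : A ≠ 0)
    (hTA : ∀ x, T x ≤ A) (hTB : ∫⁻ x in Ω, T x ∂μ ≤ B) {p : ℝ≥0∞} (hp : 1 ≤ p) :
    ∫⁻ x, ‖g x‖ₑ * T x ∂μ ≤ A ^ (p⁻¹).toReal * B ^ (1 - (p⁻¹).toReal) * eLpNorm g p μ := by
  have h1 : ∫⁻ x, ‖g x‖ₑ * T x ∂μ = eLpNorm g 1 ((μ.restrict Ω).withDensity T) := by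
    rw [eLpNorm_one_eq_lintegral_enorm,
      lintegral_withDensity_eq_lintegral_mul _ hT hg.measurable.enorm, ← lintegral_indicator hΩ]
    refine lintegral_congr fun x => ?_
    by_cases hx : x ∈ Ω
    · rw [Set.indicator_of_mem hx, Pi.mul_apply, mul_comm]
    · rw [Set.indicator_of_notMem hx, hgΩ x hx, enorm_zero, zero_mul]
  have h2 := eLpNorm_le_eLpNorm_mul_rpow_measure_univ (f := g)
    (μ := (μ.restrict Ω).withDensity T) hp hg.aestronglyMeasurable
  have h3 : (μ.restrict Ω).withDensity T ≤ A • μ := by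
    rw [← withDensity_const]
    exact (withDensity_mono (.of_forall hTA)).trans
      (by rw [withDensity_const, withDensity_const]; gcongr; exact Measure.restrict_le_self)
  have h4 : eLpNorm g p ((μ.restrict Ω).withDensity T) ≤ A ^ (p⁻¹).toReal * eLpNorm g p μ := by
    refine (eLpNorm_mono_measure g h3).trans (le_of_eq ?_)
    rw [eLpNorm_smul_measure_of_ne_zero hA0, one_div, smul_eq_mul]
  have h5 : (μ.restrict Ω).withDensity T Set.univ ≤ B := by
    rw [withDensity_apply _ .univ, Measure.restrict_univ]
    exact hTB
  rw [h1]
  refine h2.trans ?_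
  rw [ENNReal.toReal_one, div_one, one_div, ← ENNReal.toReal_inv, mul_right_comm]
  gcongr
  linarith [inv_toReal_le_one hp]

theorem two_pow_rpow (k : ℕ) (t : ℝ) :
    ((2 : ℝ≥0∞) ^ k) ^ t = ENNReal.ofReal (((2 : ℝ) ^ t) ^ k) := by
  rw [ENNReal.ofReal_pow (by positivity), ← ENNReal.ofReal_rpow_of_pos two_pos, ENNReal.ofReal_ofNat,
    ← ENNReal.rpow_natCast, ← ENNReal.rpow_natCast, ← ENNReal.rpow_mul, ← ENNReal.rpow_mul, mul_comm]

theorem weight_eq {d : ℕ} (s : ℝ) (m : Fin d → ℕ) :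
    weight s m = ((2 : ℝ≥0∞) ^ (∑ i, m i)) ^ s := by
  rw [two_pow_rpow, weight, Real.rpow_mul two_pos.le, ← Nat.cast_sum, Real.rpow_natCast]

theorem two_pow_ne_zero (k : ℕ) : (2 : ℝ≥0∞) ^ k ≠ 0 := by positivity

theorem two_pow_ne_top (k : ℕ) : (2 : ℝ≥0∞) ^ k ≠ ∞ := by finiteness

theorem weight_mul_neg {d : ℕ} (s : ℝ) (m : Fin d → ℕ) :
    ((2 : ℝ≥0∞) ^ (∑ i, m i)) ^ (-s) * weight s m = 1 := by
  rw [weight_eq, ← ENNReal.rpow_add _ _ (two_pow_ne_zero _) (two_pow_ne_top _), neg_add_cancel,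
    ENNReal.rpow_zero]

/-- The embedding `ℓ^θ ⊂ ℓ^1`: every entry is at most the `ℓ^θ` quasi-norm `S`, so `a = a^θ a^{1-θ}
≤ a^θ S^{1-θ}`. -/
theorem tsum_le_rpow_tsum_rpow {ι : Type*} {θ : ℝ} (h0 : 0 < θ) (h1 : θ ≤ 1) (a : ι → ℝ≥0∞) :
    ∑' i, a i ≤ (∑' i, a i ^ θ) ^ (1 / θ) := by
  set S := (∑' i, a i ^ θ) ^ (1 / θ) with hS
  have hle : ∀ i, a i ≤ S := by
    intro i
    have : a i = (a i ^ θ) ^ (1 / θ) := by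
      rw [← ENNReal.rpow_mul, mul_one_div_cancel h0.ne', ENNReal.rpow_one]
    rw [this]
    exact ENNReal.rpow_le_rpow (ENNReal.le_tsum i) (by positivity)
  have hSθ : ∑' i, a i ^ θ = S ^ θ := by
    rw [hS, ← ENNReal.rpow_mul, one_div_mul_cancel h0.ne', ENNReal.rpow_one]
  calc ∑' i, a i = ∑' i, a i ^ θ * a i ^ (1 - θ) := by
        refine tsum_congr fun i => ?_
        rw [← ENNReal.rpow_add_of_nonneg _ _ h0.le (by linarith), add_sub_cancel, ENNReal.rpow_one]
    _ ≤ ∑' i, a i ^ θ * S ^ (1 - θ) := by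
        gcongr with i
        exact hle i
    _ = S := by
        rw [ENNReal.tsum_mul_right, hSθ, ← ENNReal.rpow_add_of_nonneg _ _ h0.le (by linarith),
          add_sub_cancel, ENNReal.rpow_one]

theorem summable_pow_sum (d : ℕ) {r : ℝ} (h0 : 0 ≤ r) (h1 : r < 1) :
    Summable fun m : Fin d → ℕ => r ^ (∑ i, m i) := by
  have h := tsum_pi_prod (d := d) (fun _ (j : ℕ) => ENNReal.ofReal (r ^ j))
  have hs : ∑' j : ℕ, ENNReal.ofReal (r ^ j) ≠ ∞ :=
    (summable_geometric_of_lt_one h0 h1).tsum_ofReal_ne_top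
  have h2 : ∑' m : Fin d → ℕ, ENNReal.ofReal (r ^ (∑ i, m i)) ≠ ∞ := by
    simp_rw [← Finset.prod_pow_eq_pow_sum,
      ENNReal.ofReal_prod_of_nonneg fun _ _ => pow_nonneg h0 _]
    rw [h]
    exact (ENNReal.prod_lt_top fun i _ => lt_top_iff_ne_top.mpr hs).ne
  refine (ENNReal.summable_toReal h2).congr fun m => ENNReal.toReal_ofReal (by positivity)

theorem LocalMeansKernel.weight_mul_eLpNorm_le_besovNorm {L d : ℕ} (K : LocalMeansKernel L) {s : ℝ}
    {p : ℝ≥0∞} {θ : ℝ} (hθ : 0 < θ) (u : 𝓢'(Rd d, ℂ)) (m : Fin d → ℕ) :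
    weight s m * eLpNorm (K.conv u m) p volume ≤ K.besovNorm s p θ u := by
  have h := ENNReal.rpow_le_rpow (ENNReal.le_tsum
    (f := fun m => (weight s m * eLpNorm (K.conv u m) p volume) ^ θ) m)
    (show (0 : ℝ) ≤ 1 / θ by positivity)
  rw [← ENNReal.rpow_mul, mul_one_div_cancel hθ.ne', ENNReal.rpow_one] at h
  exact h

theorem LocalMeansKernel.weight_mul_eLpNorm_le_triebelLizorkinNorm {L d : ℕ}
    (K : LocalMeansKernel L) {s : ℝ} {p : ℝ≥0∞} {θ : ℝ} (hθ : 0 < θ) (u : 𝓢'(Rd d, ℂ))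
    (m : Fin d → ℕ) :
    weight s m * eLpNorm (K.conv u m) p volume ≤ K.triebelLizorkinNorm s p θ u := by
  have h1 : weight s m * eLpNorm (K.conv u m) p volume =
      eLpNorm (((2 : ℝ) ^ (s * ∑ i, (m i : ℝ))) • K.conv u m) p volume := by
    rw [eLpNorm_const_smul, Real.enorm_of_nonneg (by positivity), weight]
  rw [h1]
  refine eLpNorm_mono_enorm fun x => ?_
  have h := ENNReal.rpow_le_rpow (ENNReal.le_tsum
    (f := fun m => (weight s m * ‖K.conv u m x‖ₑ) ^ θ) m)
    (show (0 : ℝ) ≤ 1 / θ by positivity)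
  rw [← ENNReal.rpow_mul, mul_one_div_cancel hθ.ne', ENNReal.rpow_one] at h
  rw [Pi.smul_apply, enorm_smul, Real.enorm_of_nonneg (by positivity)]
  exact h

/-- The sum over the high scales that controls the error of the cubature formula. -/
def LocalMeansKernel.highSum {L d : ℕ} (K : LocalMeansKernel L) (c : ℝ) (n : ℕ)
    (u : 𝓢'(Rd d, ℂ)) : ℝ≥0∞ :=
  ∑' m : Fin d → ℕ, {m | (n : ℝ) ≤ c * 2 ^ (∑ i, m i)}.indicator
    (fun m => ∫⁻ y, ‖K.conv u m y‖ₑ * sumWeight n m y) m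

/-- The required uniform summability is a Nikolskii-type inequality: the part of scale `m` is
bounded by a multiple of `2^{|m|_1/p} ‖Ψ_m * u‖_p`, hence by `2^{-(s - 1/p)|m|_1}`, which is where
`s > 1/p` gives continuity. -/
theorem LocalMeansKernel.exists_cubatureError_le_highSum {L d : ℕ} (K : LocalMeansKernel L)
    (hd : 1 ≤ d) {p : ℝ≥0∞} (hp : 1 ≤ p) {s : ℝ} (hs : (p⁻¹).toReal < s) :
    ∃ (C : ℝ≥0) (c : ℝ), 0 < c ∧ ∀ n : ℕ, 0 < n → ∀ u : 𝓢'(Rd d, ℂ),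
      Distribution.dsupport u ⊆ unitCube d →
      (∀ m, weight s m * eLpNorm (K.conv u m) p volume ≤ 1) →
      cubatureError n u ≤ C * K.highSum c n u := by
  obtain ⟨D⟩ := exists_dualKernel K
  obtain ⟨C, c, hc, hC⟩ := D.exists_cubatureError_le hd
  obtain ⟨C0, hC0⟩ := D.exists_enorm_part_le d
  refine ⟨C, c, hc, fun n hn u hu hN => ?_⟩
  set σ := s - (p⁻¹).toReal with hσ
  have hσ0 : 0 < σ := sub_pos.mpr hs
  set r : ℝ := 2 ^ (-σ)
  have hr1 : r < 1 := Real.rpow_lt_one_of_one_lt_of_neg one_lt_two (by linarith)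
  set C1 : ℝ≥0∞ := C0 * (decayMass d : ℝ≥0∞) ^ (1 - (p⁻¹).toReal) with hC1
  have hC1t : C1 ≠ ∞ := ENNReal.mul_ne_top ENNReal.coe_ne_top
    (ENNReal.rpow_ne_top_of_nonneg (by linarith [inv_toReal_le_one hp]) ENNReal.coe_ne_top)
  refine hC n hn u hu (fun m => C1.toReal * r ^ (∑ i, m i))
    ((summable_pow_sum d (by positivity) hr1).mul_left _) fun m x => ?_
  have h1 : ‖D.part u m x‖ₑ ≤ C1 * ENNReal.ofReal (r ^ (∑ i, m i)) := by
    set k := ∑ i, m i with hk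
    have hpos := two_pow_ne_zero k
    have hg : eLpNorm (K.conv u m) p volume ≤ ((2 : ℝ≥0∞) ^ k) ^ (-s) := by
      calc _ = ((2 : ℝ≥0∞) ^ k) ^ (-s) * (weight s m * eLpNorm (K.conv u m) p volume) := by
            rw [← mul_assoc, weight_mul_neg, one_mul]
        _ ≤ ((2 : ℝ≥0∞) ^ k) ^ (-s) * 1 := by gcongr; exact hN m
        _ = _ := mul_one _
    have h2 := lintegral_enorm_mul_le (μ := volume) (K.continuous_conv u m).stronglyMeasurable
      (T := fun y => ENNReal.ofReal (decayProd m (x - y)))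
      (((continuous_decayProd m).comp (by fun_prop)).measurable.ennreal_ofReal) (Ω := Set.univ)
      .univ (fun x hx => absurd (Set.mem_univ x) hx) (A := 2 ^ k) (B := decayMass d) hpos
      (fun y => ?_) ?_ hp
    · calc _ ≤ C0 * (((2 : ℝ≥0∞) ^ k) ^ (p⁻¹).toReal * (decayMass d : ℝ≥0∞) ^ (1 - (p⁻¹).toReal) *
            ((2 : ℝ≥0∞) ^ k) ^ (-s)) := by
            refine (hC0 u m x).trans (mul_le_mul_right (h2.trans ?_) _)
            gcongr
        _ = C1 * (((2 : ℝ≥0∞) ^ k) ^ (p⁻¹).toReal * ((2 : ℝ≥0∞) ^ k) ^ (-s)) := by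
            rw [hC1]; ring
        _ = _ := by
            rw [← ENNReal.rpow_add _ _ hpos (two_pow_ne_top _), ← two_pow_rpow, hσ]
            congr 2
            ring
    · refine (ENNReal.ofReal_le_ofReal (decayProd_le m _)).trans (le_of_eq ?_)
      rw [ENNReal.ofReal_pow two_pos.le, ENNReal.ofReal_ofNat]
    · rw [Measure.restrict_univ, lintegral_sub_left_eq_self (fun y => ENNReal.ofReal (decayProd m y)),
        lintegral_decayProd]
  rw [← ENNReal.ofReal_toReal hC1t, ← ENNReal.ofReal_mul ENNReal.toReal_nonneg, ← ofReal_norm] at h1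
  exact (ENNReal.ofReal_le_ofReal_iff (by positivity)).mp h1

theorem rpow_le_mul_rpow {X c : ℝ≥0∞} {a s : ℝ} (h0 : X ≠ 0) (ht : X ≠ ∞) (hX : 1 ≤ c * X)
    (has : a ≤ s) : X ^ a ≤ c ^ (s - a) * X ^ s := by
  have hsa : 0 ≤ s - a := sub_nonneg.mpr has
  calc X ^ a = X ^ a * 1 := (mul_one _).symm
    _ ≤ X ^ a * (c * X) ^ (s - a) := by
        gcongr
        simpa using ENNReal.rpow_le_rpow hX hsa
    _ = c ^ (s - a) * X ^ s := by
        rw [ENNReal.mul_rpow_of_nonneg _ _ hsa, mul_left_comm, ← ENNReal.rpow_add _ _ h0 ht,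
          add_sub_cancel]

/-- On the high scales `2^{|m|_1}/n` is at least `1/c`, so its exponent may be raised from `a` to
`s` at the cost of a constant. -/
theorem high_rpow_le {d : ℕ} {c : ℝ} (hc : 0 < c) {n : ℕ} (hn : 0 < n) {m : Fin d → ℕ}
    (hm : (n : ℝ) ≤ c * 2 ^ (∑ i, m i)) {a s : ℝ} (has : a ≤ s) (hs : 0 ≤ s) :
    ((2 : ℝ≥0∞) ^ (∑ i, m i) / n) ^ a ≤
      ENNReal.ofReal c ^ (s - a) * ((n : ℝ≥0∞) ^ (-s) * weight s m) := by
  have hn0 : (n : ℝ≥0∞) ≠ 0 := by exact_mod_cast hn.ne'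
  have hnt : (n : ℝ≥0∞) ≠ ∞ := ENNReal.natCast_ne_top n
  have h1 : (n : ℝ≥0∞) ≤ ENNReal.ofReal c * 2 ^ (∑ i, m i) := by
    have := ENNReal.ofReal_le_ofReal hm
    rwa [ENNReal.ofReal_natCast, ENNReal.ofReal_mul hc.le, ENNReal.ofReal_pow (by norm_num),
      ENNReal.ofReal_ofNat] at this
  refine (rpow_le_mul_rpow (c := ENNReal.ofReal c) (s := s) ?_ ?_ ?_ has).trans (le_of_eq ?_)
  · exact ENNReal.div_ne_zero.mpr ⟨two_pow_ne_zero _, hnt⟩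
  · exact ENNReal.div_ne_top (two_pow_ne_top _) hn0
  · rw [← mul_div_assoc, ENNReal.le_div_iff_mul_le (.inl hn0) (.inl hnt), one_mul]
    exact h1
  · rw [ENNReal.div_rpow_of_nonneg _ _ hs, weight_eq, ENNReal.rpow_neg, div_eq_mul_inv]
    ring

theorem ofReal_natCast_rpow {n : ℕ} (hn : 0 < n) (t : ℝ) :
    ENNReal.ofReal ((n : ℝ) ^ t) = (n : ℝ≥0∞) ^ t := by
  rw [← ENNReal.ofReal_rpow_of_pos (by exact_mod_cast hn), ENNReal.ofReal_natCast]

/-- A bound for the high scales gives a bound for the worst-case error. -/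
theorem LocalMeansKernel.asympLE_worstCaseError {L d : ℕ} (K : LocalMeansKernel L)
    (hd : 1 ≤ d) {p : ℝ≥0∞} (hp : 1 ≤ p) {s : ℝ} (hs : (p⁻¹).toReal < s)
    {N : 𝓢'(Rd d, ℂ) → ℝ≥0∞} (hN : ∀ u m, weight s m * eLpNorm (K.conv u m) p volume ≤ N u)
    {b : ℕ → ℝ≥0∞} (hb : ∀ c : ℝ, 0 < c → ∃ C : ℝ≥0, ∀ n : ℕ, 2 ≤ n → ∀ u : 𝓢'(Rd d, ℂ),
      Distribution.dsupport u ⊆ unitCube d → N u ≤ 1 → K.highSum c n u ≤ C * b n) :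
    AsympLE (fun n => worstCaseError n N) b := by
  obtain ⟨C, c, hc, hC⟩ := K.exists_cubatureError_le_highSum hd hp hs
  obtain ⟨C', hC'⟩ := hb c hc
  refine ⟨C * C' + 1, by positivity, fun n hn => ?_⟩
  refine iSup₂_le fun u hu => ?_
  calc cubatureError n u ≤ C * K.highSum c n u :=
        hC n (by omega) u hu.1.2 fun m => (hN u m).trans hu.2
    _ ≤ C * (C' * b n) := by gcongr; exact hC' n hn u hu.1.2 hu.2
    _ = (C * C' : ℝ≥0) * b n := by push_cast; ring
    _ ≤ _ := by
        gcongr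
        exact le_self_add

theorem LocalMeansKernel.asympLE_besov {L d : ℕ} (K : LocalMeansKernel L)
    (hd : 1 ≤ d) {p : ℝ≥0∞} (hp : 1 ≤ p) {s : ℝ} (hs : (p⁻¹).toReal < s) {θ : ℝ} (hθ : 0 < θ)
    (hθ1 : θ < 1) :
    AsympLE (fun n => worstCaseError n (K.besovNorm (d := d) s p θ))
        (fun n => ENNReal.ofReal ((n : ℝ) ^ (-s))) := by
  refine K.asympLE_worstCaseError hd hp hs
    (fun u m => K.weight_mul_eLpNorm_le_besovNorm hθ u m) fun c hc => ?_
  obtain ⟨R, hR, hsupp⟩ := K.exists_conv_support d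
  obtain ⟨A, hA⟩ := exists_sumWeight_le hd hc
  obtain ⟨B, hB⟩ := exists_lintegral_sumWeight_le hd hR
  set a := (p⁻¹).toReal with ha
  have ha0 : 0 ≤ a := ENNReal.toReal_nonneg
  have ha1 : a ≤ 1 := inv_toReal_le_one hp
  -- `A + 1` replaces `A` because the weighted Hölder estimate asks for a nonzero majorant.
  set C : ℝ≥0∞ := ((A + 1 : ℝ≥0) : ℝ≥0∞) ^ a * (B : ℝ≥0∞) ^ (1 - a) * ENNReal.ofReal c ^ (s - a)
    with hCdef
  have hCt : C ≠ ∞ := by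
    have h1 : ((A + 1 : ℝ≥0) : ℝ≥0∞) ^ a ≠ ∞ :=
      ENNReal.rpow_ne_top_of_nonneg ha0 ENNReal.coe_ne_top
    have h2 : (B : ℝ≥0∞) ^ (1 - a) ≠ ∞ :=
      ENNReal.rpow_ne_top_of_nonneg (by linarith) ENNReal.coe_ne_top
    have h3 : ENNReal.ofReal c ^ (s - a) ≠ ∞ :=
      ENNReal.rpow_ne_top_of_nonneg (by linarith) ENNReal.ofReal_ne_top
    exact ENNReal.mul_ne_top (ENNReal.mul_ne_top h1 h2) h3
  refine ⟨C.toNNReal, fun n hn u hu hN => ?_⟩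
  have hn0 : 0 < n := by omega
  have hnt : (n : ℝ≥0∞) ≠ ∞ := ENNReal.natCast_ne_top n
  rw [ofReal_natCast_rpow hn0, ENNReal.coe_toNNReal hCt]
  have hterm : ∀ m : Fin d → ℕ, {m | (n : ℝ) ≤ c * 2 ^ (∑ i, m i)}.indicator
      (fun m => ∫⁻ y, ‖K.conv u m y‖ₑ * sumWeight n m y) m ≤
      C * (n : ℝ≥0∞) ^ (-s) * (weight s m * eLpNorm (K.conv u m) p volume) := by
    intro m
    by_cases hm : (n : ℝ) ≤ c * 2 ^ (∑ i, m i)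
    swap
    · rw [Set.indicator_of_notMem (by exact hm)]
      exact zero_le
    rw [Set.indicator_of_mem (by exact hm)]
    have h1 := lintegral_enorm_mul_le (μ := volume) (K.continuous_conv u m).stronglyMeasurable
      (measurable_sumWeight n m) (isCompact_box d R).isClosed.measurableSet (hsupp u hu m)
      (A := ((A + 1 : ℝ≥0) : ℝ≥0∞) * (2 ^ (∑ i, m i) / n)) ?_ (fun y => ?_) (hB n m hn0) hp
    · refine h1.trans ?_
      rw [ENNReal.mul_rpow_of_nonneg _ _ ha0]
      calc _ ≤ ((A + 1 : ℝ≥0) : ℝ≥0∞) ^ a * (ENNReal.ofReal c ^ (s - a) *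
            ((n : ℝ≥0∞) ^ (-s) * weight s m)) * (B : ℝ≥0∞) ^ (1 - a) *
              eLpNorm (K.conv u m) p volume := by
            gcongr
            exact high_rpow_le hc hn0 hm hs.le (ha0.trans hs.le)
        _ = _ := by rw [hCdef]; ring
    · exact mul_ne_zero (by positivity) (ENNReal.div_ne_zero.mpr ⟨two_pow_ne_zero _, hnt⟩)
    · refine (hA n m hn0 hm y).trans ?_
      rw [mul_div_assoc]
      gcongr
      exact le_self_add
  calc K.highSum c n u
      ≤ ∑' m, C * (n : ℝ≥0∞) ^ (-s) * (weight s m * eLpNorm (K.conv u m) p volume) :=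
        ENNReal.tsum_le_tsum hterm
    _ = C * (n : ℝ≥0∞) ^ (-s) * ∑' m, weight s m * eLpNorm (K.conv u m) p volume :=
        ENNReal.tsum_mul_left
    _ ≤ C * (n : ℝ≥0∞) ^ (-s) * 1 := by
        gcongr
        exact (tsum_le_rpow_tsum_rpow hθ hθ1.le _).trans hN
    _ = _ := mul_one _

end

end FrolovCubature

namespace FrolovCubature

noncomputable section

/-! ### Counting scales -/

/-- The first coordinate is determined by the sum and the other `d` coordinates, which lie in `0, …,
k`. -/
theorem card_sum_eq_le (d k : ℕ) :
    ENat.card {m : Fin (d + 1) → ℕ // ∑ i, m i = k} ≤ ((k + 1) ^ d : ℕ) := by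
  have hle : ∀ (m : {m : Fin (d + 1) → ℕ // ∑ i, m i = k}) (i : Fin d), m.1 i.succ < k + 1 := by
    intro m i
    have := Finset.single_le_sum (f := m.1) (fun _ _ => Nat.zero_le _) (Finset.mem_univ i.succ)
    rw [m.2] at this
    omega
  have hinj : Function.Injective fun (m : {m : Fin (d + 1) → ℕ // ∑ i, m i = k}) (i : Fin d) =>
      (⟨m.1 i.succ, hle m i⟩ : Fin (k + 1)) := by
    intro m m' h
    have hs : ∀ i : Fin d, m.1 i.succ = m'.1 i.succ := fun i => by
      simpa using congrFun h i
    have h0 : m.1 0 = m'.1 0 := by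
      have h1 := m.2
      have h2 := m'.2
      rw [Fin.sum_univ_succ] at h1 h2
      rw [Finset.sum_congr rfl fun i _ => hs i] at h1
      omega
    refine Subtype.ext (funext fun i => ?_)
    refine Fin.cases h0 hs i
  refine (ENat.card_le_card_of_injective hinj).trans (le_of_eq ?_)
  rw [ENat.card_eq_coe_fintype_card]
  simp

theorem tsum_sum_le (d : ℕ) (F : ℕ → ℝ≥0∞) :
    ∑' m : Fin (d + 1) → ℕ, F (∑ i, m i) ≤ ∑' k : ℕ, ((k + 1) ^ d : ℕ) * F k := by
  rw [← (Equiv.sigmaFiberEquiv fun m : Fin (d + 1) → ℕ => ∑ i, m i).tsum_eq, ENNReal.tsum_sigma']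
  refine ENNReal.tsum_le_tsum fun k => ?_
  have h : ∀ x : {m : Fin (d + 1) → ℕ // ∑ i, m i = k},
      F (∑ i, (Equiv.sigmaFiberEquiv fun m : Fin (d + 1) → ℕ => ∑ i, m i) ⟨k, x⟩ i) = F k :=
    fun x => congrArg F x.2
  simp_rw [h]
  rw [ENNReal.tsum_const]
  gcongr
  exact_mod_cast ENat.toENNReal_le.mpr (card_sum_eq_le d k)

theorem exists_tsum_high_le (d : ℕ) {r : ℝ} (h0 : 0 < r) (h1 : r < 1) : ∃ C : ℝ≥0, ∀ N : ℕ,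
    ∑' m : Fin (d + 1) → ℕ, {m | N ≤ ∑ i, m i}.indicator
      (fun m => ENNReal.ofReal (r ^ (∑ i, m i))) m ≤
      C * ((N + 1 : ℕ) : ℝ≥0∞) ^ d * ENNReal.ofReal (r ^ N) := by
  have hsum : ∑' j : ℕ, ENNReal.ofReal (((j + 1 : ℕ) : ℝ) ^ d * r ^ j) ≠ ∞ := by
    have h := summable_pow_mul_geometric_of_norm_lt_one (R := ℝ) d
      (r := r) (by rw [Real.norm_of_nonneg h0.le]; exact h1)
    have h2 := ((summable_nat_add_iff 1).mpr h).mul_right r⁻¹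
    refine (h2.congr fun j => ?_).tsum_ofReal_ne_top
    rw [pow_succ]
    field_simp
  refine ⟨(∑' j : ℕ, ENNReal.ofReal (((j + 1 : ℕ) : ℝ) ^ d * r ^ j)).toNNReal, fun N => ?_⟩
  rw [ENNReal.coe_toNNReal hsum]
  have hF := tsum_sum_le d fun k => if N ≤ k then ENNReal.ofReal (r ^ k) else 0
  refine (le_of_eq (tsum_congr fun m => ?_)).trans (hF.trans ?_)
  · simp [Set.indicator]
  rw [← Summable.sum_add_tsum_nat_add' (k := N) ENNReal.summable, Finset.sum_eq_zero, zero_add,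
    ← ENNReal.tsum_mul_right, ← ENNReal.tsum_mul_right]
  · refine ENNReal.tsum_le_tsum fun j => ?_
    rw [if_pos (Nat.le_add_left N j), ← ENNReal.ofReal_natCast (N + 1),
      ← ENNReal.ofReal_natCast ((j + N + 1) ^ d), ← ENNReal.ofReal_pow (by positivity),
      ← ENNReal.ofReal_mul (by positivity), ← ENNReal.ofReal_mul (by positivity),
      ← ENNReal.ofReal_mul (by positivity)]
    refine ENNReal.ofReal_le_ofReal ?_
    -- With `k = j + N`, this separates the polynomial factor: the power of `j + 1` is absorbed by
    -- the geometric series, leaving only `(N + 1)^d`.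
    have h3 : ((j + N + 1 : ℕ) : ℝ) ≤ ((j + 1 : ℕ) : ℝ) * ((N + 1 : ℕ) : ℝ) := by
      push_cast
      have : (0 : ℝ) ≤ (j : ℝ) * N := by positivity
      nlinarith
    calc (((j + N + 1) ^ d : ℕ) : ℝ) * r ^ (j + N)
        = ((j + N + 1 : ℕ) : ℝ) ^ d * (r ^ j * r ^ N) := by rw [Nat.cast_pow, pow_add]
      _ ≤ (((j + 1 : ℕ) : ℝ) * ((N + 1 : ℕ) : ℝ)) ^ d * (r ^ j * r ^ N) := by gcongr
      _ = _ := by rw [mul_pow]; ring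
  · intro k hk
    rw [if_neg (by simpa using hk), mul_zero]

/-! ### Triebel-Lizorkin spaces -/

namespace LocalMeansKernel

variable {L d : ℕ} (K : LocalMeansKernel L)

/-- The function whose `L^p` norm is the Triebel-Lizorkin norm. -/
def squareFunction (s θ : ℝ) (u : 𝓢'(Rd d, ℂ)) (x : Rd d) : ℝ≥0∞ :=
  (∑' m : Fin d → ℕ, (weight s m * ‖K.conv u m x‖ₑ) ^ θ) ^ (1 / θ)

theorem measurable_squareFunction (s θ : ℝ) (u : 𝓢'(Rd d, ℂ)) :
    Measurable (K.squareFunction s θ u) := by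
  have h : ∀ m : Fin d → ℕ, Measurable fun x => (weight s m * ‖K.conv u m x‖ₑ) ^ θ := fun m =>
    (measurable_const.mul (K.continuous_conv u m).enorm.measurable).pow_const θ
  exact (Measurable.tsum (L := SummationFilter.unconditional (Fin d → ℕ)) h).pow_const _

theorem tsum_le_squareFunction {s θ : ℝ} (hθ : 0 < θ) (hθ1 : θ ≤ 1) (u : 𝓢'(Rd d, ℂ)) (x : Rd d) :
    ∑' m, weight s m * ‖K.conv u m x‖ₑ ≤ K.squareFunction s θ u x :=
  tsum_le_rpow_tsum_rpow hθ hθ1 _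

theorem triebelLizorkinNorm_eq (s : ℝ) (p : ℝ≥0∞) (θ : ℝ) (u : 𝓢'(Rd d, ℂ)) :
    K.triebelLizorkinNorm s p θ u = eLpNorm (K.squareFunction s θ u) p volume := rfl

theorem lintegral_squareFunction_le {p : ℝ≥0∞} (hp : 1 ≤ p) (s θ : ℝ) (u : 𝓢'(Rd d, ℂ)) (R : ℝ) :
    ∫⁻ x in box d R, K.squareFunction s θ u x ≤
      K.triebelLizorkinNorm s p θ u * volume (box d R) ^ (1 - (p⁻¹).toReal) := by
  have h := eLpNorm_le_eLpNorm_mul_rpow_measure_univ (f := K.squareFunction s θ u)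
    (μ := volume.restrict (box d R)) hp (K.measurable_squareFunction s θ u).aestronglyMeasurable
  rw [eLpNorm_one_eq_lintegral_enorm, Measure.restrict_apply_univ, ENNReal.toReal_one, div_one,
    one_div, ← ENNReal.toReal_inv] at h
  refine h.trans (mul_le_mul_left ?_ _)
  exact eLpNorm_restrict_le _ _ _ _

theorem highSum_le_lintegral {c : ℝ} {n : ℕ} {u : 𝓢'(Rd d, ℂ)} {R : ℝ}
    (hsupp : ∀ m x, x ∉ box d R → K.conv u m x = 0) :
    K.highSum c n u = ∫⁻ y in box d R, ∑' m : Fin d → ℕ,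
      {m | (n : ℝ) ≤ c * 2 ^ (∑ i, m i)}.indicator
        (fun m => ‖K.conv u m y‖ₑ * sumWeight n m y) m := by
  have hms : MeasurableSet (box d R) := (isCompact_box d R).isClosed.measurableSet
  have hm : ∀ m, Measurable fun y => ‖K.conv u m y‖ₑ * sumWeight n m y := fun m =>
    (K.continuous_conv u m).enorm.measurable.mul (measurable_sumWeight n m)
  rw [highSum, lintegral_tsum]
  · refine tsum_congr fun m => ?_
    by_cases h : m ∈ {m : Fin d → ℕ | (n : ℝ) ≤ c * 2 ^ (∑ i, m i)}
    · simp only [Set.indicator_of_mem h]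
      rw [setLIntegral_eq_of_support_subset]
      intro x hx
      by_contra hcon
      exact hx (by simp [hsupp m x hcon])
    · simp only [Set.indicator_of_notMem h, lintegral_zero]
  · intro m
    by_cases h : m ∈ {m : Fin d → ℕ | (n : ℝ) ≤ c * 2 ^ (∑ i, m i)}
    · simp only [Set.indicator_of_mem h]
      exact (hm m).aemeasurable
    · simp only [Set.indicator_of_notMem h]
      exact aemeasurable_const

/-- Since `s ≥ 1`, already the pointwise bound `2^{|m|_1}/n` for the weights can be raised to the
exponent `s`. The sum over `m` is then dominated pointwise by the square function, whose `L^1` norm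
on the box is controlled by its `L^p` norm. -/
theorem asympLE_triebelLizorkin (hd : 1 ≤ d) {p : ℝ≥0∞} (hp : 1 ≤ p) {s : ℝ}
    (hs : (p⁻¹).toReal < s) {θ : ℝ} (hθ : 0 < θ) (hθ1 : θ < 1) (hs1 : 1 ≤ s) :
    AsympLE (fun n => worstCaseError n (K.triebelLizorkinNorm (d := d) s p θ))
        (fun n => ENNReal.ofReal ((n : ℝ) ^ (-s))) := by
  refine K.asympLE_worstCaseError hd hp hs
    (fun u m => K.weight_mul_eLpNorm_le_triebelLizorkinNorm hθ u m) fun c hc => ?_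
  obtain ⟨R, hR, hsupp⟩ := K.exists_conv_support d
  obtain ⟨A, hA⟩ := exists_sumWeight_le hd hc
  set V : ℝ≥0∞ := volume (box d R) ^ (1 - (p⁻¹).toReal) with hV
  have hVt : V ≠ ∞ := ENNReal.rpow_ne_top_of_nonneg (by linarith [inv_toReal_le_one hp])
    (isCompact_box d R).measure_lt_top.ne
  set C : ℝ≥0∞ := A * ENNReal.ofReal c ^ (s - 1) with hCdef
  have hCt : C ≠ ∞ := ENNReal.mul_ne_top ENNReal.coe_ne_top
    (ENNReal.rpow_ne_top_of_nonneg (by linarith) ENNReal.ofReal_ne_top)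
  refine ⟨(C * V).toNNReal, fun n hn u hu hN => ?_⟩
  have hn0 : 0 < n := by omega
  rw [ofReal_natCast_rpow hn0, ENNReal.coe_toNNReal (ENNReal.mul_ne_top hCt hVt),
    K.highSum_le_lintegral (hsupp u hu)]
  have hpt : ∀ y, ∑' m : Fin d → ℕ, {m | (n : ℝ) ≤ c * 2 ^ (∑ i, m i)}.indicator
        (fun m => ‖K.conv u m y‖ₑ * sumWeight n m y) m ≤
      C * (n : ℝ≥0∞) ^ (-s) * K.squareFunction s θ u y := by
    intro y
    refine le_trans (ENNReal.tsum_le_tsum fun m => ?_) ((ENNReal.tsum_mul_left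
      (a := C * (n : ℝ≥0∞) ^ (-s)) (f := fun m => weight s m * ‖K.conv u m y‖ₑ)).trans_le ?_)
    · by_cases hm : (n : ℝ) ≤ c * 2 ^ (∑ i, m i)
      swap
      · rw [Set.indicator_of_notMem (by exact hm)]
        exact zero_le
      rw [Set.indicator_of_mem (by exact hm)]
      have h1 := high_rpow_le hc hn0 hm hs1 (by linarith)
      rw [ENNReal.rpow_one] at h1
      calc ‖K.conv u m y‖ₑ * sumWeight n m y
          ≤ ‖K.conv u m y‖ₑ * (A * (2 ^ (∑ i, m i) / n)) := by
            gcongr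
            rw [← mul_div_assoc]
            exact hA n m hn0 hm y
        _ ≤ ‖K.conv u m y‖ₑ * (A * (ENNReal.ofReal c ^ (s - 1) *
            ((n : ℝ≥0∞) ^ (-s) * weight s m))) := by gcongr
        _ = _ := by rw [hCdef]; ring
    · gcongr
      exact K.tsum_le_squareFunction hθ hθ1.le u y
  calc _ ≤ ∫⁻ y in box d R, C * (n : ℝ≥0∞) ^ (-s) * K.squareFunction s θ u y :=
        lintegral_mono fun y => hpt y
    _ = C * (n : ℝ≥0∞) ^ (-s) * ∫⁻ y in box d R, K.squareFunction s θ u y :=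
        lintegral_const_mul _ (K.measurable_squareFunction s θ u)
    _ ≤ C * (n : ℝ≥0∞) ^ (-s) * (1 * V) := by
        gcongr
        exact (K.lintegral_squareFunction_le hp s θ u R).trans (mul_le_mul_left hN _)
    _ = _ := by ring

end LocalMeansKernel

end

end FrolovCubature

namespace FrolovCubature

noncomputable section

/-! ### Triebel-Lizorkin spaces of small smoothness -/

/-- `N` is the least exponent with `n (log n)^d ≤ 2^N`. Since `log n ≤ n`, it is at most a multiple
of `log n`; the additive constants are absorbed by `log n ≥ log 2`. -/
theorem exists_threshold_scale (d : ℕ) : ∃ C : ℝ, 0 < C ∧ ∀ n : ℕ, 2 ≤ n → ∃ N : ℕ,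
    (∀ k < N, (2 : ℝ) ^ k ≤ n * Real.log n ^ d) ∧ n * Real.log n ^ d ≤ (2 : ℝ) ^ N ∧
      (N + 1 : ℕ) ≤ C * Real.log n := by
  have hl2 : 0 < Real.log 2 := Real.log_pos one_lt_two
  refine ⟨(d + 3) / Real.log 2, by positivity, fun n hn => ?_⟩
  have hn2 : (2 : ℝ) ≤ n := by exact_mod_cast hn
  have hlog : Real.log 2 ≤ Real.log n := Real.log_le_log two_pos hn2
  have hln : Real.log n ≤ n := (Real.log_le_sub_one_of_pos (by linarith)).trans (by linarith)
  set M := (n : ℝ) * Real.log n ^ d with hM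
  have hMle : M ≤ (n : ℝ) ^ (d + 1) := by
    rw [hM, pow_succ, mul_comm]
    have := pow_le_pow_left₀ (hl2.le.trans hlog) hln d
    gcongr
  have hex : ∃ N : ℕ, M ≤ 2 ^ N := by
    obtain ⟨N, hN⟩ := pow_unbounded_of_one_lt M (one_lt_two (α := ℝ))
    exact ⟨N, hN.le⟩
  classical
  refine ⟨Nat.find hex, fun k hk => (not_le.mp (Nat.find_min hex hk)).le, Nat.find_spec hex, ?_⟩
  set N := Nat.find hex with hNdef
  have hkey : ((N : ℝ) - 1) * Real.log 2 ≤ (d + 1) * Real.log n := by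
    rcases Nat.eq_zero_or_pos N with h0 | h0
    · rw [h0]
      have : 0 ≤ (d + 1 : ℝ) * Real.log n := by positivity
      push_cast
      linarith
    · have h1 : (2 : ℝ) ^ (N - 1) ≤ (n : ℝ) ^ (d + 1) :=
        (not_le.mp (Nat.find_min hex (show N - 1 < N by omega))).le.trans hMle
      have h2 := Real.log_le_log (by positivity) h1
      rw [Real.log_pow, Real.log_pow] at h2
      push_cast [Nat.cast_sub h0] at h2
      exact h2
  rw [div_mul_eq_mul_div, le_div_iff₀ hl2]
  push_cast
  linarith

theorem tsum_mul_le_mul_rpow {ι : Type*} (a b : ι → ℝ≥0∞) {q : ℝ} (hq : 0 < q) :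
    ∑' i, a i * b i ≤ (∑' i, a i) * (∑' i, b i ^ q) ^ (1 / q) := by
  rw [← ENNReal.tsum_mul_right]
  refine ENNReal.tsum_le_tsum fun i => mul_le_mul_right ?_ _
  calc b i = (b i ^ q) ^ (1 / q) := by
        rw [← ENNReal.rpow_mul, mul_one_div_cancel hq.ne', ENNReal.rpow_one]
    _ ≤ _ := ENNReal.rpow_le_rpow (ENNReal.le_tsum i) (by positivity)

theorem lintegral_rpow_sumWeight_le {d : ℕ} {n : ℕ} {m : Fin d → ℕ} {R : ℝ} {X B : ℝ≥0∞}
    (hX : ∀ y : Rd d, sumWeight n m y ≤ X) (hB : ∫⁻ y in box d R, sumWeight n m y ≤ B) {q : ℝ}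
    (hq : 1 ≤ q) : ∫⁻ y in box d R, sumWeight n m y ^ q ≤ X ^ (q - 1) * B := by
  calc ∫⁻ y in box d R, sumWeight n m y ^ q
      ≤ ∫⁻ y in box d R, X ^ (q - 1) * sumWeight n m y := by
        refine lintegral_mono fun y => ?_
        have h : sumWeight n m y ^ q = sumWeight n m y ^ (q - 1) * sumWeight n m y := by
          conv_rhs => rw [← ENNReal.rpow_one (sumWeight n m y), ← ENNReal.rpow_mul, one_mul]
          rw [← ENNReal.rpow_add_of_nonneg _ _ (by linarith) zero_le_one, sub_add_cancel]
        simp only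
        rw [h]
        refine mul_le_mul_left ?_ _
        exact ENNReal.rpow_le_rpow (hX y) (by linarith)
    _ = X ^ (q - 1) * ∫⁻ y in box d R, sumWeight n m y :=
        lintegral_const_mul _ (measurable_sumWeight n m)
    _ ≤ _ := by gcongr

namespace LocalMeansKernel

variable {L d : ℕ} (K : LocalMeansKernel L)

/-- The weights of the scales beyond a threshold. -/
def farWeight (d : ℕ) (s c : ℝ) (n N : ℕ) (m : Fin d → ℕ) (y : Rd d) : ℝ≥0∞ :=
  {m | (n : ℝ) ≤ c * 2 ^ (∑ i, m i) ∧ N ≤ ∑ i, m i}.indicator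
    (fun m => ((2 : ℝ≥0∞) ^ (∑ i, m i)) ^ (-s) * sumWeight n m y) m

theorem measurable_farWeight (s c : ℝ) (n N : ℕ) (m : Fin d → ℕ) :
    Measurable (farWeight d s c n N m) := by
  unfold farWeight
  by_cases h : m ∈ {m : Fin d → ℕ | (n : ℝ) ≤ c * 2 ^ (∑ i, m i) ∧ N ≤ ∑ i, m i}
  · simp only [Set.indicator_of_mem h]
    exact measurable_const.mul (measurable_sumWeight n m)
  · simp only [Set.indicator_of_notMem h]
    exact measurable_const

/-- For `|m|_1 < N` the pointwise bound is written as `2^{|m|_1} = 2^{|m|_1(1-s)} 2^{s|m|_1}`, and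
`s ≤ 1` lets the first factor be estimated at the threshold. For `|m|_1 ≥ N` the factor `2^{s|m|_1}`
goes to the square function, and the supremum of the remaining weights is bounded by their `ℓ^q`
norm. -/
theorem tsum_high_le_near_add_far {s θ c : ℝ} (hs1 : s ≤ 1) (hθ : 0 < θ)
    (hθ1 : θ ≤ 1) {n : ℕ} {A : ℝ≥0∞}
    (hA : ∀ m : Fin d → ℕ, (n : ℝ) ≤ c * 2 ^ (∑ i, m i) → ∀ y : Rd d,
      sumWeight n m y ≤ A * 2 ^ (∑ i, m i) / n)
    {N : ℕ} {M : ℝ≥0∞} (hM : ∀ k < N, (2 : ℝ≥0∞) ^ k ≤ M) {q : ℝ} (hq : 0 < q)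
    (u : 𝓢'(Rd d, ℂ)) (y : Rd d) :
    ∑' m : Fin d → ℕ, {m | (n : ℝ) ≤ c * 2 ^ (∑ i, m i)}.indicator
        (fun m => ‖K.conv u m y‖ₑ * sumWeight n m y) m ≤
      A * M ^ (1 - s) * (n : ℝ≥0∞)⁻¹ * K.squareFunction s θ u y +
      K.squareFunction s θ u y * (∑' m, farWeight d s c n N m y ^ q) ^ (1 / q) := by
  have hG := K.tsum_le_squareFunction (s := s) hθ hθ1 u y
  have h1 : ∀ m : Fin d → ℕ, {m | (n : ℝ) ≤ c * 2 ^ (∑ i, m i)}.indicator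
        (fun m => ‖K.conv u m y‖ₑ * sumWeight n m y) m ≤
      A * M ^ (1 - s) * (n : ℝ≥0∞)⁻¹ * (weight s m * ‖K.conv u m y‖ₑ) +
      weight s m * ‖K.conv u m y‖ₑ * farWeight d s c n N m y := by
    intro m
    by_cases hm : (n : ℝ) ≤ c * 2 ^ (∑ i, m i)
    swap
    · rw [Set.indicator_of_notMem (by exact hm)]
      exact zero_le
    rw [Set.indicator_of_mem (by exact hm)]
    set k := ∑ i, m i with hk
    rcases lt_or_ge k N with hkN | hkN
    · refine le_trans ?_ le_self_add
      have h2 : (2 : ℝ≥0∞) ^ k = ((2 : ℝ≥0∞) ^ k) ^ (1 - s) * weight s m := by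
        rw [weight_eq, ← hk, ← ENNReal.rpow_add _ _ (two_pow_ne_zero _) (two_pow_ne_top _),
          sub_add_cancel, ENNReal.rpow_one]
      calc ‖K.conv u m y‖ₑ * sumWeight n m y
          ≤ ‖K.conv u m y‖ₑ * (A * (((2 : ℝ≥0∞) ^ k) ^ (1 - s) * weight s m) / n) := by
            gcongr
            rw [← h2]
            exact hA m hm y
        _ ≤ ‖K.conv u m y‖ₑ * (A * (M ^ (1 - s) * weight s m) / n) := by
            gcongr
            exact hM k hkN
        _ = _ := by rw [div_eq_mul_inv]; ring
    · refine le_trans (le_of_eq ?_) le_add_self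
      rw [farWeight, Set.indicator_of_mem (by exact ⟨hm, hkN⟩)]
      calc _ = (((2 : ℝ≥0∞) ^ (∑ i, m i)) ^ (-s) * weight s m) *
            (‖K.conv u m y‖ₑ * sumWeight n m y) := by rw [weight_mul_neg, one_mul]
        _ = _ := by ring
  refine (ENNReal.tsum_le_tsum h1).trans ?_
  rw [ENNReal.tsum_add, ENNReal.tsum_mul_left]
  refine add_le_add (mul_le_mul_right hG _) ((tsum_mul_le_mul_rpow _ _ hq).trans ?_)
  exact mul_le_mul_left hG _

/-- The sup and integral bounds on the weight give `∫ w^q ≲ (2^{|m|_1}/n)^{q-1}`, so scale `m`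
contributes `n^{-(q-1)} 2^{-(sq-q+1)|m|_1}`. Counting multi-indices of given length adds the power
of `N + 1`. In dimension `d + 1` this power is `d`. -/
theorem exists_lintegral_farWeight_le (d : ℕ) {s c R q : ℝ} (hc : 0 < c) (hR : 0 ≤ R)
    (hq : 1 ≤ q) (hβ : 0 < s * q - q + 1) : ∃ C : ℝ≥0, ∀ n N : ℕ, 0 < n →
    ∫⁻ y in box (d + 1) R, ∑' m, farWeight (d + 1) s c n N m y ^ q ≤
      C * (n : ℝ≥0∞) ^ (-(q - 1)) * ((N + 1 : ℕ) : ℝ≥0∞) ^ d *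
        ((2 : ℝ≥0∞) ^ N) ^ (-(s * q - q + 1)) := by
  obtain ⟨A, hA⟩ := exists_sumWeight_le (d := d + 1) (by omega) hc
  obtain ⟨B, hB⟩ := exists_lintegral_sumWeight_le (d := d + 1) (by omega) hR
  set β := s * q - q + 1 with hβdef
  set r : ℝ := 2 ^ (-β) with hr
  obtain ⟨C, hC⟩ := exists_tsum_high_le d (r := r) (by positivity)
    (Real.rpow_lt_one_of_one_lt_of_neg one_lt_two (by linarith))
  have hq0 : 0 ≤ q - 1 := by linarith
  set D : ℝ≥0∞ := (A : ℝ≥0∞) ^ (q - 1) * B with hD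
  have hDt : D ≠ ∞ := ENNReal.mul_ne_top
    (ENNReal.rpow_ne_top_of_nonneg hq0 ENNReal.coe_ne_top) ENNReal.coe_ne_top
  refine ⟨D.toNNReal * C, fun n N hn => ?_⟩
  rw [lintegral_tsum fun m => ((measurable_farWeight s c n N m).pow_const q).aemeasurable]
  have hterm : ∀ m : Fin (d + 1) → ℕ, ∫⁻ y in box (d + 1) R, farWeight (d + 1) s c n N m y ^ q ≤
      D * (n : ℝ≥0∞) ^ (-(q - 1)) * {m | N ≤ ∑ i, m i}.indicator
        (fun m => ENNReal.ofReal (r ^ (∑ i, m i))) m := by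
    intro m
    by_cases hm : (n : ℝ) ≤ c * 2 ^ (∑ i, m i) ∧ N ≤ ∑ i, m i
    swap
    · have h0 : ∀ y, farWeight (d + 1) s c n N m y = 0 := fun y =>
        Set.indicator_of_notMem (by exact hm) _
      simp_rw [h0, ENNReal.zero_rpow_of_pos (by linarith : 0 < q), lintegral_zero]
      exact zero_le
    have h1 : ∀ y, farWeight (d + 1) s c n N m y =
        ((2 : ℝ≥0∞) ^ (∑ i, m i)) ^ (-s) * sumWeight n m y := fun y =>
      Set.indicator_of_mem (by exact hm) _
    rw [Set.indicator_of_mem (by exact hm.2)]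
    simp_rw [h1, ENNReal.mul_rpow_of_nonneg _ _ (by linarith : 0 ≤ q)]
    rw [lintegral_const_mul _ ((measurable_sumWeight n m).pow_const q)]
    set k := ∑ i, m i with hk
    calc _ ≤ (((2 : ℝ≥0∞) ^ k) ^ (-s)) ^ q * ((A * 2 ^ k / n) ^ (q - 1) * B) := by
          gcongr
          exact lintegral_rpow_sumWeight_le (hA n m hn hm.1) (hB n m hn) hq
      _ = D * (n : ℝ≥0∞) ^ (-(q - 1)) * ((((2 : ℝ≥0∞) ^ k) ^ (-s)) ^ q *
          ((2 : ℝ≥0∞) ^ k) ^ (q - 1)) := by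
          rw [ENNReal.div_rpow_of_nonneg _ _ hq0, ENNReal.mul_rpow_of_nonneg _ _ hq0, hD,
            ENNReal.rpow_neg (n : ℝ≥0∞), div_eq_mul_inv]
          ring_nf
      _ = _ := by
          rw [← ENNReal.rpow_mul, ← ENNReal.rpow_add _ _ (two_pow_ne_zero _) (two_pow_ne_top _),
            hr, ← two_pow_rpow, hβdef]
          congr 2
          ring
  refine (ENNReal.tsum_le_tsum hterm).trans ?_
  rw [ENNReal.tsum_mul_left]
  refine (mul_le_mul_right (hC N) _).trans (le_of_eq ?_)
  rw [ENNReal.coe_mul, ENNReal.coe_toNNReal hDt, two_pow_rpow]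
  ring

theorem asympLE_triebelLizorkin_log (hd : 1 ≤ d) {p : ℝ≥0∞} (hp : 1 ≤ p) (hpt : p ≠ ∞) {s : ℝ}
    (hs : (p⁻¹).toReal < s) {θ : ℝ} (hθ : 0 < θ) (hθ1 : θ < 1) (hs1 : s < 1) :
    AsympLE (fun n => worstCaseError n (K.triebelLizorkinNorm (d := d) s p θ))
        (fun n => ENNReal.ofReal
            ((n : ℝ) ^ (-s) * Real.log n ^ (((d : ℝ) - 1) * (1 - s)))) := by
  refine K.asympLE_worstCaseError hd hp hs
    (fun u m => K.weight_mul_eLpNorm_le_triebelLizorkinNorm hθ u m) fun c hc => ?_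
  obtain ⟨R, hR, hsupp⟩ := K.exists_conv_support d
  obtain ⟨A, hA⟩ := exists_sumWeight_le hd hc
  obtain ⟨d, rfl⟩ : ∃ e, d = e + 1 := ⟨d - 1, by omega⟩
  set a := (p⁻¹).toReal with ha
  have ha0 : 0 < a := ENNReal.toReal_pos (ENNReal.inv_ne_zero.mpr hpt)
    (ENNReal.inv_ne_top.mpr (one_pos.trans_le hp).ne')
  have ha1 : a < 1 := hs.trans hs1
  have hpa : p.toReal = a⁻¹ := by rw [ha, ENNReal.toReal_inv, inv_inv]
  -- The exponent conjugate to `p`. It is finite because `1/p < s < 1` forces `p > 1`; moreover `s q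
  -- - q + 1 = q (s - 1/p)` is positive, as the far sum requires.
  set q : ℝ := (1 - a)⁻¹ with hq
  have hq1 : 1 ≤ q := (one_le_inv₀ (by linarith)).mpr (by linarith)
  have hq0 : 0 < q := by linarith
  have hqa : 1 / q = 1 - a := by rw [hq, one_div, inv_inv]
  have hqq : q * (1 - a) = 1 := inv_mul_cancel₀ (by linarith)
  have hβ : s * q - q + 1 = q * (s - a) := by linarith
  have hconj : p.toReal.HolderConjugate q := by
    rw [hpa, hq]
    exact Real.HolderConjugate.inv_inv ha0 (by linarith) (by ring)
  obtain ⟨C1, hC1⟩ := exists_lintegral_farWeight_le d (s := s) hc hR hq1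
    (by rw [hβ]; exact mul_pos hq0 (by linarith))
  obtain ⟨C2, hC2, hN⟩ := exists_threshold_scale d
  set V : ℝ≥0∞ := volume (box (d + 1) R) ^ (1 - a) with hV
  have hVt : V ≠ ∞ := ENNReal.rpow_ne_top_of_nonneg (by linarith)
    (isCompact_box (d + 1) R).measure_lt_top.ne
  set E : ℝ≥0∞ := (C1 : ℝ≥0∞) ^ (1 - a) * (ENNReal.ofReal C2 ^ d) ^ (1 - a) with hE
  have hEt : E ≠ ∞ := ENNReal.mul_ne_top
    (ENNReal.rpow_ne_top_of_nonneg (by linarith) ENNReal.coe_ne_top)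
    (ENNReal.rpow_ne_top_of_nonneg (by linarith) (by finiteness))
  have hCt : A * V + E ≠ ∞ := ENNReal.add_ne_top.mpr ⟨ENNReal.mul_ne_top ENNReal.coe_ne_top hVt, hEt⟩
  refine ⟨(A * V + E).toNNReal, fun n hn u hu hNu => ?_⟩
  have hn0 : 0 < n := by omega
  have hnz : (n : ℝ≥0∞) ≠ 0 := by exact_mod_cast hn0.ne'
  have hnt : (n : ℝ≥0∞) ≠ ∞ := ENNReal.natCast_ne_top n
  obtain ⟨N, hN1, hN2, hN3⟩ := hN n hn
  have hlog : 0 < Real.log n := Real.log_pos (by exact_mod_cast (by omega : 1 < n))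
  set l : ℝ≥0∞ := ENNReal.ofReal (Real.log n) ^ d with hl
  have hl0 : l ≠ 0 := pow_ne_zero _ (ENNReal.ofReal_pos.mpr hlog).ne'
  have hlt : l ≠ ∞ := by finiteness
  set M : ℝ≥0∞ := n * l with hM
  have hMe : ENNReal.ofReal (n * Real.log n ^ d) = M := by
    rw [ENNReal.ofReal_mul (by positivity), ENNReal.ofReal_natCast, ENNReal.ofReal_pow hlog.le]
  have hM1 : ∀ k < N, (2 : ℝ≥0∞) ^ k ≤ M := fun k hk => by
    have := ENNReal.ofReal_le_ofReal (hN1 k hk)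
    rwa [hMe, ENNReal.ofReal_pow two_pos.le, ENNReal.ofReal_ofNat] at this
  have hM2 : M ≤ (2 : ℝ≥0∞) ^ N := by
    have := ENNReal.ofReal_le_ofReal hN2
    rwa [hMe, ENNReal.ofReal_pow two_pos.le, ENNReal.ofReal_ofNat] at this
  have hM3 : ((N + 1 : ℕ) : ℝ≥0∞) ^ d ≤ ENNReal.ofReal C2 ^ d * l := by
    have := ENNReal.ofReal_le_ofReal hN3
    rw [ENNReal.ofReal_natCast, ENNReal.ofReal_mul hC2.le] at this
    rw [hl, ← mul_pow]
    gcongr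
  have hMs : ∀ t : ℝ, M ^ t = (n : ℝ≥0∞) ^ t * l ^ t := fun t =>
    ENNReal.mul_rpow_of_ne_top hnt hlt t
  have htarget : ENNReal.ofReal
      ((n : ℝ) ^ (-s) * Real.log n ^ ((((d + 1 : ℕ) : ℝ) - 1) * (1 - s))) =
      (n : ℝ≥0∞) ^ (-s) * l ^ (1 - s) := by
    rw [ENNReal.ofReal_mul (by positivity), ofReal_natCast_rpow hn0]
    congr 1
    push_cast
    rw [add_sub_cancel_right, Real.rpow_mul hlog.le, Real.rpow_natCast,
      ← ENNReal.ofReal_rpow_of_pos (by positivity), ENNReal.ofReal_pow hlog.le]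
  rw [htarget, ENNReal.coe_toNNReal hCt, K.highSum_le_lintegral (hsupp u hu)]
  set G := K.squareFunction s θ u with hG
  have hGm : Measurable G := K.measurable_squareFunction s θ u
  set H : Rd (d + 1) → ℝ≥0∞ := fun y => (∑' m, farWeight (d + 1) s c n N m y ^ q) ^ (1 / q) with hH
  have hHm : Measurable H :=
    (Measurable.tsum (L := SummationFilter.unconditional (Fin (d + 1) → ℕ))
      fun m => (measurable_farWeight s c n N m).pow_const q).pow_const _
  have hnear : ∫⁻ y in box (d + 1) R, G y ≤ V := by
    refine (K.lintegral_squareFunction_le hp s θ u R).trans ?_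
    calc _ ≤ 1 * V := by gcongr
      _ = V := one_mul V
  have hfar : ∫⁻ y in box (d + 1) R, G y * H y ≤ E * ((n : ℝ≥0∞) ^ (-s) * l ^ (1 - s)) := by
    refine (ENNReal.lintegral_mul_le_Lp_mul_Lq _ hconj hGm.aemeasurable hHm.aemeasurable).trans ?_
    have hGn : (∫⁻ y in box (d + 1) R, G y ^ p.toReal) ^ (1 / p.toReal) ≤ 1 := by
      refine le_trans ?_ hNu
      rw [K.triebelLizorkinNorm_eq, eLpNorm_eq_lintegral_rpow_enorm_toReal
        (one_pos.trans_le hp).ne' hpt]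
      refine ENNReal.rpow_le_rpow (setLIntegral_le_lintegral _ _) (by positivity)
    have hHn : ∀ y, H y ^ q = ∑' m, farWeight (d + 1) s c n N m y ^ q := fun y => by
      rw [hH, ← ENNReal.rpow_mul, one_div_mul_cancel hq0.ne', ENNReal.rpow_one]
    simp_rw [hHn]
    calc _ ≤ 1 * (C1 * (n : ℝ≥0∞) ^ (-(q - 1)) * ((N + 1 : ℕ) : ℝ≥0∞) ^ d *
          ((2 : ℝ≥0∞) ^ N) ^ (-(s * q - q + 1))) ^ (1 / q) := by
          gcongr
          exact hC1 n N hn0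
      _ ≤ (C1 * (n : ℝ≥0∞) ^ (-(q - 1)) * (ENNReal.ofReal C2 ^ d * l) *
          M ^ (-(s * q - q + 1))) ^ (1 / q) := by
          rw [one_mul]
          have hneg : ((2 : ℝ≥0∞) ^ N) ^ (-(s * q - q + 1)) ≤ M ^ (-(s * q - q + 1)) := by
            rw [ENNReal.rpow_neg, ENNReal.rpow_neg, ENNReal.inv_le_inv]
            refine ENNReal.rpow_le_rpow hM2 ?_
            rw [hβ]
            exact (mul_pos hq0 (by linarith)).le
          gcongr
      _ = E * ((n : ℝ≥0∞) ^ (-a) * l ^ (1 - a) * M ^ (-(s - a))) := by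
          rw [hqa, ENNReal.mul_rpow_of_nonneg _ _ (by linarith),
            ENNReal.mul_rpow_of_nonneg _ _ (by linarith),
            ENNReal.mul_rpow_of_nonneg _ _ (by linarith),
            ENNReal.mul_rpow_of_nonneg _ _ (by linarith), ← ENNReal.rpow_mul, ← ENNReal.rpow_mul,
            hE]
          have e1 : -(q - 1) * (1 - a) = -a := by linarith
          have e2 : -(s * q - q + 1) * (1 - a) = -(s - a) := by
            rw [hβ]
            linear_combination (-(s - a)) * hqq
          rw [e1, e2]
          ring
      _ = E * ((n : ℝ≥0∞) ^ (-s) * l ^ (1 - s)) := by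
          congr 1
          rw [hMs]
          calc _ = ((n : ℝ≥0∞) ^ (-a) * (n : ℝ≥0∞) ^ (-(s - a))) *
                (l ^ (1 - a) * l ^ (-(s - a))) := by ring
            _ = _ := by
              rw [← ENNReal.rpow_add _ _ hnz hnt, ← ENNReal.rpow_add _ _ hl0 hlt]
              congr 2 <;> ring
  calc _ ≤ ∫⁻ y in box (d + 1) R, (A * M ^ (1 - s) * (n : ℝ≥0∞)⁻¹ * G y + G y * H y) :=
        lintegral_mono fun y => K.tsum_high_le_near_add_far hs1.le hθ hθ1.le
          (fun m hm y => hA n m hn0 hm y) hM1 hq0 u y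
    _ = A * M ^ (1 - s) * (n : ℝ≥0∞)⁻¹ * (∫⁻ y in box (d + 1) R, G y) +
          ∫⁻ y in box (d + 1) R, G y * H y := by
        rw [lintegral_add_left (hGm.const_mul _), lintegral_const_mul _ hGm]
    _ ≤ A * M ^ (1 - s) * (n : ℝ≥0∞)⁻¹ * V + E * ((n : ℝ≥0∞) ^ (-s) * l ^ (1 - s)) := by
        gcongr
    _ = _ := by
        have e3 : M ^ (1 - s) * (n : ℝ≥0∞)⁻¹ = (n : ℝ≥0∞) ^ (-s) * l ^ (1 - s) := by
          rw [hMs, ← ENNReal.rpow_neg_one, mul_right_comm, ← ENNReal.rpow_add _ _ hnz hnt]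
          congr 2
          ring
        rw [mul_assoc (A : ℝ≥0∞), e3]
        ring

end LocalMeansKernel

end

end FrolovCubature

namespace FrolovCubature

noncomputable section

/-! ### Local means of oscillating bumps -/

/-- Taylor's estimate for complex-valued functions: the polynomial for `deriv G` is integrated term
by term, and the mean value inequality on the ball of radius `|h|` integrates the bound. The
factorial is not kept. -/
theorem exists_polynomial_norm_sub_le {D : ℝ} :
    ∀ (N : ℕ) (G : ℝ → ℂ), ContDiff ℝ N G → (∀ t, ‖iteratedDeriv N G t‖ ≤ D) → ∀ y : ℝ,
      ∃ c : ℕ → ℂ, ∀ h : ℝ,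
        ‖G (y + h) - ∑ k ∈ Finset.range N, c k * (h : ℂ) ^ k‖ ≤ D * |h| ^ N := by
  intro N
  induction N with
  | zero =>
    intro G _ hD y
    exact ⟨0, fun h => by simpa using hD (y + h)⟩
  | succ N ih =>
    intro G hG hD y
    have hG1 : ContDiff ℝ N (deriv G) := by
      have := (contDiff_succ_iff_deriv (n := N)).mp (by exact_mod_cast hG)
      exact this.2.2
    have hGd : Differentiable ℝ G := hG.differentiable (by simp)
    obtain ⟨c, hc⟩ := ih (deriv G) hG1 (fun t => by rw [← iteratedDeriv_succ']; exact hD t) y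
    refine ⟨fun k => k.casesOn (G y) fun k => c k / (k + 1), fun h => ?_⟩
    have hder : ∀ r : ℝ, HasDerivAt (fun r : ℝ => G (y + r) -
        ∑ k ∈ Finset.range (N + 1),
          (Nat.casesOn k (G y) fun k => c k / (k + 1) : ℂ) * (r : ℂ) ^ k)
        (deriv G (y + r) - ∑ k ∈ Finset.range N, c k * (r : ℂ) ^ k) r := by
      intro r
      simp_rw [Finset.sum_range_succ' _ N]
      refine HasDerivAt.sub ?_ ?_
      · exact (hGd (y + r)).hasDerivAt.comp_const_add y r
      · simp only [pow_zero, mul_one]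
        refine HasDerivAt.add_const _ (HasDerivAt.fun_sum fun k _ => ?_)
        have h1 := ((hasDerivAt_pow (k + 1) (r : ℂ)).comp_ofReal).const_mul (c k / ((k : ℂ) + 1))
        refine h1.congr_deriv ?_
        have : (k : ℂ) + 1 ≠ 0 := Nat.cast_add_one_ne_zero k
        push_cast [Nat.add_sub_cancel]
        field_simp
    have hmv := Convex.norm_image_sub_le_of_norm_hasDerivWithin_le
      (s := Metric.closedBall (0 : ℝ) |h|) (C := D * |h| ^ N) (x := 0) (y := h)
      (fun r _ => (hder r).hasDerivWithinAt) (fun r hr => ?_) (convex_closedBall _ _)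
      (by simp) (by simp)
    · have h0 : G (y + 0) - ∑ k ∈ Finset.range (N + 1),
          (Nat.casesOn k (G y) fun k => c k / (k + 1) : ℂ) * ((0 : ℝ) : ℂ) ^ k = 0 := by
        rw [Finset.sum_range_succ']
        simp
      rw [h0, sub_zero, sub_zero, Real.norm_eq_abs] at hmv
      rw [pow_succ, ← mul_assoc]
      exact hmv
    · refine (hc r).trans ?_
      have hD0 : 0 ≤ D := (norm_nonneg _).trans (hD 0)
      have hr' : |r| ≤ |h| := by simpa using hr
      gcongr

namespace LocalMeansKernel

variable {L : ℕ} (K : LocalMeansKernel L)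

/-- Up to a nonzero factor, the moments are the derivatives of the Fourier transform at the origin.
-/
theorem integral_psi1_mul_pow {k : ℕ} (hk : k ≤ L) : ∫ t : ℝ, K.psi1 t * (t : ℂ) ^ k = 0 := by
  have hint : ∀ n : ℕ, (n : ℕ∞) ≤ (L : ℕ∞) →
      Integrable fun x : ℝ => x ^ n • (K.psi1 : ℝ → ℂ) x := fun n _ => by
    refine (K.psi1.integrable_pow_mul volume n).mono' ?_ (.of_forall fun x => ?_)
    · exact ((continuous_id.pow n).smul K.psi1.continuous).aestronglyMeasurable
    · rw [norm_smul, norm_pow]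
  have h := congrFun (Real.iteratedDeriv_fourier hint (by exact_mod_cast hk)) 0
  rw [K.moments k hk, Real.fourier_eq] at h
  simp only [inner_zero_right, neg_zero, AddChar.map_zero_eq_one, one_smul, mul_pow, smul_eq_mul]
    at h
  simp_rw [mul_assoc _ ((_ : ℂ) ^ k) _] at h
  rw [integral_const_mul] at h
  rcases mul_eq_zero.mp h.symm with h0 | h0
  · simp [Real.pi_ne_zero] at h0
  · rw [← h0]
    exact integral_congr_ae (.of_forall fun t => mul_comm _ _)

theorem integral_dilate_succ_mul (a : ℕ) (x : ℝ) (h : ℝ → ℂ) :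
    ∫ y, K.dilate (a + 1) (x - y) * h y = ∫ t, K.psi1 t * h (x + -((2 : ℝ) ^ a)⁻¹ * t) := by
  have h1 := integral_sub_left_eq_self (fun y => K.dilate (a + 1) y * h (x - y)) volume x
  simp only [sub_sub_cancel] at h1
  have h2 := Measure.integral_comp_mul_left
    (fun t => K.psi1 t * h (x + -((2 : ℝ) ^ a)⁻¹ * t)) ((2 : ℝ) ^ a)
  rw [abs_of_pos (by positivity)] at h2
  rw [h1]
  have h3 : (2 : ℝ) ^ a ≠ 0 := by positivity
  calc _ = ∫ t : ℝ, (2 : ℂ) ^ a * (K.psi1 ((2 : ℝ) ^ a * t) *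
        h (x + -((2 : ℝ) ^ a)⁻¹ * ((2 : ℝ) ^ a * t))) := by
        congr 1
        ext t
        rw [neg_mul, inv_mul_cancel_left₀ h3, ← sub_eq_add_neg, dilate, mul_assoc]
    _ = _ := by
        rw [integral_const_mul, h2, Complex.real_smul, ← mul_assoc]
        push_cast
        rw [mul_inv_cancel₀ (pow_ne_zero _ two_ne_zero), one_mul]

/-- The vanishing moments allow subtraction of the Taylor polynomial of degree `L` at `x`; the
remainder on the scale `2^{-a}` gains `2^{-a(L+1)}`. -/
theorem exists_norm_integral_dilate_le_of_iteratedDeriv : ∃ C : ℝ, 0 ≤ C ∧ ∀ (a : ℕ) (x D : ℝ)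
    (h : ℝ → ℂ), ContDiff ℝ ((L + 1 : ℕ) : WithTop ℕ∞) h → HasCompactSupport h →
      (∀ t, ‖iteratedDeriv (L + 1) h t‖ ≤ D) →
      ‖∫ y, K.dilate (a + 1) (x - y) * h y‖ ≤ C * D * (((2 : ℝ) ^ a)⁻¹) ^ (L + 1) := by
  refine ⟨∫ t : ℝ, ‖t‖ ^ (L + 1) * ‖K.psi1 t‖, integral_nonneg fun t => by positivity,
    fun a x D h hh hhc hD => ?_⟩
  obtain ⟨c, hc⟩ := exists_polynomial_norm_sub_le (L + 1) h hh hD x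
  rw [K.integral_dilate_succ_mul]
  set r : ℝ := -((2 : ℝ) ^ a)⁻¹ with hr
  have hterm : ∀ k : ℕ, Integrable fun t : ℝ => K.psi1 t * (c k * ((r * t : ℝ) : ℂ) ^ k) := by
    intro k
    refine ((K.psi1.integrable_pow_mul volume k).const_mul (‖c k‖ * |r| ^ k)).mono' ?_
      (.of_forall fun t => le_of_eq ?_)
    · exact Continuous.aestronglyMeasurable (K.psi1.continuous.mul (by fun_prop))
    · rw [norm_mul, norm_mul, norm_pow, Complex.norm_real, norm_mul, mul_pow, Real.norm_eq_abs r]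
      ring
  have hpoly : ∫ t : ℝ, ∑ k ∈ Finset.range (L + 1),
      K.psi1 t * (c k * ((r * t : ℝ) : ℂ) ^ k) = 0 := by
    rw [integral_finsetSum _ fun k _ => hterm k]
    refine Finset.sum_eq_zero fun k hk => ?_
    have : ∀ t : ℝ, K.psi1 t * (c k * ((r * t : ℝ) : ℂ) ^ k) =
        c k * (r : ℂ) ^ k * (K.psi1 t * (t : ℂ) ^ k) := fun t => by push_cast; ring
    simp_rw [this]
    rw [integral_const_mul, K.integral_psi1_mul_pow (by simpa [Nat.lt_succ_iff] using hk), mul_zero]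
  have hint : Integrable fun t : ℝ => K.psi1 t * h (x + r * t) := by
    refine Continuous.integrable_of_hasCompactSupport
      (K.psi1.continuous.mul (hh.continuous.comp (by fun_prop))) ?_
    exact K.hasCompactSupport_psi1.mul_right
  have hsub : ∫ t, K.psi1 t * h (x + r * t) = ∫ t : ℝ, K.psi1 t *
      (h (x + r * t) - ∑ k ∈ Finset.range (L + 1), c k * ((r * t : ℝ) : ℂ) ^ k) := by
    simp_rw [mul_sub, Finset.mul_sum]
    rw [integral_sub hint (integrable_finsetSum _ fun k _ => hterm k), hpoly, sub_zero]
  rw [hsub, mul_assoc, ← integral_mul_const]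
  refine norm_integral_le_of_norm_le ((K.psi1.integrable_pow_mul volume (L + 1)).mul_const _)
    (.of_forall fun t => ?_)
  rw [norm_mul]
  calc _ ≤ ‖K.psi1 t‖ * (D * |r * t| ^ (L + 1)) := by gcongr; exact hc (r * t)
    _ = _ := by
      rw [abs_mul, mul_pow, hr, abs_neg, abs_of_pos (by positivity), Real.norm_eq_abs]
      ring

theorem exists_norm_integral_dilate_le : ∃ C : ℝ, 0 ≤ C ∧ ∀ (a : ℕ) (x : ℝ) (h : ℝ → ℂ),
    (∀ t, ‖h t‖ ≤ 1) → ‖∫ y, K.dilate a (x - y) * h y‖ ≤ C := by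
  refine ⟨max (∫ t, ‖K.psi0 t‖) (∫ t, ‖K.psi1 t‖),
    le_max_of_le_left (integral_nonneg fun t => norm_nonneg _), fun a x h hh => ?_⟩
  cases a with
  | zero =>
    refine le_max_of_le_left ?_
    rw [← integral_sub_left_eq_self (fun y => ‖K.psi0 y‖) volume x]
    refine norm_integral_le_of_norm_le (K.psi0.integrable.norm.comp_sub_left x)
      (.of_forall fun t => ?_)
    rw [norm_mul]
    exact mul_le_of_le_one_right (norm_nonneg _) (hh t)
  | succ a =>
    refine le_max_of_le_right ?_
    rw [K.integral_dilate_succ_mul]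
    refine norm_integral_le_of_norm_le K.psi1.integrable.norm (.of_forall fun t => ?_)
    rw [norm_mul]
    exact mul_le_of_le_one_right (norm_nonneg _) (hh _)

end LocalMeansKernel

end

end FrolovCubature

/-! ### Sums of disjoint bumps and their one-dimensional local means -/

namespace FrolovCubature

noncomputable section

/-- Integer translates of `(0, 1)` are disjoint, so only `k = ⌊t⌋₊` can contribute. For negative `t`
the natural floor is `0` and `g t = 0`, so the formula persists. Bounds on the sum are thus uniform
in the number of bumps. -/
theorem sum_comp_sub_eq {g : ℝ → ℂ} (h0 : ∀ t, t ∉ Set.Ioo (0 : ℝ) 1 → g t = 0) (T : Finset ℕ)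
    (t : ℝ) : ∑ k ∈ T, g (t - k) = if ⌊t⌋₊ ∈ T then g (t - ⌊t⌋₊) else 0 := by
  have h1 : ∀ k : ℕ, ⌊t⌋₊ ≠ k → g (t - k) = 0 := by
    intro k hk
    refine h0 _ fun h => hk ?_
    have hk0 : (0 : ℝ) ≤ k := Nat.cast_nonneg k
    rw [Nat.floor_eq_iff (by linarith [h.1])]
    constructor <;> linarith [h.1, h.2]
  rw [← Finset.sum_ite_eq T ⌊t⌋₊ fun k => g (t - k)]
  exact Finset.sum_congr rfl fun k _ => by split_ifs with h; exacts [rfl, h1 k h]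

theorem norm_sum_comp_sub_le {g : ℝ → ℂ} (h0 : ∀ t, t ∉ Set.Ioo (0 : ℝ) 1 → g t = 0) {E : ℝ}
    (hE : ∀ t, ‖g t‖ ≤ E) (T : Finset ℕ) (t : ℝ) : ‖∑ k ∈ T, g (t - k)‖ ≤ E := by
  rw [sum_comp_sub_eq h0]
  split_ifs
  · exact hE _
  · rw [norm_zero]
    exact (norm_nonneg _).trans (hE 0)

/-- A smooth bump function supported in `[1/4, 3/4]`. -/
def unitBump : ContDiffBump (1 / 2 : ℝ) := ⟨1 / 8, 1 / 4, by norm_num, by norm_num⟩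

theorem contDiff_unitBump : ContDiff ℝ ((⊤ : ℕ∞) : WithTop ℕ∞) fun t => (unitBump t : ℂ) :=
  Complex.ofRealCLM.contDiff.comp unitBump.contDiff

theorem tsupport_unitBump : tsupport (fun t => (unitBump t : ℂ)) ⊆ Set.Ioo 0 1 := by
  have h1 : tsupport (fun t => (unitBump t : ℂ)) ⊆ tsupport unitBump :=
    closure_mono fun z hz h0 => hz (by change (unitBump z : ℂ) = 0; rw [h0, Complex.ofReal_zero])
  refine h1.trans fun t ht => ?_
  rw [unitBump.tsupport_eq, Real.closedBall_eq_Icc] at ht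
  change t ∈ Set.Icc (1 / 2 - 1 / 4 : ℝ) (1 / 2 + 1 / 4) at ht
  constructor <;> linarith [ht.1, ht.2]

theorem iteratedDeriv_unitBump_eq_zero (N : ℕ) {t : ℝ} (ht : t ∉ Set.Ioo (0 : ℝ) 1) :
    iteratedDeriv N (fun t => (unitBump t : ℂ)) t = 0 := by
  have h : t ∉ tsupport (iteratedFDeriv ℝ N fun t => (unitBump t : ℂ)) :=
    fun h => ht (tsupport_unitBump (tsupport_iteratedFDeriv_subset N h))
  rw [iteratedDeriv_eq_iteratedFDeriv, image_eq_zero_of_notMem_tsupport h]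
  rfl

theorem exists_norm_iteratedDeriv_unitBump_le (N : ℕ) : ∃ E : ℝ, ∀ t,
    ‖iteratedDeriv N (fun t => (unitBump t : ℂ)) t‖ ≤ E := by
  refine (contDiff_unitBump.continuous_iteratedDeriv N
    (by exact_mod_cast le_top)).bounded_above_of_compact_support ?_
  exact HasCompactSupport.intro isCompact_Icc fun t ht =>
    iteratedDeriv_unitBump_eq_zero N fun h => ht (Set.Ioo_subset_Icc_self h)

/-- The sum over `k ∈ T` of bumps supported in `2⁻ʲ (k, k + 1)`. -/
def bumpSum (j : ℕ) (T : Finset ℕ) (t : ℝ) : ℂ := ∑ k ∈ T, (unitBump ((2 : ℝ) ^ j * t - k) : ℂ)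

theorem contDiff_bumpSum (j : ℕ) (T : Finset ℕ) :
    ContDiff ℝ ((⊤ : ℕ∞) : WithTop ℕ∞) (bumpSum j T) :=
  ContDiff.sum fun k _ => contDiff_unitBump.comp (by fun_prop)

theorem unitBump_eq_zero {t : ℝ} (ht : t ∉ Set.Ioo (0 : ℝ) 1) : (unitBump t : ℂ) = 0 :=
  iteratedDeriv_unitBump_eq_zero 0 ht

theorem bumpSum_eq_zero {j : ℕ} {T : Finset ℕ} {t : ℝ} (h : ⌊(2 : ℝ) ^ j * t⌋₊ ∉ T) :
    bumpSum j T t = 0 := by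
  have h1 := sum_comp_sub_eq (fun t => unitBump_eq_zero (t := t)) T ((2 : ℝ) ^ j * t)
  rwa [if_neg h] at h1

theorem bumpSum_eq_zero_of_notMem {j : ℕ} {T : Finset ℕ} (hT : T ⊆ Finset.range (2 ^ j)) {t : ℝ}
    (ht : t ∉ Set.Icc (0 : ℝ) 1) : bumpSum j T t = 0 := by
  refine Finset.sum_eq_zero fun k hk => unitBump_eq_zero fun h => ht ?_
  have hk1 : (k : ℝ) + 1 ≤ 2 ^ j := by exact_mod_cast Finset.mem_range.mp (hT hk)
  have hk0 : (0 : ℝ) ≤ k := Nat.cast_nonneg k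
  have hp : (0 : ℝ) < 2 ^ j := by positivity
  constructor
  · by_contra hc
    nlinarith [h.1, h.2, mul_pos hp (neg_pos.mpr (not_le.mp hc))]
  · by_contra hc
    nlinarith [h.1, h.2, mul_pos hp (sub_pos.mpr (not_le.mp hc))]

theorem hasCompactSupport_bumpSum {j : ℕ} {T : Finset ℕ} (hT : T ⊆ Finset.range (2 ^ j)) :
    HasCompactSupport (bumpSum j T) :=
  HasCompactSupport.intro isCompact_Icc fun _ ht => bumpSum_eq_zero_of_notMem hT ht

theorem norm_bumpSum_le (j : ℕ) (T : Finset ℕ) (t : ℝ) : ‖bumpSum j T t‖ ≤ 1 := by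
  refine norm_sum_comp_sub_le (g := fun t => (unitBump t : ℂ))
    (fun t => unitBump_eq_zero (t := t)) (fun t => ?_) T _
  rw [Complex.norm_real, Real.norm_eq_abs, abs_of_nonneg unitBump.nonneg]
  exact unitBump.le_one

theorem exists_norm_iteratedDeriv_bumpSum_le (N : ℕ) : ∃ E : ℝ, 0 ≤ E ∧
    ∀ (j : ℕ) (T : Finset ℕ) (t : ℝ),
      ‖iteratedDeriv N (bumpSum j T) t‖ ≤ E * ((2 : ℝ) ^ j) ^ N := by
  obtain ⟨E, hE⟩ := exists_norm_iteratedDeriv_unitBump_le N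
  refine ⟨E, (norm_nonneg _).trans (hE 0), fun j T t => ?_⟩
  have hb : ∀ k : ℕ, ContDiff ℝ N fun t : ℝ => (unitBump (t - k) : ℂ) := fun k =>
    (contDiff_unitBump.comp (by fun_prop)).of_le (by exact_mod_cast le_top)
  have h1 : bumpSum j T = fun t => (fun r : ℝ => ∑ k ∈ T, (unitBump (r - k) : ℂ)) (2 ^ j * t) := rfl
  rw [h1, iteratedDeriv_comp_const_smul (f := fun r : ℝ => ∑ k ∈ T, (unitBump (r - k) : ℂ))
    (ContDiff.sum fun k _ => hb k)]
  simp only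
  rw [iteratedDeriv_fun_sum fun k _ => (hb k).contDiffAt, norm_smul, norm_pow, norm_pow,
    Real.norm_ofNat, mul_comm]
  gcongr
  simp_rw [fun k : ℕ => iteratedDeriv_comp_sub_const N (fun t => (unitBump t : ℂ)) (k : ℝ)]
  exact norm_sum_comp_sub_le (fun t => iteratedDeriv_unitBump_eq_zero N) hE T _

theorem integral_bumpSum (j : ℕ) (T : Finset ℕ) :
    ∫ t, bumpSum j T t = T.card * ((2 : ℂ) ^ j)⁻¹ * (∫ t, unitBump t : ℝ) := by
  have hi : Integrable fun t => (unitBump t : ℂ) := unitBump.integrable.ofReal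
  unfold bumpSum
  rw [integral_finsetSum T (f := fun (k : ℕ) (t : ℝ) => (unitBump ((2 : ℝ) ^ j * t - k) : ℂ))
    fun k _ => (hi.comp_sub_right (k : ℝ)).comp_mul_left' (by positivity)]
  have h1 : ∀ k : ℕ, ∫ t, (unitBump ((2 : ℝ) ^ j * t - k) : ℂ) =
      ((2 : ℂ) ^ j)⁻¹ * (∫ t, unitBump t : ℝ) := by
    intro k
    rw [Measure.integral_comp_mul_left (fun t => (unitBump (t - k) : ℂ)),
      integral_sub_right_eq_self (fun t => (unitBump t : ℂ)), integral_complex_ofReal,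
      abs_of_pos (by positivity), Complex.real_smul]
    push_cast
    rfl
  simp_rw [h1]
  rw [Finset.sum_const, nsmul_eq_mul, mul_assoc]

namespace LocalMeansKernel

variable {L : ℕ} (K : LocalMeansKernel L)

theorem exists_norm_integral_dilate_bumpSum_le {s : ℝ} (hs : 0 < s) (hL : s < (L : ℝ) + 1) :
    ∃ C ρ : ℝ, 0 ≤ C ∧ 0 < ρ ∧ ρ < 1 ∧ ∀ (a j : ℕ) (T : Finset ℕ), T ⊆ Finset.range (2 ^ j) →
      ∀ x : ℝ, (2 : ℝ) ^ (s * a) * ‖∫ y, K.dilate a (x - y) * bumpSum j T y‖ ≤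
        C * (2 : ℝ) ^ (s * j) * ρ ^ ((j - a) + (a - j)) := by
  obtain ⟨A, hA, hAb⟩ := K.exists_norm_integral_dilate_le
  obtain ⟨B, hB, hBb⟩ := K.exists_norm_integral_dilate_le_of_iteratedDeriv
  obtain ⟨E, hE, hEb⟩ := exists_norm_iteratedDeriv_bumpSum_le (L + 1)
  -- The first entry is the gain per scale for `a ≤ j`, where the sup bound suffices and `s > 0`
  -- helps; the second is the gain for `a > j`, where the cancellation of order `L + 1` beats the
  -- growth `2^{s a}`. The truncated differences in the exponent of `ρ` add up to `|j - a|`.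
  set ρ : ℝ := max ((2 : ℝ) ^ (-s)) ((2 : ℝ) ^ (s - ((L + 1 : ℕ) : ℝ))) with hρ
  have hρ0 : 0 < ρ := lt_max_of_lt_left (by positivity)
  have h2 : (1 : ℝ) < 2 := one_lt_two
  refine ⟨A + B * E * 2 ^ (L + 1), ρ, by positivity, hρ0, ?_, fun a j T hT x => ?_⟩
  · refine max_lt (Real.rpow_lt_one_of_one_lt_of_neg h2 (by linarith))
      (Real.rpow_lt_one_of_one_lt_of_neg h2 ?_)
    push_cast
    linarith
  have hBE : 0 ≤ B * E * 2 ^ (L + 1) := by positivity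
  rcases le_or_gt a j with haj | haj
  · obtain ⟨b, rfl⟩ := Nat.exists_eq_add_of_le haj
    have e1 : (a + b - a) + (a - (a + b)) = b := by omega
    have e2 : (2 : ℝ) ^ (s * (a : ℕ)) = 2 ^ (s * ((a + b : ℕ) : ℝ)) * ((2 : ℝ) ^ (-s)) ^ b := by
      rw [← Real.rpow_natCast, ← Real.rpow_mul two_pos.le, ← Real.rpow_add two_pos]
      congr 1
      push_cast
      ring
    rw [e1, e2]
    calc _ ≤ (2 : ℝ) ^ (s * ((a + b : ℕ) : ℝ)) * ρ ^ b * A := by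
          gcongr
          · exact le_max_left _ _
          · exact hAb a x _ (norm_bumpSum_le _ T)
      _ = A * (2 : ℝ) ^ (s * ((a + b : ℕ) : ℝ)) * ρ ^ b := by ring
      _ ≤ _ := by gcongr; linarith
  · obtain ⟨b, rfl⟩ := Nat.exists_eq_add_of_lt haj
    have e1 : (j - (j + b + 1)) + (j + b + 1 - j) = b + 1 := by omega
    have h3 := hBb (j + b) x _ _ ((contDiff_bumpSum j T).of_le (by exact_mod_cast le_top))
      (hasCompactSupport_bumpSum hT) (hEb j T)
    have e2 : (2 : ℝ) ^ (s * (j + b + 1 : ℕ)) *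
        (B * (E * ((2 : ℝ) ^ j) ^ (L + 1)) * (((2 : ℝ) ^ (j + b))⁻¹) ^ (L + 1)) =
        B * E * 2 ^ (L + 1) * (2 : ℝ) ^ (s * j) *
          ((2 : ℝ) ^ (s - ((L + 1 : ℕ) : ℝ))) ^ (b + 1) := by
      have e3 : (2 : ℝ) ^ (s * (j + b + 1 : ℕ)) = 2 ^ (s * j) * ((2 : ℝ) ^ s) ^ (b + 1) := by
        rw [← Real.rpow_natCast ((2 : ℝ) ^ s), ← Real.rpow_mul two_pos.le, ← Real.rpow_add two_pos]
        congr 1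
        push_cast
        ring
      have e4 : ((2 : ℝ) ^ (L + 1)) ^ (b + 1) = 2 ^ (L + 1) * ((2 : ℝ) ^ b) ^ (L + 1) := by ring
      rw [e3, Real.rpow_sub two_pos, Real.rpow_natCast, pow_add (2 : ℝ) j b, div_pow, e4]
      have hj : (2 : ℝ) ^ j ≠ 0 := by positivity
      have hb : (2 : ℝ) ^ b ≠ 0 := by positivity
      generalize (2 : ℝ) ^ j = P at hj
      generalize (2 : ℝ) ^ b = Q at hb
      rw [inv_pow, mul_pow]
      field_simp
    rw [e1]
    calc _ ≤ _ := mul_le_mul_of_nonneg_left h3 (by positivity)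
      _ ≤ B * E * 2 ^ (L + 1) * (2 : ℝ) ^ (s * j) * ρ ^ (b + 1) := by
          rw [e2]
          gcongr
          exact le_max_right _ _
      _ ≤ _ := by gcongr; linarith

end LocalMeansKernel

end

end FrolovCubature

namespace FrolovCubature

noncomputable section

/-! ### Norms of tensor products of bumps -/

theorem eLpNorm_le_mul_volume_box {d : ℕ} {E : Type*} [TopologicalSpace E] [ENormedAddMonoid E]
    {f : Rd d → E} {R : ℝ} (hf : ∀ x, x ∉ box d R → f x = 0) {b : ℝ≥0∞} (hb : ∀ x, ‖f x‖ₑ ≤ b)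
    (p : ℝ≥0∞) : eLpNorm f p volume ≤ b * volume (box d R) ^ (p⁻¹).toReal := by
  have hs : Function.support f ⊆ box d R := fun x hx => by
    by_contra h
    exact hx (hf x h)
  rw [← eLpNorm_restrict_eq_of_support_subset hs, ENNReal.toReal_inv]
  refine (eLpNorm_le_of_ae_enorm_bound (C := b) (.of_forall hb)).trans (le_of_eq ?_)
  rw [Measure.restrict_apply_univ, smul_eq_mul]

theorem tsum_pow_dist_le {r : ℝ≥0∞} (hr : r ≤ 1) (j : ℕ) :
    ∑' a : ℕ, r ^ ((j - a) + (a - j)) ≤ 2 * (1 - r)⁻¹ := by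
  rw [← (ENNReal.summable (f := fun a => r ^ ((j - (a + j)) + (a + j - j)))).sum_add_tsum_nat_add'
    (f := fun a => r ^ ((j - a) + (a - j))), two_mul]
  refine add_le_add ?_ ?_
  · rw [← ENNReal.tsum_geometric]
    refine le_trans ?_ (ENNReal.sum_le_tsum (Finset.range j))
    rw [← Finset.sum_range_reflect]
    refine Finset.sum_le_sum fun a ha => ?_
    rw [Finset.mem_range] at ha
    exact pow_le_pow_right_of_le_one' hr (by omega)
  · rw [← ENNReal.tsum_geometric]
    refine ENNReal.tsum_le_tsum fun a => le_of_eq ?_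
    congr 1
    omega

theorem weight_eq_prod {d : ℕ} (s : ℝ) (m : Fin d → ℕ) :
    weight s m = ∏ i, ENNReal.ofReal ((2 : ℝ) ^ (s * m i)) := by
  rw [weight, Finset.mul_sum, Real.rpow_sum_of_pos two_pos,
    ENNReal.ofReal_prod_of_nonneg fun _ _ => by positivity]

theorem weight_ne_zero {d : ℕ} (s : ℝ) (m : Fin d → ℕ) : weight s m ≠ 0 :=
  (ENNReal.ofReal_pos.mpr (by positivity)).ne'

theorem weight_ne_top {d : ℕ} (s : ℝ) (m : Fin d → ℕ) : weight s m ≠ ∞ := ENNReal.ofReal_ne_top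

/-- The function `c ∏ᵢ bumpSum (j i) (T i) (x i)`. -/
def tensorBump {d : ℕ} (c : ℂ) {j : Fin d → ℕ} {T : Fin d → Finset ℕ}
    (hT : ∀ i, T i ⊆ Finset.range (2 ^ j i)) : 𝓢(Rd d, ℂ) :=
  c • (hasCompactSupport_prod_coord fun i => hasCompactSupport_bumpSum (hT i)).toSchwartzMap
    (contDiff_prod_coord fun i => contDiff_bumpSum (j i) (T i))

theorem tensorBump_apply {d : ℕ} (c : ℂ) {j : Fin d → ℕ} {T : Fin d → Finset ℕ}
    (hT : ∀ i, T i ⊆ Finset.range (2 ^ j i)) (x : Rd d) :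
    tensorBump c hT x = c * ∏ i, bumpSum (j i) (T i) (x i) := rfl

theorem tensorBump_eq_zero {d : ℕ} (c : ℂ) {j : Fin d → ℕ} {T : Fin d → Finset ℕ}
    (hT : ∀ i, T i ⊆ Finset.range (2 ^ j i)) {x : Rd d} (hx : x ∉ unitCube d) :
    tensorBump c hT x = 0 := by
  simp only [unitCube, Set.mem_ofPred_eq, not_forall] at hx
  obtain ⟨i, hi⟩ := hx
  rw [tensorBump_apply, Finset.prod_eq_zero (Finset.mem_univ i)
    (bumpSum_eq_zero_of_notMem (hT i) hi), mul_zero]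

theorem integral_tensorBump {d : ℕ} (c : ℂ) {j : Fin d → ℕ} {T : Fin d → Finset ℕ}
    (hT : ∀ i, T i ⊆ Finset.range (2 ^ j i)) :
    ∫ x in unitCube d, tensorBump c hT x =
      c * ∏ i, ((T i).card * ((2 : ℂ) ^ j i)⁻¹ * (∫ t, unitBump t : ℝ)) := by
  rw [setIntegral_eq_integral_of_forall_compl_eq_zero fun x hx => tensorBump_eq_zero c hT hx]
  simp_rw [tensorBump_apply, ← integral_bumpSum]
  rw [integral_const_mul, integral_prod_coord fun i => bumpSum (j i) (T i)]

theorem toTemperedDistribution_apply {d : ℕ} (g φ : 𝓢(Rd d, ℂ)) :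
    toTemperedDistributionCLM (Rd d) ℂ volume g φ = ∫ x, φ x * g x :=
  toTemperedDistributionCLM_apply_apply volume g φ

theorem enorm_prod_eq {ι : Type*} (s : Finset ι) (f : ι → ℂ) : ‖∏ i ∈ s, f i‖ₑ = ∏ i ∈ s, ‖f i‖ₑ := by
  simp_rw [← ofReal_norm, norm_prod]
  exact ENNReal.ofReal_prod_of_nonneg fun _ _ => norm_nonneg _

theorem dsupport_toTemperedDistribution_subset {d : ℕ} {g : 𝓢(Rd d, ℂ)} {s : Set (Rd d)}
    (hs : IsClosed s) (hg : ∀ x, x ∉ s → g x = 0) :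
    Distribution.dsupport (toTemperedDistributionCLM (Rd d) ℂ volume g) ⊆ s := by
  intro x hx
  by_contra hxs
  refine (Distribution.notMem_dsupport_iff x).mpr ⟨sᶜ, fun φ hφ => ?_, hs.isOpen_compl, hxs⟩ hx
  rw [toTemperedDistribution_apply]
  refine integral_eq_zero_of_ae (.of_forall fun y => ?_)
  by_cases hy : y ∈ s
  · have : φ y = 0 := image_eq_zero_of_notMem_tsupport fun h => hφ h hy
    simp [this]
  · simp [hg y hy]

/-- `cubatureError` is an infimum over representing functions, so a lower bound needs the
representative to be unique. -/
theorem Represents.eq_of_toTemperedDistribution {d : ℕ} {f : Rd d →ᵇ ℂ} {g : 𝓢(Rd d, ℂ)}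
    (h : Represents f (toTemperedDistributionCLM (Rd d) ℂ volume g)) : (f : Rd d → ℂ) = g := by
  have hae : ∀ᵐ x : Rd d, f x = g x := by
    refine ae_eq_of_integral_contDiff_smul_eq f.continuous.locallyIntegrable
      g.continuous.locallyIntegrable fun φ hφ hφc => ?_
    have hsm : ContDiff ℝ ((⊤ : ℕ∞) : WithTop ℕ∞) fun y => (φ y : ℂ) :=
      Complex.ofRealCLM.contDiff.comp hφ
    have hcs : HasCompactSupport fun y => (φ y : ℂ) := hφc.comp_left Complex.ofReal_zero
    have h1 := h (hcs.toSchwartzMap hsm)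
    rw [toTemperedDistribution_apply] at h1
    simp_rw [Complex.real_smul]
    exact h1.symm
  exact Continuous.ae_eq_iff_eq (volume : Measure (Rd d)) f.continuous g.continuous |>.mp hae

namespace LocalMeansKernel

variable {L d : ℕ} (K : LocalMeansKernel L)

theorem conv_tensorBump (c : ℂ) {j : Fin d → ℕ} {T : Fin d → Finset ℕ}
    (hT : ∀ i, T i ⊆ Finset.range (2 ^ j i)) (m : Fin d → ℕ) (x : Rd d) :
    K.conv (toTemperedDistributionCLM (Rd d) ℂ volume (tensorBump c hT)) m x =
      c * ∏ i, ∫ t, K.dilate (m i) (x i - t) * bumpSum (j i) (T i) t := by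
  rw [conv, toTemperedDistribution_apply,
    ← integral_prod_coord fun i t => K.dilate (m i) (x i - t) * bumpSum (j i) (T i) t,
    ← integral_const_mul]
  congr 1
  ext y
  change (∏ i, K.dilate (m i) (x i - y i)) * (c * ∏ i, bumpSum (j i) (T i) (y i)) = _
  rw [Finset.prod_mul_distrib]
  ring

theorem norm_le_of_weight_mul_enorm_conv_le {u : 𝓢'(Rd d, ℂ)} {R : ℝ}
    (hu : ∀ m x, x ∉ box d R → K.conv u m x = 0) {s θ : ℝ} (hθ : 0 < θ) {B : (Fin d → ℕ) → ℝ≥0∞}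
    (hB : ∀ m x, weight s m * ‖K.conv u m x‖ₑ ≤ B m) (p : ℝ≥0∞) :
    K.besovNorm s p θ u ≤ (∑' m, B m ^ θ) ^ (1 / θ) * volume (box d R) ^ (p⁻¹).toReal ∧
      K.triebelLizorkinNorm s p θ u ≤
        (∑' m, B m ^ θ) ^ (1 / θ) * volume (box d R) ^ (p⁻¹).toReal := by
  constructor
  · have h1 : ∀ m, weight s m * eLpNorm (K.conv u m) p volume ≤
        B m * volume (box d R) ^ (p⁻¹).toReal := by
      intro m
      have h2 := eLpNorm_le_mul_volume_box (hu m) (b := (weight s m)⁻¹ * B m) (fun x => by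
        rw [mul_comm, ← div_eq_mul_inv, ENNReal.le_div_iff_mul_le (.inl (weight_ne_zero s m))
          (.inl (weight_ne_top s m)), mul_comm]
        exact hB m x) p
      refine (mul_le_mul_right h2 (weight s m)).trans (le_of_eq ?_)
      rw [← mul_assoc, ← mul_assoc, ENNReal.mul_inv_cancel (weight_ne_zero s m)
        (weight_ne_top s m), one_mul]
    calc K.besovNorm s p θ u ≤
        (∑' m, (B m * volume (box d R) ^ (p⁻¹).toReal) ^ θ) ^ (1 / θ) := by
          exact ENNReal.rpow_le_rpow (ENNReal.tsum_le_tsum fun m =>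
            ENNReal.rpow_le_rpow (h1 m) hθ.le) (by positivity)
      _ = _ := by
          simp_rw [ENNReal.mul_rpow_of_nonneg _ _ hθ.le]
          rw [ENNReal.tsum_mul_right, ENNReal.mul_rpow_of_nonneg _ _ (by positivity),
            ← ENNReal.rpow_mul _ θ, mul_one_div_cancel hθ.ne', ENNReal.rpow_one]
  · refine eLpNorm_le_mul_volume_box (fun x hx => ?_) (fun x => ?_) p
    · simp_rw [hu _ x hx, enorm_zero, mul_zero, ENNReal.zero_rpow_of_pos hθ, tsum_zero]
      exact ENNReal.zero_rpow_of_pos (by positivity)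
    · rw [enorm_eq_self]
      gcongr with m
      exact hB m x

/-- The weighted local means are bounded by `2^{s|j|_1} |c| ∏ ρ^{|j_i - m_i|}` up to a constant and
live in a fixed box. The sum of the `θ`-th powers over `m` factors into geometric series bounded
independently of `j`, which handles both norms and every `p` at once. -/
theorem exists_norm_tensorBump_le {s θ : ℝ} (hs : 0 < s) (hL : s < (L : ℝ) + 1) (hθ : 0 < θ)
    (p : ℝ≥0∞) : ∃ M : ℝ≥0, ∀ (c : ℂ) (j : Fin d → ℕ) (T : Fin d → Finset ℕ)
      (hT : ∀ i, T i ⊆ Finset.range (2 ^ j i)),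
      K.besovNorm s p θ (toTemperedDistributionCLM (Rd d) ℂ volume (tensorBump c hT)) ≤
          M * (weight s j * ‖c‖ₑ) ∧
        K.triebelLizorkinNorm s p θ (toTemperedDistributionCLM (Rd d) ℂ volume (tensorBump c hT)) ≤
          M * (weight s j * ‖c‖ₑ) := by
  obtain ⟨C, ρ, hC, hρ0, hρ1, hb⟩ := K.exists_norm_integral_dilate_bumpSum_le hs hL
  obtain ⟨R, hR, hsupp⟩ := K.exists_conv_support d
  set r : ℝ≥0∞ := ENNReal.ofReal ρ with hr
  have hrθ : r ^ θ < 1 :=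
    ENNReal.rpow_lt_one (by rwa [hr, ENNReal.ofReal_lt_one]) hθ
  set V := volume (box d R) ^ (p⁻¹).toReal with hV
  have hVt : V ≠ ∞ :=
    ENNReal.rpow_ne_top_of_nonneg ENNReal.toReal_nonneg (isCompact_box d R).measure_lt_top.ne
  set G : ℝ≥0∞ := ((2 * (1 - r ^ θ)⁻¹) ^ d) ^ (1 / θ) with hG
  have hGt : G ≠ ∞ := by
    refine ENNReal.rpow_ne_top_of_nonneg (by positivity) (ENNReal.pow_ne_top ?_)
    exact ENNReal.mul_ne_top ENNReal.ofNat_ne_top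
      (ENNReal.inv_ne_top.mpr (tsub_pos_of_lt hrθ).ne')
  have hMt : ENNReal.ofReal C ^ d * G * V ≠ ∞ :=
    ENNReal.mul_ne_top (ENNReal.mul_ne_top (ENNReal.pow_ne_top ENNReal.ofReal_ne_top) hGt) hVt
  refine ⟨(ENNReal.ofReal C ^ d * G * V).toNNReal, fun c j T hT => ?_⟩
  set W : ℝ≥0∞ := ENNReal.ofReal C ^ d * (weight s j * ‖c‖ₑ) with hW
  have hB : ∀ m x, weight s m * ‖K.conv (toTemperedDistributionCLM (Rd d) ℂ volume
      (tensorBump c hT)) m x‖ₑ ≤ W * ∏ i, r ^ ((j i - m i) + (m i - j i)) := by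
    intro m x
    have h1 : ∀ i, ENNReal.ofReal ((2 : ℝ) ^ (s * m i)) *
        ‖∫ t, K.dilate (m i) (x i - t) * bumpSum (j i) (T i) t‖ₑ ≤
        ENNReal.ofReal C * ENNReal.ofReal ((2 : ℝ) ^ (s * j i)) *
          r ^ ((j i - m i) + (m i - j i)) := by
      intro i
      rw [← ofReal_norm, ← ENNReal.ofReal_mul (by positivity), hr, ← ENNReal.ofReal_pow hρ0.le,
        ← ENNReal.ofReal_mul hC, ← ENNReal.ofReal_mul (by positivity)]
      exact ENNReal.ofReal_le_ofReal (hb (m i) (j i) (T i) (hT i) (x i))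
    have h2 := Finset.prod_le_prod' fun i (_ : i ∈ Finset.univ) => h1 i
    rw [Finset.prod_mul_distrib, Finset.prod_mul_distrib, Finset.prod_mul_distrib,
      ← weight_eq_prod, ← weight_eq_prod, Finset.prod_const, Finset.card_univ,
      Fintype.card_fin] at h2
    rw [K.conv_tensorBump, enorm_mul, enorm_prod_eq, mul_left_comm, hW]
    refine (mul_le_mul_right h2 ‖c‖ₑ).trans (le_of_eq ?_)
    ring
  have hsum : (∑' m : Fin d → ℕ, (W * ∏ i, r ^ ((j i - m i) + (m i - j i))) ^ θ) ^ (1 / θ) ≤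
      W * G := by
    have h1 : ∀ m : Fin d → ℕ, (W * ∏ i, r ^ ((j i - m i) + (m i - j i))) ^ θ =
        W ^ θ * ∏ i, (r ^ θ) ^ ((j i - m i) + (m i - j i)) := by
      intro m
      rw [ENNReal.mul_rpow_of_nonneg _ _ hθ.le, ← ENNReal.prod_rpow_of_nonneg hθ.le]
      congr 1
      refine Finset.prod_congr rfl fun i _ => ?_
      rw [← ENNReal.rpow_natCast, ← ENNReal.rpow_natCast, ← ENNReal.rpow_mul, ← ENNReal.rpow_mul,
        mul_comm]
    simp_rw [h1]
    rw [ENNReal.tsum_mul_left, tsum_pi_prod fun i a => (r ^ θ) ^ ((j i - a) + (a - j i)),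
      ENNReal.mul_rpow_of_nonneg _ _ (by positivity), ← ENNReal.rpow_mul W,
      mul_one_div_cancel hθ.ne', ENNReal.rpow_one, hG]
    gcongr
    calc _ ≤ ∏ _i : Fin d, 2 * (1 - r ^ θ)⁻¹ :=
          Finset.prod_le_prod' fun i _ => tsum_pow_dist_le hrθ.le (j i)
      _ = _ := by rw [Finset.prod_const, Finset.card_univ, Fintype.card_fin]
  have hfin : (∑' m : Fin d → ℕ, (W * ∏ i, r ^ ((j i - m i) + (m i - j i))) ^ θ) ^ (1 / θ) * V ≤
      (ENNReal.ofReal C ^ d * G * V).toNNReal * (weight s j * ‖c‖ₑ) := by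
    rw [ENNReal.coe_toNNReal hMt]
    refine (mul_le_mul_left hsum V).trans (le_of_eq ?_)
    rw [hW]
    ring
  have h := K.norm_le_of_weight_mul_enorm_conv_le (hsupp _ (dsupport_toTemperedDistribution_subset
    (isClosed_unitCube d) fun x hx => tensorBump_eq_zero c hT hx)) hθ hB p
  exact ⟨h.1.trans hfin, h.2.trans hfin⟩

end LocalMeansKernel

end

end FrolovCubature

namespace FrolovCubature

noncomputable section

/-! ### Lower bounds for the worst-case error -/

theorem enorm_integral_le_worstCaseError {d n : ℕ} {N : 𝓢'(Rd d, ℂ) → ℝ≥0∞} {g : 𝓢(Rd d, ℂ)}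
    (hN : N (toTemperedDistributionCLM (Rd d) ℂ volume g) ≤ 1)
    (hg : ∀ x, x ∉ unitCube d → g x = 0) (hz : ∀ x ∈ frolovLattice d n ∩ halfOpenCube d, g x = 0) :
    ‖∫ x in unitCube d, g x‖ₑ ≤ worstCaseError n N := by
  refine le_trans ?_ (le_iSup₂ (f := fun (u : 𝓢'(Rd d, ℂ))
    (_ : u ∈ {u | u ∈ supportedSpace N ∧ N u ≤ 1}) => cubatureError n u) _
    ⟨⟨hN.trans_lt ENNReal.one_lt_top,
      dsupport_toTemperedDistribution_subset (isClosed_unitCube d) hg⟩, hN⟩)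
  refine le_iInf₂ fun f hf => ?_
  rw [hf.eq_of_toTemperedDistribution, frolovRule, finsum_mem_eq_zero_of_forall_eq_zero hz,
    mul_zero, sub_zero]

/-- For `2 ^ j` at least twice a multiple of `n`, half of the strips `2⁻ʲ [k, k + 1]` in a
coordinate direction avoid the points of Frolov's cubature formula. -/
theorem exists_strips {d : ℕ} (hd : 1 ≤ d) : ∃ C : ℝ, 1 ≤ C ∧ ∀ (n : ℕ) (_ : 0 < n) (j : ℕ)
    (_ : 2 * (C * n) ≤ 2 ^ j) (i : Fin d), ∃ S : Finset ℕ, S ⊆ Finset.range (2 ^ j) ∧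
      (2 : ℝ) ^ j / 2 ≤ S.card ∧
      ∀ x ∈ frolovLattice d n ∩ halfOpenCube d, ⌊(2 : ℝ) ^ j * x i⌋₊ ∉ S := by
  obtain ⟨C, hC⟩ := exists_tsum_indicator_box_le hd zero_le_one
  refine ⟨max 1 C, le_max_left _ _, fun n hn j hj i => ?_⟩
  set Z := (finite_frolovPoint_mem_box hd hn zero_le_one).toFinset with hZ
  have hcard : (Z.card : ℝ) ≤ C * n := by
    have h1 := (ENNReal.sum_le_tsum Z).trans (hC n hn 0)
    have h0 : ∀ z ∈ Z, (box d 1).indicator (fun _ => (1 : ℝ≥0∞)) (frolovPoint d n z - 0) = 1 := by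
      intro z hz
      rw [sub_zero]
      exact if_pos ((Set.Finite.mem_toFinset _).mp hz)
    rw [Finset.sum_congr rfl h0, Finset.sum_const, nsmul_eq_mul, mul_one] at h1
    have h2 : (Z.card : ℝ≥0) ≤ C * n := by exact_mod_cast h1
    exact_mod_cast h2
  -- Each node spoils at most one strip, and there are at most `C n ≤ 2^j / 2` nodes.
  set bad := Z.image fun z => ⌊(2 : ℝ) ^ j * frolovPoint d n z i⌋₊ with hbad
  refine ⟨Finset.range (2 ^ j) \ bad, Finset.sdiff_subset, ?_, ?_⟩
  · have h1 := Finset.le_card_sdiff bad (Finset.range (2 ^ j))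
    rw [Finset.card_range, tsub_le_iff_right] at h1
    have h2 : ((2 : ℝ) ^ j) ≤ (Finset.range (2 ^ j) \ bad).card + bad.card := by exact_mod_cast h1
    have h3 : (bad.card : ℝ) ≤ Z.card := by exact_mod_cast Finset.card_image_le
    have h4 : (C : ℝ) * n ≤ max 1 (C : ℝ) * n := by gcongr; exact le_max_right _ _
    linarith
  · rintro x ⟨⟨z, rfl⟩, hx⟩ hS
    refine (Finset.mem_sdiff.mp hS).2 (Finset.mem_image.mpr ⟨z, ?_, rfl⟩)
    rw [hZ, Set.Finite.mem_toFinset]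
    intro i
    have := hx i
    rw [← abs_of_nonneg this.1] at this
    exact this.2.le

/-- The fooling function oscillates in one coordinate only, at scale `2^{-j} ≈ 1/n`, on the strips
that avoid the nodes. Its norm costs `2^{sj} ≈ n^s`, while its integral before normalization stays
bounded below. -/
theorem asympLE_worstCaseError {d : ℕ} (hd : 1 ≤ d) {N : 𝓢'(Rd d, ℂ) → ℝ≥0∞} {s : ℝ} (hs : 0 < s)
    {M : ℝ≥0} (hN : ∀ (c : ℂ) (j : Fin d → ℕ) (T : Fin d → Finset ℕ)
      (hT : ∀ i, T i ⊆ Finset.range (2 ^ j i)),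
      N (toTemperedDistributionCLM (Rd d) ℂ volume (tensorBump c hT)) ≤
        M * (weight s j * ‖c‖ₑ)) :
    AsympLE (fun n => ENNReal.ofReal ((n : ℝ) ^ (-s))) (fun n => worstCaseError n N) := by
  obtain ⟨C, hC1, hC⟩ := exists_strips hd
  have hC0 : 0 < C := by linarith
  set I : ℝ := ∫ t, unitBump t with hI
  have hI0 : 0 < I := unitBump.integral_pos
  set κ : ℝ := 2 * (M + 1) * (4 * C) ^ s / I ^ d with hκ
  have hκ0 : 0 < κ := by positivity
  refine ⟨κ.toNNReal, Real.toNNReal_pos.mpr hκ0, fun n hn => ?_⟩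
  have hn0 : (0 : ℝ) < n := by exact_mod_cast (show 0 < n by omega)
  have hn1 : (1 : ℝ) ≤ n := by exact_mod_cast (show 1 ≤ n by omega)
  -- The scale satisfies `2 C n < 2^j ≤ 4 C n`: fine enough for half of the strips to be free, and
  -- coarse enough for the norm to be of order `n^s`.
  obtain ⟨j', hj1, hj2⟩ := exists_nat_pow_near (x := 2 * (C * n)) (y := 2)
    (by nlinarith [mul_le_mul hC1 hn1 zero_le_one hC0.le]) one_lt_two
  obtain ⟨j, hj⟩ : ∃ j, j = j' + 1 := ⟨_, rfl⟩
  have hjle : (2 : ℝ) ^ j ≤ 4 * C * n := by rw [hj, pow_succ]; linarith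
  rw [← hj] at hj2
  set i₀ : Fin d := ⟨0, hd⟩
  obtain ⟨S, hS, hScard, hSx⟩ := hC n (by omega) j hj2.le i₀
  -- In the other coordinates a single bump at scale `0` is used, so the weight is only `2^{sj}`.
  set J : Fin d → ℕ := fun i => if i = i₀ then j else 0 with hJ
  set T : Fin d → Finset ℕ := fun i => if i = i₀ then S else {0} with hTdef
  have hT : ∀ i, T i ⊆ Finset.range (2 ^ J i) := by
    intro i
    by_cases h : i = i₀ <;> simp [hJ, hTdef, h, hS]
  have hw : weight s J = ENNReal.ofReal ((2 : ℝ) ^ (s * j)) := by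
    rw [weight, ← Nat.cast_sum, hJ, Finset.sum_ite_eq' Finset.univ i₀]
    simp
  -- Normalization into the unit ball; `M + 1` avoids division by zero.
  set c : ℝ := ((M + 1) * (2 : ℝ) ^ (s * j))⁻¹ with hc
  have hc0 : 0 < c := by positivity
  have hNle : N (toTemperedDistributionCLM (Rd d) ℂ volume (tensorBump (c : ℂ) hT)) ≤ 1 := by
    refine (hN c J T hT).trans ?_
    rw [hw, ← ofReal_norm, Complex.norm_real, Real.norm_of_nonneg hc0.le,
      ← ENNReal.ofReal_coe_nnreal, ← ENNReal.ofReal_mul (by positivity),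
      ← ENNReal.ofReal_mul (by positivity), ENNReal.ofReal_le_one, hc, mul_inv,
      mul_left_comm ((2 : ℝ) ^ (s * j)), mul_inv_cancel₀ (by positivity), mul_one,
      ← div_eq_mul_inv, div_le_one (by positivity)]
    linarith
  have hz : ∀ x ∈ frolovLattice d n ∩ halfOpenCube d, tensorBump (c : ℂ) hT x = 0 := by
    intro x hx
    have h0 : bumpSum (J i₀) (T i₀) (x i₀) = 0 := by
      simp only [hJ, hTdef, if_true]
      exact bumpSum_eq_zero (hSx x hx)
    rw [tensorBump_apply, Finset.prod_eq_zero (Finset.mem_univ i₀) h0, mul_zero]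
  have hint : ∫ x in unitCube d, tensorBump (c : ℂ) hT x =
      ((c * ((S.card : ℝ) * ((2 : ℝ) ^ j)⁻¹ * I ^ d) : ℝ) : ℂ) := by
    have h1 : ∀ i, ((T i).card : ℂ) * ((2 : ℂ) ^ J i)⁻¹ * (I : ℂ) =
        (if i = i₀ then (S.card : ℂ) * ((2 : ℂ) ^ j)⁻¹ else 1) * (I : ℂ) := by
      intro i
      by_cases h : i = i₀ <;> simp [hJ, hTdef, h]
    rw [integral_tensorBump, ← hI, Finset.prod_congr rfl fun i _ => h1 i, Finset.prod_mul_distrib,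
      Finset.prod_ite_eq', if_pos (Finset.mem_univ _), Finset.prod_const, Finset.card_univ,
      Fintype.card_fin]
    push_cast
    ring
  have hmain := enorm_integral_le_worstCaseError (n := n) hNle
    (fun x hx => tensorBump_eq_zero _ hT hx) hz
  refine le_trans ?_ (mul_le_mul_right hmain _)
  rw [hint, ← ofReal_norm, Complex.norm_real, Real.norm_of_nonneg (by positivity)]
  change _ ≤ ENNReal.ofReal κ * _
  rw [← ENNReal.ofReal_mul hκ0.le]
  refine ENNReal.ofReal_le_ofReal ?_
  have hP : (0 : ℝ) < 2 ^ j := by positivity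
  have hhalf : (1 : ℝ) / 2 ≤ S.card * ((2 : ℝ) ^ j)⁻¹ := by
    rw [← div_eq_mul_inv, le_div_iff₀ hP]
    linarith
  have hpow : (2 : ℝ) ^ (s * j) ≤ (4 * C) ^ s * (n : ℝ) ^ s := by
    rw [mul_comm s, Real.rpow_mul two_pos.le, Real.rpow_natCast,
      ← Real.mul_rpow (by positivity) hn0.le]
    exact Real.rpow_le_rpow hP.le hjle hs.le
  calc (n : ℝ) ^ (-s) = κ * (((M + 1) * ((4 * C) ^ s * (n : ℝ) ^ s))⁻¹ * (1 / 2 * I ^ d)) := by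
        rw [Real.rpow_neg hn0.le, hκ]
        field_simp
    _ ≤ _ := by
        rw [hc]
        gcongr

end

end FrolovCubature

/-! ### The two-sided estimates combined -/

theorem corollary6p1 (d : ℕ) (hd : 1 ≤ d) (p : ℝ≥0∞) (hp : 1 ≤ p) (θ : ℝ) (hθ0 : 0 < θ)
    (hθ1 : θ < 1) (s : ℝ) (hs : (p⁻¹).toReal < s) (L : ℕ) (hL : s < (L : ℝ) + 1)
    (K : LocalMeansKernel L) :
    AsympEq (fun n => worstCaseError n (K.besovNorm (d := d) s p θ))
        (fun n => ENNReal.ofReal ((n : ℝ) ^ (-s))) ∧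
      (p ≠ ∞ → 1 ≤ s →
        AsympEq (fun n => worstCaseError n (K.triebelLizorkinNorm (d := d) s p θ))
          (fun n => ENNReal.ofReal ((n : ℝ) ^ (-s)))) ∧
      (p ≠ ∞ → s < 1 →
        AsympLE (fun n => worstCaseError n (K.triebelLizorkinNorm (d := d) s p θ))
          (fun n => ENNReal.ofReal
            ((n : ℝ) ^ (-s) * Real.log n ^ (((d : ℝ) - 1) * (1 - s))))) := by
  have hs0 : 0 < s := ENNReal.toReal_nonneg.trans_lt hs
  obtain ⟨M, hM⟩ := K.exists_norm_tensorBump_le (d := d) hs0 hL hθ0 p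
  exact ⟨⟨K.asympLE_besov hd hp hs hθ0 hθ1,
      asympLE_worstCaseError hd hs0 fun c j T hT => (hM c j T hT).1⟩,
    fun hpt hs1 => ⟨K.asympLE_triebelLizorkin hd hp hs hθ0 hθ1 hs1,
      asympLE_worstCaseError hd hs0 fun c j T hT => (hM c j T hT).2⟩,
    fun hpt hs1 => K.asympLE_triebelLizorkin_log hd hp hpt hs hθ0 hθ1 hs1⟩
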